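/- For $k\in\mathbb R$ let $\mathfrak h(k)=-\partial_x^2+(x-k)^2$ be the self-adjoint operator in $L^2(0,\infty)$ with Dirichlet boundary condition at $x=0$, that is, with domain $\{u\in H^1_0(0,\infty)\cap H^2(0,\infty) : x^2u\in L^2(0,\infty)\}$. Let $\lambda_1(k)\le\lambda_2(k)\le\dots$ be its eigenvalues, arranged in non-decreasing order and counted with multiplicity, and put $E_n=2n-1$. Then for every integer $n\ge 1$ there is a constant $\gamma_n>0$ such that, as $k\to+\infty$, (i) $\lambda_n(k)=E_n+2^{2n-1}\gamma_n^2\,k^{2n-1}e^{-k^2}\bigl(1+\mathcal O(k^{-2})\bigr)$, and (ii) $\lambda_n$ is differentiable at all sufficiently large $k$, with $\lambda_n'(k)=-2^{2n}\gamma_n^2\,k^{2n}e^{-k^2}\bigl(1+\mathcal O(k^{-2})\bigr)$, with the same constant $\gamma_n$ in (i) and (ii). -/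

import Mathlib

open MeasureTheory Filter Set Asymptotics Topology
open scoped Distributions

namespace HalfLine

/-- The open half-line `(0, ∞)`. -/
abbrev halfLine : TopologicalSpace.Opens ℝ := ⟨Ioi 0, isOpen_Ioi⟩

/-- The complex Hilbert space `L²(0, ∞)`. -/
abbrev L2 : Type := Lp ℂ 2 (volume.restrict (Ioi (0 : ℝ)))

/-- Smooth complex functions with compact support contained in `(0, ∞)`. -/
abbrev Test : Type := 𝓓(halfLine, ℂ)

theorem contDiff_test (φ : Test) : ContDiff ℝ 2 φ :=
  φ.contDiff.of_le (WithTop.coe_le_coe.2 (le_top : (2 : ℕ∞) ≤ ⊤))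

theorem differentiable_test (φ : Test) : Differentiable ℝ φ :=
  (contDiff_test φ).differentiable (by norm_num)

theorem memLp_test (φ : Test) : MemLp φ 2 (volume.restrict (Ioi (0 : ℝ))) :=
  (φ.continuous.memLp_of_hasCompactSupport φ.hasCompactSupport).restrict _

theorem memLp_deriv_test (φ : Test) :
    MemLp (deriv φ) 2 (volume.restrict (Ioi (0 : ℝ))) :=
  (((contDiff_test φ).continuous_deriv (by norm_num)).memLp_of_hasCompactSupport
    φ.hasCompactSupport.deriv).restrict _

theorem integrable_test_mul (φ : Test) (u : L2) :
    Integrable (fun x => φ x * u x) (volume.restrict (Ioi (0 : ℝ))) :=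
  (memLp_test φ).integrable_mul (Lp.memLp u)

theorem integrable_deriv_test_mul (φ : Test) (u : L2) :
    Integrable (fun x => deriv φ x * u x) (volume.restrict (Ioi (0 : ℝ))) :=
  (memLp_deriv_test φ).integrable_mul (Lp.memLp u)

/-- The pairs `(u, v)` of elements of `L²(0, ∞)` such that `v` is the weak derivative of `u` on
`(0, ∞)`. -/
def weakDerivGraph : Submodule ℂ (L2 × L2) where
  carrier := {p | ∀ φ : Test,
    ∫ x in Ioi (0 : ℝ), deriv φ x * p.1 x = -∫ x in Ioi (0 : ℝ), φ x * p.2 x}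
  zero_mem' := by
    intro φ
    have h0 : (((0 : L2 × L2).1 : L2) : ℝ → ℂ) =ᵐ[volume.restrict (Ioi (0 : ℝ))] 0 :=
      Lp.coeFn_zero ..
    have h1 : (((0 : L2 × L2).2 : L2) : ℝ → ℂ) =ᵐ[volume.restrict (Ioi (0 : ℝ))] 0 :=
      Lp.coeFn_zero ..
    rw [integral_eq_zero_of_ae, integral_eq_zero_of_ae, neg_zero]
    · filter_upwards [h1] with x hx
      rw [hx, Pi.zero_apply, mul_zero]
    · filter_upwards [h0] with x hx
      rw [hx, Pi.zero_apply, mul_zero]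
  add_mem' := by
    intro p q hp hq φ
    have e1 : ∫ x in Ioi (0 : ℝ), deriv φ x * (p + q).1 x =
        ∫ x in Ioi (0 : ℝ), (deriv φ x * p.1 x + deriv φ x * q.1 x) := by
      refine integral_congr_ae ?_
      filter_upwards [Lp.coeFn_add p.1 q.1] with x hx
      rw [Prod.fst_add, hx, Pi.add_apply, mul_add]
    have e2 : ∫ x in Ioi (0 : ℝ), φ x * (p + q).2 x =
        ∫ x in Ioi (0 : ℝ), (φ x * p.2 x + φ x * q.2 x) := by
      refine integral_congr_ae ?_
      filter_upwards [Lp.coeFn_add p.2 q.2] with x hx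
      rw [Prod.snd_add, hx, Pi.add_apply, mul_add]
    rw [e1, e2, integral_add (integrable_deriv_test_mul φ _) (integrable_deriv_test_mul φ _),
      integral_add (integrable_test_mul φ _) (integrable_test_mul φ _), hp φ, hq φ]
    ring
  smul_mem' := by
    intro c p hp φ
    have e1 : ∫ x in Ioi (0 : ℝ), deriv φ x * (c • p).1 x =
        ∫ x in Ioi (0 : ℝ), c * (deriv φ x * p.1 x) := by
      refine integral_congr_ae ?_
      filter_upwards [Lp.coeFn_smul c p.1] with x hx
      rw [Prod.smul_fst, hx, Pi.smul_apply, smul_eq_mul]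
      ring
    have e2 : ∫ x in Ioi (0 : ℝ), φ x * (c • p).2 x =
        ∫ x in Ioi (0 : ℝ), c * (φ x * p.2 x) := by
      refine integral_congr_ae ?_
      filter_upwards [Lp.coeFn_smul c p.2] with x hx
      rw [Prod.smul_snd, hx, Pi.smul_apply, smul_eq_mul]
      ring
    rw [e1, e2, integral_const_mul, integral_const_mul, hp φ]
    ring

/-- Weak derivatives are unique. -/
theorem weakDerivGraph_functional (p : L2 × L2) (hp : p ∈ weakDerivGraph) (h0 : p.1 = 0) :
    p.2 = 0 := by
  have key : ∀ φ : Test, ∫ x in Ioi (0 : ℝ), φ x * p.2 x = 0 := by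
    intro φ
    have h1 := hp φ
    rw [integral_eq_zero_of_ae] at h1
    · simpa using h1.symm
    · rw [h0]
      filter_upwards [Lp.coeFn_zero ℂ 2 (volume.restrict (Ioi (0 : ℝ)))] with x hx
      rw [hx, Pi.zero_apply, mul_zero]
  have hae : ∀ᵐ x ∂(volume.restrict (Ioi (0 : ℝ))), x ∈ Ioi (0 : ℝ) → p.2 x = 0 := by
    refine isOpen_Ioi.ae_eq_zero_of_integral_contDiff_smul_eq_zero ?_ ?_
    · exact ((Lp.memLp p.2).locallyIntegrable (by norm_num)).locallyIntegrableOn _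
    · intro g hg hgc hgs
      have hs : tsupport (fun x => (g x : ℂ)) ⊆ tsupport g :=
        closure_mono fun x hx => by
          intro h
          exact hx (by simp [h])
      have := key ⟨fun x => (g x : ℂ), Complex.ofRealCLM.contDiff.comp hg,
        hgc.comp_left (g := fun r : ℝ => (r : ℂ)) (by simp), hs.trans hgs⟩
      simp only [Complex.real_smul]
      exact this
  refine (Lp.eq_zero_iff_ae_eq_zero).2 ?_
  filter_upwards [hae, ae_restrict_mem measurableSet_Ioi] with x hx hx0 using hx hx0

/-- The weak derivative as an unbounded operator in `L²(0, ∞)`, with domain `H¹(0, ∞)`. -/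
noncomputable def weakDeriv : L2 →ₗ.[ℂ] L2 := weakDerivGraph.toLinearPMap

theorem weakDeriv_graph : weakDeriv.graph = weakDerivGraph :=
  Submodule.toLinearPMap_graph_eq _ weakDerivGraph_functional

/-- The Sobolev space `H¹(0, ∞)`. -/
noncomputable def H1 : Submodule ℂ L2 := weakDeriv.domain

/-- The Sobolev space `H²(0, ∞)`. -/
noncomputable def H2 : Submodule ℂ L2 where
  carrier := {u | ∃ hu : u ∈ H1, weakDeriv ⟨u, hu⟩ ∈ H1}
  zero_mem' := ⟨zero_mem _, by
    rw [show (⟨0, zero_mem H1⟩ : weakDeriv.domain) = 0 from rfl, weakDeriv.map_zero]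
    exact zero_mem _⟩
  add_mem' := by
    rintro u v ⟨hu, hu'⟩ ⟨hv, hv'⟩
    refine ⟨add_mem hu hv, ?_⟩
    rw [show (⟨u + v, add_mem hu hv⟩ : weakDeriv.domain) = ⟨u, hu⟩ + ⟨v, hv⟩ from rfl,
      weakDeriv.map_add]
    exact add_mem hu' hv'
  smul_mem' := by
    rintro c u ⟨hu, hu'⟩
    refine ⟨H1.smul_mem c hu, ?_⟩
    rw [show (⟨c • u, H1.smul_mem c hu⟩ : weakDeriv.domain) = c • ⟨u, hu⟩ from rfl,
      weakDeriv.map_smul]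
    exact H1.smul_mem c hu'

/-- The pairs `(φ, φ')` with `φ` smooth and compactly supported in `(0, ∞)`. -/
def testGraph : Submodule ℂ (L2 × L2) where
  carrier := {p | ∃ φ : Test, p.1 =ᵐ[volume.restrict (Ioi (0 : ℝ))] φ ∧
    p.2 =ᵐ[volume.restrict (Ioi (0 : ℝ))] deriv φ}
  zero_mem' := by
    have hd : deriv ((0 : Test) : ℝ → ℂ) = 0 := by
      ext x
      exact deriv_const x (0 : ℂ)
    refine ⟨0, Lp.coeFn_zero .., ?_⟩
    rw [hd]
    exact Lp.coeFn_zero ..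
  add_mem' := by
    rintro p q ⟨φ, h1, h2⟩ ⟨ψ, h3, h4⟩
    refine ⟨φ + ψ, ?_, ?_⟩
    · filter_upwards [h1, h3, Lp.coeFn_add p.1 q.1] with x a b c
      rw [Prod.fst_add, c, Pi.add_apply, a, b]
      rfl
    · filter_upwards [h2, h4, Lp.coeFn_add p.2 q.2] with x a b c
      rw [Prod.snd_add, c, Pi.add_apply, a, b]
      exact (deriv_add (differentiable_test φ x) (differentiable_test ψ x)).symm
  smul_mem' := by
    rintro c p ⟨φ, h1, h2⟩
    refine ⟨c • φ, ?_, ?_⟩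
    · filter_upwards [h1, Lp.coeFn_smul c p.1] with x a b
      rw [Prod.smul_fst, b, Pi.smul_apply, a]
      rfl
    · filter_upwards [h2, Lp.coeFn_smul c p.2] with x a b
      rw [Prod.smul_snd, b, Pi.smul_apply, a]
      exact (deriv_const_smul c (differentiable_test φ x)).symm

/-- The Sobolev space `H¹₀(0, ∞)`, the closure of the test functions in the `H¹` norm: `u` belongs
to it iff for some `v` (then necessarily the weak derivative of `u`) there are test functions `φⱼ`
with `φⱼ → u` and `φⱼ' → v` in `L²(0, ∞)`. -/
noncomputable def H10 : Submodule ℂ L2 :=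
  testGraph.topologicalClosure.map (LinearMap.fst ℂ L2 L2)

/-- The domain of multiplication by `x²` in `L²(0, ∞)`. -/
def sqWeighted : Submodule ℂ L2 where
  carrier := {u | MemLp (fun x : ℝ => (x : ℂ) ^ 2 * u x) 2 (volume.restrict (Ioi (0 : ℝ)))}
  zero_mem' := by
    refine (MemLp.zero (ε := ℂ)).ae_eq ?_
    filter_upwards [Lp.coeFn_zero ℂ 2 (volume.restrict (Ioi (0 : ℝ)))] with x hx
    rw [hx, Pi.zero_apply, mul_zero]
  add_mem' := by
    intro u v hu hv
    refine (hu.add hv).ae_eq ?_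
    filter_upwards [Lp.coeFn_add u v] with x hx
    rw [hx, Pi.add_apply, Pi.add_apply, mul_add]
  smul_mem' := by
    intro c u hu
    refine (hu.const_smul c).ae_eq ?_
    filter_upwards [Lp.coeFn_smul c u] with x hx
    rw [hx, Pi.smul_apply, Pi.smul_apply, smul_eq_mul, smul_eq_mul]
    ring

/-- If `u` and `x² u` are square integrable on `(0, ∞)`, then so is `(x - k)² u`. -/
theorem memLp_potential (k : ℝ) {u : L2} (hu : u ∈ sqWeighted) :
    MemLp (fun x : ℝ => ((x : ℂ) - k) ^ 2 * u x) 2 (volume.restrict (Ioi (0 : ℝ))) := by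
  have hu' : MemLp (fun x : ℝ => (x : ℂ) ^ 2 * u x) 2 (volume.restrict (Ioi (0 : ℝ))) := hu
  have hb : MemLp (fun x : ℝ => 2 * ‖(x : ℂ) ^ 2 * u x‖ + 2 * k ^ 2 * ‖u x‖) 2
      (volume.restrict (Ioi (0 : ℝ))) :=
    (hu'.norm.const_mul 2).add ((Lp.memLp u).norm.const_mul (2 * k ^ 2))
  refine hb.of_le ?_ ?_
  · exact (Continuous.aestronglyMeasurable (by fun_prop)).mul (Lp.aestronglyMeasurable u)
  · refine Eventually.of_forall fun x => ?_
    have h1 : ‖((x : ℂ) - k) ^ 2 * u x‖ = (x - k) ^ 2 * ‖u x‖ := by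
      rw [norm_mul, norm_pow, ← Complex.ofReal_sub, Complex.norm_real, Real.norm_eq_abs, sq_abs]
    have h2 : ‖(x : ℂ) ^ 2 * u x‖ = x ^ 2 * ‖u x‖ := by
      rw [norm_mul, norm_pow, Complex.norm_real, Real.norm_eq_abs, sq_abs]
    rw [h1, h2, Real.norm_eq_abs]
    refine le_trans ?_ (le_abs_self _)
    nlinarith [norm_nonneg (u x), mul_nonneg (sq_nonneg (x + k)) (norm_nonneg (u x))]

/-- The common domain `{u ∈ H¹₀(0, ∞) ∩ H²(0, ∞) : x² u ∈ L²(0, ∞)}` of the operators `h(k)`. -/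
noncomputable def hDomain : Submodule ℂ L2 := H10 ⊓ H2 ⊓ sqWeighted

/-- The self-adjoint operator `h(k) = -∂ₓ² + (x - k)²` in `L²(0, ∞)` with Dirichlet boundary
condition at `0`. -/
noncomputable def h (k : ℝ) : L2 →ₗ.[ℂ] L2 where
  domain := hDomain
  toFun :=
    { toFun := fun u =>
        -weakDeriv ⟨weakDeriv ⟨u, u.2.1.2.choose⟩, u.2.1.2.choose_spec⟩ +
          (memLp_potential k u.2.2).toLp (fun x : ℝ => ((x : ℂ) - k) ^ 2 * (u : L2) x)
      map_add' := by
        intro u v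
        have hu := u.2.1.2
        have hv := v.2.1.2
        have e1 : weakDeriv ⟨weakDeriv ⟨(u + v : hDomain), (u + v).2.1.2.choose⟩,
            (u + v).2.1.2.choose_spec⟩ =
            weakDeriv ⟨weakDeriv ⟨u, hu.choose⟩, hu.choose_spec⟩ +
              weakDeriv ⟨weakDeriv ⟨v, hv.choose⟩, hv.choose_spec⟩ := by
          rw [← weakDeriv.map_add]
          congr 1
          ext1
          exact weakDeriv.map_add ⟨u, hu.choose⟩ ⟨v, hv.choose⟩
        have e2 : (memLp_potential k (u + v).2.2).toLp
              (fun x : ℝ => ((x : ℂ) - k) ^ 2 * ((u + v : hDomain) : L2) x) =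
            (memLp_potential k u.2.2).toLp (fun x : ℝ => ((x : ℂ) - k) ^ 2 * (u : L2) x) +
              (memLp_potential k v.2.2).toLp
                (fun x : ℝ => ((x : ℂ) - k) ^ 2 * (v : L2) x) := by
          rw [← MemLp.toLp_add, MemLp.toLp_eq_toLp_iff]
          filter_upwards [Lp.coeFn_add (u : L2) (v : L2)] with x hx
          rw [Submodule.coe_add, hx, Pi.add_apply, Pi.add_apply, mul_add]
        rw [e1, e2]
        abel
      map_smul' := by
        intro c u
        have hu := u.2.1.2
        have e1 : weakDeriv ⟨weakDeriv ⟨(c • u : hDomain), (c • u).2.1.2.choose⟩,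
            (c • u).2.1.2.choose_spec⟩ =
            c • weakDeriv ⟨weakDeriv ⟨u, hu.choose⟩, hu.choose_spec⟩ := by
          rw [← weakDeriv.map_smul]
          congr 1
          ext1
          exact weakDeriv.map_smul c ⟨u, hu.choose⟩
        have e2 : (memLp_potential k (c • u).2.2).toLp
              (fun x : ℝ => ((x : ℂ) - k) ^ 2 * ((c • u : hDomain) : L2) x) =
            c • (memLp_potential k u.2.2).toLp
              (fun x : ℝ => ((x : ℂ) - k) ^ 2 * (u : L2) x) := by
          rw [← MemLp.toLp_const_smul, MemLp.toLp_eq_toLp_iff]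
          filter_upwards [Lp.coeFn_smul c (u : L2)] with x hx
          rw [Submodule.coe_smul, hx, Pi.smul_apply, Pi.smul_apply, smul_eq_mul, smul_eq_mul]
          ring
        rw [e1, e2, RingHom.id_apply, smul_add, smul_neg] }

/-- The eigenspace `ker (h(k) - ν)`; the number `ν` is an eigenvalue of `h(k)` iff it is not `⊥`. -/
noncomputable def eigenspace (k ν : ℝ) : Submodule ℂ L2 where
  carrier := {u | ∃ hu : u ∈ (h k).domain, h k ⟨u, hu⟩ = (ν : ℂ) • u}
  zero_mem' := ⟨zero_mem _, by
    rw [show (⟨0, zero_mem _⟩ : (h k).domain) = 0 from rfl, (h k).map_zero, smul_zero]⟩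
  add_mem' := by
    rintro u v ⟨hu, hu'⟩ ⟨hv, hv'⟩
    refine ⟨add_mem hu hv, ?_⟩
    rw [show (⟨u + v, add_mem hu hv⟩ : (h k).domain) = ⟨u, hu⟩ + ⟨v, hv⟩ from rfl,
      (h k).map_add, hu', hv', smul_add]
  smul_mem' := by
    rintro c u ⟨hu, hu'⟩
    refine ⟨(h k).domain.smul_mem c hu, ?_⟩
    rw [show (⟨c • u, (h k).domain.smul_mem c hu⟩ : (h k).domain) = c • ⟨u, hu⟩ from rfl,
      (h k).map_smul, hu', smul_comm]

/-- The number of eigenvalues of `h(k)` in `(-∞, μ]`, counted with multiplicity: the dimension of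
the span of the eigenspaces for these eigenvalues. -/
noncomputable def eigenvalueCount (k μ : ℝ) : Cardinal :=
  Module.rank ℂ (⨆ ν ∈ Iic μ, eigenspace k ν : Submodule ℂ L2)

/-- The `n`-th band function `λₙ(k)` for `n ≥ 1`: the `n`-th eigenvalue of `h(k)`, where the
eigenvalues are arranged in non-decreasing order and repeated according to multiplicity; it is the
least `μ` such that at least `n` eigenvalues lie in `(-∞, μ]`. -/
noncomputable def bandFunction (n : ℕ) (k : ℝ) : ℝ :=
  sInf {μ : ℝ | (n : Cardinal) ≤ eigenvalueCount k μ}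

/-- The `n`-th Landau level `Eₙ = 2n - 1`. -/
def landauLevel (n : ℕ) : ℝ := 2 * n - 1

end HalfLine

/-!
With `D s x = exp (-x²/2) J s x` the parabolic cylinder function that decays at `+∞` and solves
`-y'' + x² y = (1 - 2 s) y`, the functions `x ↦ D s (x - k)` are the only candidates for
eigenfunctions of `h(k)`, and the Dirichlet condition reads `J s (-k) = 0`. So the eigenvalues are
the numbers `1 - 2 s` for the zeros `s` of `s ↦ J s (-k)` (`eigenfunction_mem_eigenspace`,
`exists_smul_of_mem_eigenspace`), all simple.

The zeros are located by Hermite polynomials: `J (-m)` is the monic Hermite polynomial of degree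
`m`, so for large `k` the signs of the first few `J (-j) (-k)` alternate, and a sign-change argument
(`exists_unique_order`) gives exactly one zero between `-(m + 1)` and `-m`. At a zero
`s` the Wronskian of `D s` and `D t`, for `t` near `s`, shows in which direction `t ↦ J t (-k)`
crosses zero: this depends only on the sign of `J (s + 1) (-k)`, which is known inductively. Hence
`λ_{m+1}(k) = 1 - 2 S(k)` for the branch `S` of zeros in that interval (`isBranch_bandFunction`),
and `λ_{m+1}(k) - E_{m+1} = δ` with `δ = 2 (-m - S(k)) > 0`.

For the asymptotics let `u = D S(k)` and let `h = D (-m)` be the Hermite function. The Wronskian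
of `u` and `h` at `x` equals `δ ∫ₓ^∞ u h`, so `ζ = u / h` satisfies `ζ' = δ (∫ₓ^∞ u h) / h²`.
It vanishes at `-k` and is close to `1` at a fixed point `-K`. As `∫ₓ^∞ u h` is close to `‖h‖²`
where `h⁻²` is large, integrating from `-k` to `-K` gives `1 ≈ δ ‖h‖² ∫ h⁻²`, and the Laplace
asymptotics `∫ h⁻² ≈ h(-k)⁻² / (2 k)` (`exists_integral_invSq_bounds`) yields
`δ ≈ 2 k h(-k)² / ‖h‖²`, all with relative errors `O(k⁻²)` (`IsBranch.comparison`,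
`IsBranch.asymptotics`). Since `h(-k)² ≈ k^(2 m) exp (-k²)`, this is the expansion of the band
function, with `γ² = 1 / (2^(2 m) ‖h‖²)`.

The derivative comes from the exact formula `S'(k) = u'(-k)² / (2 ∫_{-k}^∞ u²)`
(`IsBranch.hasDerivAt`), in which `u'(-k) h(-k) = δ ∫_{-k}^∞ u h` is again a Wronskian, and both
overlap integrals tend to `‖h‖²`.

On the side of operator theory, elements of `H¹(0, ∞)` are shown to be primitives of their weak
derivatives (`exists_eq_const_add_primitive`), with value `0` at the origin on `H¹₀(0, ∞)`
(`eq_primitive_of_mem_closure`); conversely, regular functions vanishing at the origin belong to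
`H¹₀(0, ∞)` by a separation argument (`mem_closure_testGraph`). Eigenfunctions are then classical
solutions, whose Wronskian with the decaying solution is constant and integrable, hence zero.
-/

namespace HalfLine

/-! ### Gaussian Mellin integrals -/

/-- The Gaussian Mellin integral `∫₀^∞ t^(s-1) exp(-t²/4 - x t) dt`. -/
noncomputable def gaussMellin (s x : ℝ) : ℝ :=
  ∫ t in Ioi (0 : ℝ), t ^ (s - 1) * Real.exp (-t ^ 2 / 4 - x * t)

theorem integrableOn_gaussMellin {s : ℝ} (hs : 0 < s) (x : ℝ) :
    IntegrableOn (fun t : ℝ => t ^ (s - 1) * Real.exp (-t ^ 2 / 4 - x * t)) (Ioi 0) := by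
  have h := (integrableOn_rpow_mul_exp_neg_mul_sq (b := 1 / 8) (by norm_num)
    (s := s - 1) (by linarith)).const_mul (Real.exp (2 * x ^ 2))
  refine Integrable.mono' h ?_ ?_
  · refine (ContinuousOn.mul ?_ (by fun_prop)).aestronglyMeasurable measurableSet_Ioi
    exact continuousOn_id.rpow_const fun t ht => Or.inl (ne_of_gt ht)
  · filter_upwards [ae_restrict_mem measurableSet_Ioi] with t ht
    have ht0 : 0 < t := ht
    rw [Real.norm_of_nonneg (by positivity), mul_left_comm, ← Real.exp_add]
    gcongr
    nlinarith [sq_nonneg (t + 4 * x)]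

theorem gaussMellin_pos {s : ℝ} (hs : 0 < s) (x : ℝ) : 0 < gaussMellin s x := by
  refine (setIntegral_pos_iff_support_of_nonneg_ae ?_ (integrableOn_gaussMellin hs x)).2 ?_
  · filter_upwards [ae_restrict_mem measurableSet_Ioi] with t ht
    have ht0 : 0 < t := ht
    positivity
  · have : (Function.support fun t : ℝ => t ^ (s - 1) * Real.exp (-t ^ 2 / 4 - x * t)) ∩ Ioi 0
        = Ioi 0 := by
      refine inter_eq_right.2 fun t ht => ?_
      have ht0 : 0 < t := ht
      exact ne_of_gt (by positivity)
    rw [this]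
    simp

theorem gaussMellin_anti {s x y : ℝ} (hs : 0 < s) (hxy : x ≤ y) :
    gaussMellin s y ≤ gaussMellin s x := by
  refine setIntegral_mono_on (integrableOn_gaussMellin hs y) (integrableOn_gaussMellin hs x)
    measurableSet_Ioi fun t ht => ?_
  have ht0 : 0 < t := ht
  gcongr

theorem hasDerivAt_gaussMellin {s : ℝ} (hs : 0 < s) (x : ℝ) :
    HasDerivAt (gaussMellin s) (-gaussMellin (s + 1) x) x := by
  have key := hasDerivAt_integral_of_dominated_loc_of_deriv_le (μ := volume.restrict (Ioi (0 : ℝ)))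
    (F := fun x t : ℝ => t ^ (s - 1) * Real.exp (-t ^ 2 / 4 - x * t))
    (F' := fun x t : ℝ => -(t ^ (s + 1 - 1) * Real.exp (-t ^ 2 / 4 - x * t)))
    (bound := fun t : ℝ => t ^ (s + 1 - 1) * Real.exp (-t ^ 2 / 4 - (x - 1) * t))
    (x₀ := x) (s := Ioi (x - 1)) (Ioi_mem_nhds (by linarith))
    (Eventually.of_forall fun y => (integrableOn_gaussMellin hs y).aestronglyMeasurable)
    (integrableOn_gaussMellin hs x)
    (integrableOn_gaussMellin (by linarith : 0 < s + 1) x).aestronglyMeasurable.neg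
    ?_ (integrableOn_gaussMellin (by linarith : 0 < s + 1) (x - 1)) ?_
  · have h2 := key.2
    rw [integral_neg] at h2
    exact h2
  · filter_upwards [ae_restrict_mem measurableSet_Ioi] with t ht y hy
    have ht0 : 0 < t := ht
    have hy0 : x - 1 < y := hy
    rw [norm_neg, Real.norm_of_nonneg (by positivity)]
    gcongr
  · filter_upwards [ae_restrict_mem measurableSet_Ioi] with t ht y hy
    have ht0 : 0 < t := ht
    have h1 : HasDerivAt (fun y : ℝ => -t ^ 2 / 4 - y * t) (-(1 * t)) y :=
      ((hasDerivAt_id y).mul_const t).const_sub _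
    refine (h1.exp.const_mul (t ^ (s - 1))).congr_deriv ?_
    rw [show s + 1 - 1 = (s - 1) + 1 by ring, Real.rpow_add_one ht0.ne']
    ring

/-- Integration by parts in the Gaussian Mellin integral. -/
theorem gaussMellin_recurrence {s : ℝ} (hs : 0 < s) (x : ℝ) :
    s * gaussMellin s x = gaussMellin (s + 2) x / 2 + x * gaussMellin (s + 1) x := by
  set f : ℝ → ℝ := fun t => t ^ s * Real.exp (-t ^ 2 / 4 - x * t) with hf
  have i0 := integrableOn_gaussMellin hs x
  have i1 := integrableOn_gaussMellin (by linarith : 0 < s + 1) x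
  have i2 := integrableOn_gaussMellin (by linarith : 0 < s + 2) x
  have hd : ∀ t ∈ Ioi (0 : ℝ), HasDerivAt f
      (s * (t ^ (s - 1) * Real.exp (-t ^ 2 / 4 - x * t)) -
        (1 / 2 * (t ^ (s + 2 - 1) * Real.exp (-t ^ 2 / 4 - x * t)) +
          x * (t ^ (s + 1 - 1) * Real.exp (-t ^ 2 / 4 - x * t)))) t := by
    intro t ht
    have ht0 : 0 < t := ht
    have h1 : HasDerivAt (fun t : ℝ => -t ^ 2 / 4 - x * t) (-(2 * t) / 4 - x * 1) t := by
      have := ((hasDerivAt_pow 2 t).neg.div_const 4).sub ((hasDerivAt_id t).const_mul x)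
      exact this.congr_deriv (by norm_num)
    have h2 := (Real.hasDerivAt_rpow_const (p := s) (Or.inl ht0.ne')).mul h1.exp
    refine h2.congr_deriv ?_
    rw [show s + 2 - 1 = s + 1 by ring, show s + 1 - 1 = s by ring, Real.rpow_add_one ht0.ne']
    ring
  have hint := (i0.const_mul s).sub ((i2.const_mul (1 / 2)).add (i1.const_mul x))
  have hcont : ContinuousWithinAt f (Ici 0) 0 := by
    refine ContinuousAt.continuousWithinAt ?_
    exact (Real.continuousAt_rpow_const _ _ (Or.inr hs.le)).mul (by fun_prop)
  have hlim : Tendsto f atTop (𝓝 0) := by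
    have h1 := tendsto_rpow_abs_mul_exp_neg_mul_sq_cocompact (a := 1 / 8) (by norm_num) s
    have h2 := ((h1.mono_left atTop_le_cocompact).const_mul (Real.exp (2 * x ^ 2)))
    rw [mul_zero] at h2
    refine squeeze_zero' ?_ ?_ h2
    · filter_upwards [eventually_gt_atTop 0] with t ht
      positivity
    · filter_upwards [eventually_gt_atTop 0] with t ht
      rw [abs_of_pos ht, mul_left_comm, ← Real.exp_add]
      simp only [hf]
      gcongr
      nlinarith [sq_nonneg (t + 4 * x)]
  have h := integral_Ioi_of_hasDerivAt_of_tendsto hcont hd hint hlim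
  have e1 := integral_sub (i0.const_mul s) ((i2.const_mul (1 / 2)).add (i1.const_mul x))
  have e2 := integral_add (i2.const_mul (1 / 2)) (i1.const_mul x)
  simp only [Pi.add_apply] at e1
  rw [e1, e2, integral_const_mul, integral_const_mul, integral_const_mul] at h
  have hf0 : f 0 = 0 := by simp [hf, Real.zero_rpow hs.ne']
  rw [hf0] at h
  unfold gaussMellin
  linarith

/-- By convexity of `s ↦ t^(s-1)`, this power is Lipschitz at `σ`, with a constant given by the
powers at two nearby exponents. -/
theorem abs_rpow_sub_rpow_le {t σ s r : ℝ} (ht : 0 < t) (hr : 0 < r) (hs : |s - σ| ≤ r) :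
    |t ^ (s - 1) - t ^ (σ - 1)| ≤ |s - σ| / r * (t ^ (σ - r - 1) + t ^ (σ + r - 1)) := by
  have hconv : ConvexOn ℝ univ fun y : ℝ => t ^ y := by
    have h1 : ConvexOn ℝ univ fun y : ℝ => Real.exp (Real.log t * y) := by
      have := convexOn_exp.comp_linearMap (LinearMap.mulLeft ℝ (Real.log t))
      simpa [Function.comp_def] using this
    refine h1.congr fun y _ => ?_
    simp [Real.rpow_def_of_pos ht]
  set θ := |s - σ| / r with hθ
  have hθ0 : 0 ≤ θ := by positivity
  have hθ1 : θ ≤ 1 := (div_le_one hr).2 hs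
  have hθr : θ * r = |s - σ| := by rw [hθ]; field_simp
  have p1 : 0 < t ^ (σ - r - 1) := by positivity
  have p2 : 0 < t ^ (σ + r - 1) := by positivity
  have p3 : 0 < t ^ (s - 1) := by positivity
  have p4 : 0 < t ^ (σ - 1) := by positivity
  have conv : ∀ a b θ : ℝ, 0 ≤ θ → θ ≤ 1 →
      t ^ ((1 - θ) * a + θ * b) ≤ (1 - θ) * t ^ a + θ * t ^ b := by
    intro a b θ h0 h1
    have := hconv.2 (mem_univ a) (mem_univ b) (by linarith : 0 ≤ 1 - θ) h0 (by ring)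
    simpa using this
  have q1 : 0 < 1 + θ := by linarith
  -- `σ` is a convex combination of `s` and the opposite end point, with weight `θ / (1 + θ)`.
  have w0 : 0 ≤ θ / (1 + θ) := by positivity
  have w1 : θ / (1 + θ) ≤ 1 := (div_le_one q1).2 (by linarith)
  have w2 : θ / (1 + θ) * (1 + θ) = θ := by field_simp
  rcases le_total σ s with h | h
  · rw [abs_of_nonneg (by linarith : (0 : ℝ) ≤ s - σ)] at hθr
    have c1 := conv (σ - 1) (σ + r - 1) θ hθ0 hθ1
    rw [show (1 - θ) * (σ - 1) + θ * (σ + r - 1) = s - 1 by linarith] at c1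
    have c2 := conv (s - 1) (σ - r - 1) (θ / (1 + θ)) w0 w1
    rw [show (1 - θ / (1 + θ)) * (s - 1) + θ / (1 + θ) * (σ - r - 1) = σ - 1 by
      field_simp; linarith] at c2
    have c3 : (1 + θ) * t ^ (σ - 1) ≤ t ^ (s - 1) + θ * t ^ (σ - r - 1) := by
      have := mul_le_mul_of_nonneg_left c2 q1.le
      refine this.trans (le_of_eq ?_)
      field_simp
      ring
    rw [abs_le]
    constructor <;> nlinarith [mul_nonneg hθ0 p1.le, mul_nonneg hθ0 p2.le, mul_nonneg hθ0 p4.le]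
  · rw [abs_of_nonpos (by linarith : s - σ ≤ 0)] at hθr
    have c1 := conv (σ - 1) (σ - r - 1) θ hθ0 hθ1
    rw [show (1 - θ) * (σ - 1) + θ * (σ - r - 1) = s - 1 by linarith] at c1
    have c2 := conv (s - 1) (σ + r - 1) (θ / (1 + θ)) w0 w1
    rw [show (1 - θ / (1 + θ)) * (s - 1) + θ / (1 + θ) * (σ + r - 1) = σ - 1 by
      field_simp; linarith] at c2
    have c3 : (1 + θ) * t ^ (σ - 1) ≤ t ^ (s - 1) + θ * t ^ (σ + r - 1) := by
      have := mul_le_mul_of_nonneg_left c2 q1.le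
      refine this.trans (le_of_eq ?_)
      field_simp
      ring
    rw [abs_le]
    constructor <;> nlinarith [mul_nonneg hθ0 p1.le, mul_nonneg hθ0 p2.le, mul_nonneg hθ0 p4.le]

theorem abs_gaussMellin_sub_le {σ s r x : ℝ} (hr : 0 < r) (hrσ : r < σ) (hs : |s - σ| ≤ r) :
    |gaussMellin s x - gaussMellin σ x| ≤
      |s - σ| / r * (gaussMellin (σ - r) x + gaussMellin (σ + r) x) := by
  have hs0 : 0 < s := by have := (abs_le.1 hs).1; linarith
  have i1 := integrableOn_gaussMellin hs0 x
  have i2 := integrableOn_gaussMellin (by linarith : 0 < σ) x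
  have i3 := integrableOn_gaussMellin (by linarith : 0 < σ - r) x
  have i4 := integrableOn_gaussMellin (by linarith : 0 < σ + r) x
  unfold gaussMellin
  rw [← integral_sub i1 i2, ← integral_add i3 i4, ← integral_const_mul, ← Real.norm_eq_abs]
  refine (norm_integral_le_integral_norm _).trans ?_
  refine setIntegral_mono_on (i1.sub i2).norm ((i3.add i4).const_mul _) measurableSet_Ioi ?_
  intro t ht
  have ht0 : 0 < t := ht
  have := abs_rpow_sub_rpow_le ht0 hr hs
  rw [← sub_mul, ← add_mul, norm_mul, Real.norm_eq_abs, Real.norm_of_nonneg (Real.exp_nonneg _),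
    ← mul_assoc]
  gcongr

/-! ### Hermite functions of real order -/

/-- The solution `J s` of `y'' - 2 x y' - 2 s y = 0` that grows subexponentially at `+∞`, that is,
the Hermite function of order `-s`, normalised so that `J (-m)` is the monic Hermite polynomial of
degree `m`. For `s > 0` it is a normalised Gaussian Mellin integral; the three-term recurrence
in `s` continues it to all real `s`. -/
noncomputable def hermiteFn (s x : ℝ) : ℝ :=
  if 0 < s then gaussMellin s x / Real.Gamma s
  else (s + 1) / 2 * hermiteFn (s + 2) x + x * hermiteFn (s + 1) x
termination_by ⌊1 - s⌋₊
decreasing_by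
  all_goals
    rw [Nat.lt_iff_add_one_le, Nat.le_floor_iff (by linarith)]
    push_cast
    by_cases h : 0 ≤ 1 - (s + 1)
    · have := Nat.floor_le h
      have h2 : ⌊1 - (s + 2)⌋₊ ≤ ⌊1 - (s + 1)⌋₊ := Nat.floor_mono (by linarith)
      have h3 : (⌊1 - (s + 2)⌋₊ : ℝ) ≤ ⌊1 - (s + 1)⌋₊ := by exact_mod_cast h2
      linarith
    · rw [Nat.floor_of_nonpos (by linarith)]
      push_cast
      linarith

theorem hermiteFn_of_pos {s : ℝ} (hs : 0 < s) (x : ℝ) :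
    hermiteFn s x = gaussMellin s x / Real.Gamma s := by
  rw [hermiteFn, if_pos hs]

theorem hermiteFn_recurrence (s x : ℝ) :
    hermiteFn s x = (s + 1) / 2 * hermiteFn (s + 2) x + x * hermiteFn (s + 1) x := by
  by_cases hs : 0 < s
  · rw [hermiteFn_of_pos hs, hermiteFn_of_pos (by linarith : 0 < s + 1),
      hermiteFn_of_pos (by linarith : 0 < s + 2), show s + 2 = s + 1 + 1 by ring,
      Real.Gamma_add_one (by linarith : s + 1 ≠ 0), Real.Gamma_add_one hs.ne',
      show s + 1 + 1 = s + 2 by ring]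
    have hG := (Real.Gamma_pos_of_pos hs).ne'
    have h1 := gaussMellin_recurrence hs x
    have h2 : s + 1 ≠ 0 := by linarith
    field_simp
    linarith
  · rw [hermiteFn, if_neg hs]

/-- Induction on the order in steps of one, from the orders `s > 0` downwards. -/
theorem order_induction {P : ℝ → Prop} (h0 : ∀ s, 0 < s → P s)
    (h1 : ∀ s, P (s + 1) → P (s + 2) → P s) (s : ℝ) : P s := by
  have key : ∀ m : ℕ, ∀ s : ℝ, -(m : ℝ) < s → P s := by
    intro m
    induction m with
    | zero => exact fun s hs => h0 s (by simpa using hs)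
    | succ m ih =>
      intro s hs
      push_cast at hs
      exact h1 s (ih _ (by linarith)) (ih _ (by linarith))
  obtain ⟨m, hm⟩ := exists_nat_gt (-s)
  exact key m s (by linarith)

theorem hasDerivAt_hermiteFn (s x : ℝ) :
    HasDerivAt (hermiteFn s) (-s * hermiteFn (s + 1) x) x := by
  revert x
  refine order_induction (P := fun s => ∀ x, HasDerivAt (hermiteFn s) (-s * hermiteFn (s + 1) x) x)
    ?_ ?_ s
  · intro s hs x
    have h := (hasDerivAt_gaussMellin hs x).div_const (Real.Gamma s)
    have e : hermiteFn s = fun x => gaussMellin s x / Real.Gamma s :=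
      funext fun x => hermiteFn_of_pos hs x
    rw [e]
    refine h.congr_deriv ?_
    rw [hermiteFn_of_pos (by linarith : 0 < s + 1), Real.Gamma_add_one hs.ne']
    have hG := (Real.Gamma_pos_of_pos hs).ne'
    field_simp
  · intro s h1 h2 x
    have e : hermiteFn s = fun x => (s + 1) / 2 * hermiteFn (s + 2) x + x * hermiteFn (s + 1) x :=
      funext fun x => hermiteFn_recurrence s x
    rw [e]
    refine (((h2 x).const_mul ((s + 1) / 2)).add ((hasDerivAt_id x).mul (h1 x))).congr_deriv ?_
    have h3 := hermiteFn_recurrence (s + 1) x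
    rw [show s + 1 + 1 = s + 2 by ring, show s + 1 + 2 = s + 2 + 1 by ring] at *
    simp only [id]
    linear_combination (-(s + 1)) * (-h3)

theorem continuous_hermiteFn (s : ℝ) : Continuous (hermiteFn s) :=
  continuous_iff_continuousAt.2 fun x => (hasDerivAt_hermiteFn s x).continuousAt

theorem hermiteFn_pos_of_pos {s : ℝ} (hs : 0 < s) (x : ℝ) : 0 < hermiteFn s x := by
  rw [hermiteFn_of_pos hs]
  exact div_pos (gaussMellin_pos hs x) (Real.Gamma_pos_of_pos hs)

theorem hermiteFn_zero (x : ℝ) : hermiteFn 0 x = 1 := by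
  -- The function is constant; integrating by parts for `t ↦ exp (-t²/4)` gives its value at `0`.
  have hd : ∀ y, HasDerivAt (hermiteFn 0) 0 y := fun y => by
    simpa using hasDerivAt_hermiteFn 0 y
  have hc := is_const_of_deriv_eq_zero (fun y => (hd y).differentiableAt) (fun y => (hd y).deriv)
  rw [hc x 0, hermiteFn_recurrence, hermiteFn_of_pos (by norm_num), gaussMellin]
  have hI : ∫ t in Ioi (0 : ℝ), t ^ ((0 : ℝ) + 2 - 1) * Real.exp (-t ^ 2 / 4 - 0 * t) = 2 := by
    have hlim : Tendsto (fun t : ℝ => -2 * Real.exp (-t ^ 2 / 4)) atTop (𝓝 (-2 * 0)) := by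
      refine (Real.tendsto_exp_atBot.comp ?_).const_mul _
      have : Tendsto (fun t : ℝ => t ^ 2 / 4) atTop atTop :=
        (tendsto_pow_atTop (by norm_num)).atTop_div_const (by norm_num)
      refine (tendsto_neg_atTop_atBot.comp this).congr fun t => ?_
      simp [neg_div]
    have := integral_Ioi_of_hasDerivAt_of_nonneg' (a := 0)
      (g := fun t : ℝ => -2 * Real.exp (-t ^ 2 / 4))
      (g' := fun t : ℝ => t ^ ((0 : ℝ) + 2 - 1) * Real.exp (-t ^ 2 / 4 - 0 * t))
      (l := -2 * 0) ?_ ?_ hlim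
    · rw [this]; norm_num
    · intro t _
      have h1 : HasDerivAt (fun t : ℝ => -t ^ 2 / 4) (-(2 * t) / 4) t := by
        have := (hasDerivAt_pow 2 t).neg.div_const 4
        exact this.congr_deriv (by norm_num)
      refine (h1.exp.const_mul (-2)).congr_deriv ?_
      norm_num
      ring
    · intro t ht
      have ht0 : (0 : ℝ) < t := ht
      positivity
  rw [hI]
  norm_num [Real.Gamma_two]

theorem hermiteFn_pos {s : ℝ} (hs : 0 ≤ s) (x : ℝ) : 0 < hermiteFn s x := by
  rcases hs.eq_or_lt with rfl | hs
  · rw [hermiteFn_zero]; norm_num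
  · exact hermiteFn_pos_of_pos hs x

/-- The Cauchy data `J s`, `(J s)' = -s J (s+1)` do not vanish simultaneously. -/
theorem hermiteFn_ne_zero_of_succ_eq_zero (s x : ℝ) (h : hermiteFn (s + 1) x = 0) :
    hermiteFn s x ≠ 0 := by
  refine order_induction (P := fun s => hermiteFn (s + 1) x = 0 → hermiteFn s x ≠ 0) ?_ ?_ s h
  · exact fun s hs _ => (hermiteFn_pos hs.le x).ne'
  · intro s h1 _ h0 hz
    have hr := hermiteFn_recurrence s x
    rw [h0, hz, mul_zero, add_zero] at hr
    rcases mul_eq_zero.1 hr.symm with h | h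
    · have : s + 1 = 0 := by linarith
      rw [this, hermiteFn_zero] at h0
      exact one_ne_zero h0
    · exact h1 (by rw [show s + 1 + 1 = s + 2 by ring]; exact h) h0

theorem abs_le_exp_abs (x : ℝ) : |x| ≤ Real.exp |x| := by
  have := Real.add_one_le_exp |x|
  linarith

/-- On a half-line `[a, ∞)` the function `J s` is exponentially bounded. -/
theorem exists_abs_hermiteFn_le (s a : ℝ) :
    ∃ C c : ℝ, 0 ≤ C ∧ 0 ≤ c ∧ ∀ x, a ≤ x → |hermiteFn s x| ≤ C * Real.exp (c * |x|) := by
  refine order_induction (P := fun s => ∃ C c : ℝ, 0 ≤ C ∧ 0 ≤ c ∧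
    ∀ x, a ≤ x → |hermiteFn s x| ≤ C * Real.exp (c * |x|)) ?_ ?_ s
  · intro s hs
    refine ⟨hermiteFn s a, 0, (hermiteFn_pos hs.le a).le, le_rfl, fun x hx => ?_⟩
    rw [abs_of_pos (hermiteFn_pos hs.le x), zero_mul, Real.exp_zero, mul_one,
      hermiteFn_of_pos hs, hermiteFn_of_pos hs]
    have := Real.Gamma_pos_of_pos hs
    have := gaussMellin_anti hs hx
    gcongr
  · rintro s ⟨C₁, c₁, hC₁, hc₁, h₁⟩ ⟨C₂, c₂, hC₂, hc₂, h₂⟩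
    refine ⟨|(s + 1) / 2| * C₂ + C₁, c₁ + c₂ + 1, by positivity, by positivity, fun x hx => ?_⟩
    rw [hermiteFn_recurrence, add_mul]
    refine (abs_add_le _ _).trans (add_le_add ?_ ?_)
    · rw [abs_mul, mul_assoc]
      refine mul_le_mul_of_nonneg_left ((h₂ x hx).trans ?_) (abs_nonneg _)
      have : c₂ * |x| ≤ (c₁ + c₂ + 1) * |x| :=
        mul_le_mul_of_nonneg_right (by linarith) (abs_nonneg _)
      gcongr
    · rw [abs_mul]
      calc |x| * |hermiteFn (s + 1) x|
          ≤ Real.exp |x| * (C₁ * Real.exp (c₁ * |x|)) :=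
            mul_le_mul (abs_le_exp_abs x) (h₁ x hx) (abs_nonneg _) (Real.exp_nonneg _)
        _ = C₁ * Real.exp (c₁ * |x| + |x|) := by rw [Real.exp_add]; ring
        _ ≤ C₁ * Real.exp ((c₁ + c₂ + 1) * |x|) := by
            have := mul_nonneg hc₂ (abs_nonneg x)
            gcongr
            linarith

/-- Local Lipschitz continuity of `J s x` in `s`, with an exponential weight in `x ≥ a`. -/
theorem exists_abs_hermiteFn_sub_le (σ a : ℝ) :
    ∃ C c : ℝ, 0 ≤ C ∧ 0 ≤ c ∧ ∀ᶠ s in 𝓝 σ, ∀ x, a ≤ x →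
      |hermiteFn s x - hermiteFn σ x| ≤ C * |s - σ| * Real.exp (c * |x|) := by
  refine order_induction (P := fun σ => ∃ C c : ℝ, 0 ≤ C ∧ 0 ≤ c ∧ ∀ᶠ s in 𝓝 σ, ∀ x, a ≤ x →
      |hermiteFn s x - hermiteFn σ x| ≤ C * |s - σ| * Real.exp (c * |x|)) ?_ ?_ σ
  · intro σ hσ
    have hG := Real.Gamma_pos_of_pos hσ
    have hGd : DifferentiableAt ℝ (fun s => (Real.Gamma s)⁻¹) σ :=
      (Real.differentiableAt_Gamma fun m => by
        have : (0 : ℝ) ≤ m := m.cast_nonneg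
        linarith).inv hG.ne'
    obtain ⟨L, hL0, hL⟩ := hGd.isBigO_sub.exists_pos
    have hL := hL.bound
    set r := σ / 2 with hr
    have hr0 : 0 < r := by positivity
    set A := gaussMellin (σ - r) a + gaussMellin (σ + r) a with hA
    have hA0 : 0 < A := add_pos (gaussMellin_pos (by linarith) a) (gaussMellin_pos (by linarith) a)
    have hB0 := gaussMellin_pos hσ a
    have hcont : ∀ᶠ s in 𝓝 σ, (Real.Gamma s)⁻¹ < (Real.Gamma σ)⁻¹ + 1 :=
      hGd.continuousAt.eventually_lt_const (by linarith)
    refine ⟨A / r * ((Real.Gamma σ)⁻¹ + 1) + gaussMellin σ a * L, 0, by positivity, le_rfl, ?_⟩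
    filter_upwards [hL, hcont, Metric.closedBall_mem_nhds σ hr0] with s h1 h2 h3 x hx
    rw [Metric.mem_closedBall, Real.dist_eq] at h3
    rw [Real.norm_eq_abs, Real.norm_eq_abs] at h1
    have hs0 : 0 < s := by have := (abs_le.1 h3).1; linarith
    have hGs := Real.Gamma_pos_of_pos hs0
    have h4 := abs_gaussMellin_sub_le (x := x) hr0 (by linarith : r < σ) h3
    have h5 := gaussMellin_anti (by linarith : 0 < σ - r) hx
    have h6 := gaussMellin_anti (by linarith : 0 < σ + r) hx
    have h7 := gaussMellin_anti hσ hx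
    have h8 := gaussMellin_pos hσ x
    rw [hermiteFn_of_pos hs0, hermiteFn_of_pos hσ, zero_mul, Real.exp_zero, mul_one,
      show gaussMellin s x / Real.Gamma s - gaussMellin σ x / Real.Gamma σ =
        (gaussMellin s x - gaussMellin σ x) * (Real.Gamma s)⁻¹ +
        gaussMellin σ x * ((Real.Gamma s)⁻¹ - (Real.Gamma σ)⁻¹) by ring]
    refine (abs_add_le _ _).trans ?_
    rw [abs_mul, abs_mul, abs_of_pos h8, abs_of_pos (inv_pos.2 hGs), add_mul]
    have h9 : |gaussMellin s x - gaussMellin σ x| ≤ |s - σ| / r * A := h4.trans (by rw [hA]; gcongr)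
    have h10 : 0 < (Real.Gamma s)⁻¹ := inv_pos.2 hGs
    refine add_le_add ?_ ?_
    · calc _ ≤ |s - σ| / r * A * ((Real.Gamma σ)⁻¹ + 1) := by gcongr
        _ = _ := by ring
    · calc _ ≤ gaussMellin σ a * (L * |s - σ|) := by gcongr
        _ = _ := by ring
  · rintro σ ⟨C₁, c₁, hC₁, hc₁, h₁⟩ ⟨C₂, c₂, hC₂, hc₂, h₂⟩
    obtain ⟨C₃, c₃, hC₃, hc₃, h₃⟩ := exists_abs_hermiteFn_le (σ + 2) a
    have t1 : Tendsto (fun s : ℝ => s + 1) (𝓝 σ) (𝓝 (σ + 1)) :=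
      (continuous_id.add continuous_const).tendsto _
    have t2 : Tendsto (fun s : ℝ => s + 2) (𝓝 σ) (𝓝 (σ + 2)) :=
      (continuous_id.add continuous_const).tendsto _
    refine ⟨(|σ + 1| + 1) / 2 * C₂ + C₃ / 2 + C₁, c₁ + c₂ + c₃ + 1, by positivity, by positivity,
      ?_⟩
    filter_upwards [t1.eventually h₁, t2.eventually h₂, Metric.closedBall_mem_nhds σ one_pos]
      with s g₁ g₂ hs x hx
    rw [Metric.mem_closedBall, Real.dist_eq] at hs
    have g₁ := g₁ x hx
    have g₂ := g₂ x hx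
    have g₃ := h₃ x hx
    rw [add_sub_add_right_eq_sub] at g₁ g₂
    have n1 := mul_nonneg hc₁ (abs_nonneg x)
    have n2 := mul_nonneg hc₂ (abs_nonneg x)
    have n3 := mul_nonneg hc₃ (abs_nonneg x)
    have n4 := abs_nonneg x
    set E := Real.exp ((c₁ + c₂ + c₃ + 1) * |x|) with hE
    have e2 : Real.exp (c₂ * |x|) ≤ E := Real.exp_le_exp.2 (by linarith)
    have e3 : Real.exp (c₃ * |x|) ≤ E := Real.exp_le_exp.2 (by linarith)
    have e1 : |x| * Real.exp (c₁ * |x|) ≤ E := by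
      calc |x| * Real.exp (c₁ * |x|) ≤ Real.exp |x| * Real.exp (c₁ * |x|) := by
            gcongr; exact abs_le_exp_abs x
        _ = Real.exp (|x| + c₁ * |x|) := (Real.exp_add _ _).symm
        _ ≤ E := Real.exp_le_exp.2 (by linarith)
    rw [hermiteFn_recurrence s, hermiteFn_recurrence σ,
      show (s + 1) / 2 * hermiteFn (s + 2) x + x * hermiteFn (s + 1) x -
        ((σ + 1) / 2 * hermiteFn (σ + 2) x + x * hermiteFn (σ + 1) x) =
        (s + 1) / 2 * (hermiteFn (s + 2) x - hermiteFn (σ + 2) x) +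
        (s - σ) / 2 * hermiteFn (σ + 2) x +
        x * (hermiteFn (s + 1) x - hermiteFn (σ + 1) x) by ring]
    refine (abs_add_three _ _ _).trans ?_
    rw [add_mul, add_mul, add_mul, add_mul]
    have hs1 : |s + 1| ≤ |σ + 1| + 1 := by
      calc |s + 1| = |(σ + 1) + (s - σ)| := by ring_nf
        _ ≤ |σ + 1| + |s - σ| := abs_add_le _ _
        _ ≤ _ := by linarith
    refine add_le_add (add_le_add ?_ ?_) ?_
    · rw [abs_mul, abs_div, abs_two]
      calc _ ≤ (|σ + 1| + 1) / 2 * (C₂ * |s - σ| * E) := by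
            gcongr
            exact g₂.trans (by gcongr)
        _ = _ := by ring
    · rw [abs_mul, abs_div, abs_two]
      calc _ ≤ |s - σ| / 2 * (C₃ * E) := by
            gcongr
            exact g₃.trans (by gcongr)
        _ = _ := by ring
    · rw [abs_mul]
      calc _ ≤ |x| * (C₁ * |s - σ| * Real.exp (c₁ * |x|)) := by gcongr
        _ = C₁ * |s - σ| * (|x| * Real.exp (c₁ * |x|)) := by ring
        _ ≤ C₁ * |s - σ| * E := by gcongr

/-- Joint continuity of `J s x`. -/
theorem continuous_hermiteFn_uncurry : Continuous fun p : ℝ × ℝ => hermiteFn p.1 p.2 := by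
  refine continuous_iff_continuousAt.2 fun ⟨σ, x₀⟩ => ?_
  obtain ⟨C, c, hC, hc, h⟩ := exists_abs_hermiteFn_sub_le σ (x₀ - 1)
  have h1 : Tendsto (fun p : ℝ × ℝ => C * |p.1 - σ| * Real.exp (c * |p.2|)) (𝓝 (σ, x₀)) (𝓝 0) := by
    have : Continuous fun p : ℝ × ℝ => C * |p.1 - σ| * Real.exp (c * |p.2|) := by fun_prop
    simpa using this.tendsto (σ, x₀)
  have h2 : Tendsto (fun p : ℝ × ℝ => hermiteFn p.1 p.2 - hermiteFn σ p.2) (𝓝 (σ, x₀)) (𝓝 0) := by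
    refine squeeze_zero_norm' ?_ h1
    have e1 : ∀ᶠ p : ℝ × ℝ in 𝓝 (σ, x₀), x₀ - 1 ≤ p.2 :=
      (continuous_snd.tendsto (σ, x₀)).eventually (eventually_ge_nhds (by simp))
    filter_upwards [(continuous_fst.tendsto (σ, x₀)).eventually h, e1] with p hp hx
    exact hp p.2 hx
  have h3 : Tendsto (fun p : ℝ × ℝ => hermiteFn σ p.2) (𝓝 (σ, x₀)) (𝓝 (hermiteFn σ x₀)) :=
    ((continuous_hermiteFn σ).comp continuous_snd).tendsto (σ, x₀)
  have := h2.add h3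
  simpa [ContinuousAt] using this

theorem continuous_hermiteFn_order (x : ℝ) : Continuous fun s => hermiteFn s x :=
  continuous_hermiteFn_uncurry.comp (continuous_id.prodMk continuous_const)

/-- The polynomials `J (-m)` are exponentially bounded on the whole line. -/
theorem exists_abs_hermiteFn_neg_nat_le (m : ℕ) :
    ∃ C c : ℝ, 0 ≤ C ∧ 0 ≤ c ∧ ∀ x, |hermiteFn (-m) x| ≤ C * Real.exp (c * |x|) := by
  suffices key : ∀ m : ℕ, (∃ C c : ℝ, 0 ≤ C ∧ 0 ≤ c ∧
      ∀ x, |hermiteFn (-m) x| ≤ C * Real.exp (c * |x|)) ∧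
      (∃ C c : ℝ, 0 ≤ C ∧ 0 ≤ c ∧
      ∀ x, |hermiteFn (-(m + 1 : ℕ)) x| ≤ C * Real.exp (c * |x|)) from (key m).1
  intro m
  induction m with
  | zero =>
    refine ⟨⟨1, 0, zero_le_one, le_rfl, fun x => by simp [hermiteFn_zero]⟩,
      ⟨1, 1, zero_le_one, zero_le_one, fun x => ?_⟩⟩
    rw [hermiteFn_recurrence]
    norm_num [hermiteFn_zero]
    exact abs_le_exp_abs x
  | succ m ih =>
    refine ⟨ih.2, ?_⟩
    obtain ⟨⟨C₂, c₂, hC₂, hc₂, h₂⟩, ⟨C₁, c₁, hC₁, hc₁, h₁⟩⟩ := ih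
    refine ⟨((m : ℝ) + 1) / 2 * C₂ + C₁, c₁ + c₂ + 1, by positivity, by positivity, fun x => ?_⟩
    rw [hermiteFn_recurrence, add_mul]
    rw [show (-((m + 1 + 1 : ℕ) : ℝ) + 2) = -(m : ℝ) by push_cast; ring,
      show (-((m + 1 + 1 : ℕ) : ℝ) + 1) = -((m + 1 : ℕ) : ℝ) by push_cast; ring]
    have n1 := mul_nonneg hc₁ (abs_nonneg x)
    have n2 := mul_nonneg hc₂ (abs_nonneg x)
    have n3 := abs_nonneg x
    refine (abs_add_le _ _).trans (add_le_add ?_ ?_)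
    · rw [abs_mul, abs_div, abs_two, abs_neg, Nat.abs_cast, mul_assoc]
      push_cast
      gcongr
      refine (h₂ x).trans ?_
      gcongr
      linarith
    · rw [abs_mul]
      calc |x| * |hermiteFn (-((m + 1 : ℕ) : ℝ)) x|
          ≤ Real.exp |x| * (C₁ * Real.exp (c₁ * |x|)) :=
            mul_le_mul (abs_le_exp_abs x) (h₁ x) (abs_nonneg _) (Real.exp_nonneg _)
        _ = C₁ * Real.exp (c₁ * |x| + |x|) := by rw [Real.exp_add]; ring
        _ ≤ C₁ * Real.exp ((c₁ + c₂ + 1) * |x|) := by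
            gcongr
            linarith

/-! ### Parabolic cylinder functions, Wronskians and overlap integrals -/

/-- The parabolic cylinder function `D s x = exp (-x²/2) J s x`: up to scalars, the only solution
of `-y'' + x² y = (1 - 2 s) y` that is square integrable at `+∞`. -/
noncomputable def weberFn (s x : ℝ) : ℝ := Real.exp (-x ^ 2 / 2) * hermiteFn s x

/-- The derivative of `D s`. -/
noncomputable def weberDeriv (s x : ℝ) : ℝ :=
  Real.exp (-x ^ 2 / 2) * (-s * hermiteFn (s + 1) x - x * hermiteFn s x)

theorem hasDerivAt_exp_neg_sq_half (x : ℝ) :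
    HasDerivAt (fun x : ℝ => Real.exp (-x ^ 2 / 2)) (Real.exp (-x ^ 2 / 2) * -x) x := by
  have h1 : HasDerivAt (fun t : ℝ => -t ^ 2 / 2) (-x) x := by
    have := (hasDerivAt_pow 2 x).neg.div_const 2
    exact this.congr_deriv (by norm_num; ring)
  exact h1.exp

theorem hasDerivAt_weberFn (s x : ℝ) : HasDerivAt (weberFn s) (weberDeriv s x) x := by
  refine ((hasDerivAt_exp_neg_sq_half x).mul (hasDerivAt_hermiteFn s x)).congr_deriv ?_
  unfold weberDeriv
  ring

theorem hasDerivAt_weberDeriv (s x : ℝ) :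
    HasDerivAt (weberDeriv s) ((x ^ 2 - 1 + 2 * s) * weberFn s x) x := by
  have h1 := ((hasDerivAt_hermiteFn (s + 1) x).const_mul (-s)).sub
    ((hasDerivAt_id x).mul (hasDerivAt_hermiteFn s x))
  refine ((hasDerivAt_exp_neg_sq_half x).mul h1).congr_deriv ?_
  have h2 := hermiteFn_recurrence s x
  rw [show s + 1 + 1 = s + 2 by ring]
  unfold weberFn
  simp only [id, Pi.sub_apply, Pi.mul_apply]
  linear_combination (-2 * s * Real.exp (-x ^ 2 / 2)) * h2

theorem continuous_weberFn (s : ℝ) : Continuous (weberFn s) :=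
  continuous_iff_continuousAt.2 fun x => (hasDerivAt_weberFn s x).continuousAt

theorem continuous_weberDeriv (s : ℝ) : Continuous (weberDeriv s) :=
  continuous_iff_continuousAt.2 fun x => (hasDerivAt_weberDeriv s x).continuousAt

theorem continuous_weberDeriv_uncurry : Continuous fun p : ℝ × ℝ => weberDeriv p.1 p.2 := by
  unfold weberDeriv
  have h1 : Continuous fun p : ℝ × ℝ => hermiteFn (p.1 + 1) p.2 :=
    continuous_hermiteFn_uncurry.comp
      (f := fun p : ℝ × ℝ => (p.1 + 1, p.2)) (by fun_prop)
  have h2 := continuous_hermiteFn_uncurry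
  fun_prop

theorem weberFn_eq_zero_iff {s x : ℝ} : weberFn s x = 0 ↔ hermiteFn s x = 0 := by
  simp [weberFn, Real.exp_ne_zero]

theorem weberDeriv_of_eq_zero {s x : ℝ} (h : hermiteFn s x = 0) :
    weberDeriv s x = Real.exp (-x ^ 2 / 2) * (-s * hermiteFn (s + 1) x) := by
  simp [weberDeriv, h]

/-- The zeros of `D s` are simple. -/
theorem weberDeriv_ne_zero {s x : ℝ} (h : weberFn s x = 0) : weberDeriv s x ≠ 0 := by
  rw [weberFn_eq_zero_iff] at h
  rw [weberDeriv_of_eq_zero h]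
  have hs : s ≠ 0 := by
    rintro rfl
    rw [hermiteFn_zero] at h
    exact one_ne_zero h
  refine mul_ne_zero (Real.exp_ne_zero _) (mul_ne_zero (neg_ne_zero.2 hs) fun h1 => ?_)
  exact hermiteFn_ne_zero_of_succ_eq_zero s x h1 h

/-- A Gaussian absorbs an exponential weight. -/
theorem exp_mul_abs_mul_gauss_le (c x : ℝ) :
    Real.exp (c * |x|) * Real.exp (-x ^ 2 / 2) ≤ Real.exp (c ^ 2) * Real.exp (-x ^ 2 / 4) := by
  rw [← Real.exp_add, ← Real.exp_add, Real.exp_le_exp]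
  nlinarith [sq_nonneg (|x| / 2 - c), sq_abs x]

theorem exists_abs_weberFn_le (s a : ℝ) :
    ∃ C : ℝ, 0 ≤ C ∧ ∀ x, a ≤ x → |weberFn s x| ≤ C * Real.exp (-x ^ 2 / 4) := by
  obtain ⟨C, c, hC, -, h⟩ := exists_abs_hermiteFn_le s a
  refine ⟨C * Real.exp (c ^ 2), by positivity, fun x hx => ?_⟩
  rw [weberFn, abs_mul, Real.abs_exp]
  calc _ ≤ Real.exp (-x ^ 2 / 2) * (C * Real.exp (c * |x|)) := by gcongr; exact h x hx
    _ = C * (Real.exp (c * |x|) * Real.exp (-x ^ 2 / 2)) := by ring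
    _ ≤ C * (Real.exp (c ^ 2) * Real.exp (-x ^ 2 / 4)) := by
        exact mul_le_mul_of_nonneg_left (exp_mul_abs_mul_gauss_le c x) (by positivity)
    _ = _ := by ring

theorem exists_abs_mul_weberFn_le (s a : ℝ) :
    ∃ C : ℝ, 0 ≤ C ∧ ∀ x, a ≤ x → |x| ^ 2 * |weberFn s x| ≤ C * Real.exp (-x ^ 2 / 4) := by
  obtain ⟨C, c, hC, -, h⟩ := exists_abs_hermiteFn_le s a
  refine ⟨C * Real.exp ((c + 2) ^ 2), by positivity, fun x hx => ?_⟩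
  rw [weberFn, abs_mul, Real.abs_exp]
  have h2 : |x| ^ 2 ≤ Real.exp (2 * |x|) := by
    rw [two_mul, Real.exp_add, ← sq]
    have := abs_le_exp_abs x
    gcongr
  calc _ ≤ Real.exp (2 * |x|) * (Real.exp (-x ^ 2 / 2) * (C * Real.exp (c * |x|))) := by
        gcongr; exact h x hx
    _ = C * (Real.exp ((c + 2) * |x|) * Real.exp (-x ^ 2 / 2)) := by
        rw [add_mul, Real.exp_add]; ring
    _ ≤ C * (Real.exp ((c + 2) ^ 2) * Real.exp (-x ^ 2 / 4)) := by
        exact mul_le_mul_of_nonneg_left (exp_mul_abs_mul_gauss_le _ x) (by positivity)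
    _ = _ := by ring

theorem exists_abs_weberDeriv_le (s a : ℝ) :
    ∃ C : ℝ, 0 ≤ C ∧ ∀ x, a ≤ x → |weberDeriv s x| ≤ C * Real.exp (-x ^ 2 / 4) := by
  obtain ⟨C₁, hC₁, h₁⟩ := exists_abs_weberFn_le (s + 1) a
  obtain ⟨C₂, hC₂, h₂⟩ := exists_abs_mul_weberFn_le s a
  obtain ⟨C₃, hC₃, h₃⟩ := exists_abs_weberFn_le s a
  refine ⟨|s| * C₁ + (C₂ + C₃), by positivity, fun x hx => ?_⟩
  have e : weberDeriv s x = -s * weberFn (s + 1) x + -(x * weberFn s x) := by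
    unfold weberDeriv weberFn; ring
  rw [e, add_mul, add_mul]
  refine (abs_add_le _ _).trans (add_le_add ?_ ?_)
  · rw [abs_mul, abs_neg, mul_assoc]
    exact mul_le_mul_of_nonneg_left (h₁ x hx) (abs_nonneg _)
  · rw [abs_neg, abs_mul]
    have h4 : |x| ≤ |x| ^ 2 + 1 := by nlinarith [sq_nonneg (|x| - 1), abs_nonneg x]
    calc |x| * |weberFn s x| ≤ (|x| ^ 2 + 1) * |weberFn s x| := by gcongr
      _ = |x| ^ 2 * |weberFn s x| + |weberFn s x| := by ring
      _ ≤ _ := add_le_add (h₂ x hx) (h₃ x hx)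

theorem exists_abs_weberFn_sub_le (σ a : ℝ) :
    ∃ C : ℝ, 0 ≤ C ∧ ∀ᶠ s in 𝓝 σ, ∀ x, a ≤ x →
      |weberFn s x - weberFn σ x| ≤ C * |s - σ| * Real.exp (-x ^ 2 / 4) := by
  obtain ⟨C, c, hC, -, h⟩ := exists_abs_hermiteFn_sub_le σ a
  refine ⟨C * Real.exp (c ^ 2), by positivity, ?_⟩
  filter_upwards [h] with s h x hx
  rw [weberFn, weberFn, ← mul_sub, abs_mul, Real.abs_exp]
  calc _ ≤ Real.exp (-x ^ 2 / 2) * (C * |s - σ| * Real.exp (c * |x|)) := by gcongr; exact h x hx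
    _ = C * |s - σ| * (Real.exp (c * |x|) * Real.exp (-x ^ 2 / 2)) := by ring
    _ ≤ C * |s - σ| * (Real.exp (c ^ 2) * Real.exp (-x ^ 2 / 4)) := by
        exact mul_le_mul_of_nonneg_left (exp_mul_abs_mul_gauss_le c x) (by positivity)
    _ = _ := by ring

theorem gauss_mul_gauss (x : ℝ) :
    Real.exp (-x ^ 2 / 4) * Real.exp (-x ^ 2 / 4) = Real.exp (-x ^ 2 / 2) := by
  rw [← Real.exp_add]; ring_nf

theorem integrable_gauss_half : Integrable fun x : ℝ => Real.exp (-x ^ 2 / 2) := by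
  have := integrable_exp_neg_mul_sq (b := 1 / 2) (by norm_num)
  refine this.congr (Eventually.of_forall fun x => ?_)
  simp only
  congr 1
  ring

theorem integrableOn_mul_of_gauss_bound {f g : ℝ → ℝ} {a : ℝ} (hf : Continuous f)
    (hg : Continuous g)
    (hf' : ∃ C : ℝ, 0 ≤ C ∧ ∀ x, a ≤ x → |f x| ≤ C * Real.exp (-x ^ 2 / 4))
    (hg' : ∃ C : ℝ, 0 ≤ C ∧ ∀ x, a ≤ x → |g x| ≤ C * Real.exp (-x ^ 2 / 4)) :
    IntegrableOn (fun x => f x * g x) (Ioi a) := by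
  obtain ⟨C, hC, h⟩ := hf'
  obtain ⟨C', hC', h'⟩ := hg'
  refine Integrable.mono' ((integrable_gauss_half.const_mul (C * C')).integrableOn)
    (hf.mul hg).aestronglyMeasurable ?_
  filter_upwards [ae_restrict_mem measurableSet_Ioi] with x hx
  have hx0 : a ≤ x := le_of_lt hx
  rw [norm_mul, Real.norm_eq_abs, Real.norm_eq_abs]
  calc |f x| * |g x| ≤ (C * Real.exp (-x ^ 2 / 4)) * (C' * Real.exp (-x ^ 2 / 4)) :=
        mul_le_mul (h x hx0) (h' x hx0) (abs_nonneg _) (by positivity)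
    _ = C * C' * (Real.exp (-x ^ 2 / 4) * Real.exp (-x ^ 2 / 4)) := by ring
    _ = _ := by rw [gauss_mul_gauss]

theorem integrableOn_weberFn_mul (s s' a : ℝ) :
    IntegrableOn (fun x => weberFn s x * weberFn s' x) (Ioi a) :=
  integrableOn_mul_of_gauss_bound (continuous_weberFn s) (continuous_weberFn s')
    (exists_abs_weberFn_le s a) (exists_abs_weberFn_le s' a)

theorem tendsto_gauss : Tendsto (fun x : ℝ => Real.exp (-x ^ 2 / 4)) atTop (𝓝 0) := by
  refine Real.tendsto_exp_atBot.comp ?_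
  have : Tendsto (fun t : ℝ => t ^ 2 / 4) atTop atTop :=
    (tendsto_pow_atTop (by norm_num)).atTop_div_const (by norm_num)
  refine (tendsto_neg_atTop_atBot.comp this).congr fun t => ?_
  simp [neg_div]

theorem tendsto_zero_of_gauss_bound {f : ℝ → ℝ}
    (hf' : ∃ C : ℝ, 0 ≤ C ∧ ∀ x, 0 ≤ x → |f x| ≤ C * Real.exp (-x ^ 2 / 4)) :
    Tendsto f atTop (𝓝 0) := by
  obtain ⟨C, hC, h⟩ := hf'
  have h1 := tendsto_gauss.const_mul C
  rw [mul_zero] at h1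
  refine squeeze_zero_norm' ?_ h1
  filter_upwards [eventually_ge_atTop 0] with x hx using h x hx

theorem tendsto_weberFn (s : ℝ) : Tendsto (weberFn s) atTop (𝓝 0) :=
  tendsto_zero_of_gauss_bound (exists_abs_weberFn_le s 0)

theorem tendsto_weberDeriv (s : ℝ) : Tendsto (weberDeriv s) atTop (𝓝 0) :=
  tendsto_zero_of_gauss_bound (exists_abs_weberDeriv_le s 0)

/-- The overlap integral `∫ₐ^∞ D s D s'`. -/
noncomputable def overlap (s s' a : ℝ) : ℝ := ∫ x in Ioi a, weberFn s x * weberFn s' x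

/-- The Wronskian of `D s` and `D s'`. -/
noncomputable def weberWronskian (s s' x : ℝ) : ℝ :=
  weberDeriv s x * weberFn s' x - weberFn s x * weberDeriv s' x

theorem hasDerivAt_weberWronskian (s s' x : ℝ) :
    HasDerivAt (weberWronskian s s') (2 * (s - s') * (weberFn s x * weberFn s' x)) x := by
  refine (((hasDerivAt_weberDeriv s x).mul (hasDerivAt_weberFn s' x)).sub
    ((hasDerivAt_weberFn s x).mul (hasDerivAt_weberDeriv s' x))).congr_deriv ?_
  ring

/-- Green's identity: both solutions decay at `+∞`, so there is no boundary term there. -/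
theorem weberWronskian_eq (s s' a : ℝ) :
    weberWronskian s s' a = 2 * (s' - s) * overlap s s' a := by
  have h := integral_Ioi_of_hasDerivAt_of_tendsto' (a := a)
    (fun x _ => hasDerivAt_weberWronskian s s' x)
    ((integrableOn_weberFn_mul s s' a).const_mul _)
    (((tendsto_weberDeriv s).mul (tendsto_weberFn s')).sub
      ((tendsto_weberFn s).mul (tendsto_weberDeriv s')))
  rw [integral_const_mul] at h
  unfold overlap
  linarith

theorem overlap_comm (s s' a : ℝ) : overlap s s' a = overlap s' s a := by
  simp only [overlap, mul_comm]

theorem overlap_self_pos (s a : ℝ) : 0 < overlap s s a := by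
  refine (setIntegral_pos_iff_support_of_nonneg_ae
    (Eventually.of_forall fun x => mul_self_nonneg _) (integrableOn_weberFn_mul s s a)).2 ?_
  have hopen : IsOpen ((Function.support fun x => weberFn s x * weberFn s x) ∩ Ioi a) :=
    (((continuous_weberFn s).mul (continuous_weberFn s)).isOpen_support).inter isOpen_Ioi
  refine hopen.measure_pos volume ?_
  by_contra hne
  rw [not_nonempty_iff_eq_empty] at hne
  have h0 : ∀ x ∈ Ioi a, weberFn s x = 0 := by
    intro x hx
    by_contra hx0
    have : x ∈ (Function.support fun x => weberFn s x * weberFn s x) ∩ Ioi a :=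
      ⟨mul_ne_zero hx0 hx0, hx⟩
    rw [hne] at this
    exact this
  have hx : a + 1 ∈ Ioi a := by simp
  have hev : weberFn s =ᶠ[𝓝 (a + 1)] fun _ => 0 := by
    filter_upwards [isOpen_Ioi.mem_nhds hx] with x hx using h0 x hx
  have hd := (hasDerivAt_weberFn s (a + 1)).congr_of_eventuallyEq hev.symm
  exact weberDeriv_ne_zero (h0 _ hx) (hd.unique (hasDerivAt_const _ _))

/-- Lipschitz continuity of the overlap integrals in the order. -/
theorem exists_abs_overlap_sub_le (σ a : ℝ) :
    ∃ C : ℝ, 0 ≤ C ∧ ∀ᶠ s in 𝓝 σ, |overlap s σ a - overlap σ σ a| ≤ C * |s - σ| ∧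
      |overlap s s a - overlap σ σ a| ≤ C * |s - σ| := by
  obtain ⟨C, hC, h⟩ := exists_abs_weberFn_sub_le σ a
  obtain ⟨C', hC', h'⟩ := exists_abs_weberFn_le σ a
  set I := ∫ x in Ioi a, Real.exp (-x ^ 2 / 2) with hI
  have hI0 : 0 ≤ I := integral_nonneg fun x => Real.exp_nonneg _
  have main : ∀ (f : ℝ → ℝ) (B : ℝ), IntegrableOn f (Ioi a) →
      (∀ x, a ≤ x → |f x| ≤ B * Real.exp (-x ^ 2 / 2)) → |∫ x in Ioi a, f x| ≤ B * I := by
    intro f B hf hB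
    rw [hI, ← integral_const_mul, ← Real.norm_eq_abs]
    refine (norm_integral_le_integral_norm _).trans ?_
    exact setIntegral_mono_on hf.norm (integrable_gauss_half.const_mul B).integrableOn
      measurableSet_Ioi fun x hx => hB x (le_of_lt hx)
  refine ⟨C * (2 * C' + C) * I, by positivity, ?_⟩
  filter_upwards [h, Metric.closedBall_mem_nhds σ one_pos] with s h hs
  rw [Metric.mem_closedBall, Real.dist_eq] at hs
  have i1 := integrableOn_weberFn_mul s σ a
  have i2 := integrableOn_weberFn_mul σ σ a
  have i3 := integrableOn_weberFn_mul s s a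
  have e0 : ∀ x : ℝ, 0 < Real.exp (-x ^ 2 / 4) := fun x => Real.exp_pos _
  constructor
  · unfold overlap
    rw [← integral_sub i1 i2]
    refine (main _ (C * |s - σ| * C') (i1.sub i2) fun x hx => ?_).trans ?_
    · rw [Pi.sub_apply, ← sub_mul, abs_mul, ← gauss_mul_gauss]
      calc _ ≤ (C * |s - σ| * Real.exp (-x ^ 2 / 4)) * (C' * Real.exp (-x ^ 2 / 4)) :=
            mul_le_mul (h x hx) (h' x hx) (abs_nonneg _) (by positivity)
        _ = _ := by ring
    · have : C * |s - σ| * C' * I = C * C' * I * |s - σ| := by ring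
      rw [this]
      gcongr
      linarith
  · unfold overlap
    rw [← integral_sub i3 i2]
    refine (main _ (C * |s - σ| * (2 * C' + C)) (i3.sub i2) fun x hx => ?_).trans ?_
    · rw [Pi.sub_apply, show weberFn s x * weberFn s x - weberFn σ x * weberFn σ x =
        (weberFn s x - weberFn σ x) * (2 * weberFn σ x + (weberFn s x - weberFn σ x)) by ring,
        abs_mul, ← gauss_mul_gauss]
      have h2 : |2 * weberFn σ x + (weberFn s x - weberFn σ x)| ≤
          (2 * C' + C) * Real.exp (-x ^ 2 / 4) := by
        refine (abs_add_le _ _).trans ?_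
        rw [abs_mul, abs_two, add_mul]
        refine add_le_add ?_ ((h x hx).trans ?_)
        · rw [mul_assoc]; have := h' x hx; gcongr
        · have := e0 x
          gcongr
          exact mul_le_of_le_one_right hC hs
      calc _ ≤ (C * |s - σ| * Real.exp (-x ^ 2 / 4)) * ((2 * C' + C) * Real.exp (-x ^ 2 / 4)) :=
            mul_le_mul (h x hx) h2 (abs_nonneg _) (by positivity)
        _ = _ := by ring
    · exact le_of_eq (by ring)

theorem tendsto_overlap (σ a : ℝ) : Tendsto (fun s => overlap s σ a) (𝓝 σ) (𝓝 (overlap σ σ a)) := by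
  obtain ⟨C, hC, h⟩ := exists_abs_overlap_sub_le σ a
  rw [tendsto_iff_norm_sub_tendsto_zero]
  have h1 : Tendsto (fun s => C * |s - σ|) (𝓝 σ) (𝓝 0) := by
    have : Continuous fun s => C * |s - σ| := by fun_prop
    simpa using this.tendsto σ
  refine squeeze_zero' (Eventually.of_forall fun s => norm_nonneg _) ?_ h1
  filter_upwards [h] with s h using h.1

/-- At a zero `σ` of `s ↦ J s a`, this function changes sign, in the direction given by the sign
of `J (σ + 1) a`. -/
theorem eventually_crossing {σ a : ℝ} (h : hermiteFn σ a = 0) :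
    ∀ᶠ s in 𝓝 σ, s ≠ σ → 0 < (s - σ) * hermiteFn (σ + 1) a * hermiteFn s a := by
  have hσ : σ < 0 := by
    by_contra hσ
    exact (hermiteFn_pos (not_lt.1 hσ) a).ne' h
  filter_upwards [(tendsto_overlap σ a).eventually_const_lt (overlap_self_pos σ a)] with s hs hne
  have hw := weberWronskian_eq σ s a
  rw [weberWronskian, weberFn_eq_zero_iff.2 h, zero_mul, sub_zero, weberDeriv_of_eq_zero h,
    overlap_comm, weberFn] at hw
  have hE := Real.exp_pos (-a ^ 2 / 2)
  set E := Real.exp (-a ^ 2 / 2)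
  have h1 : 0 < (s - σ) ^ 2 * overlap s σ a := mul_pos (by positivity) hs
  have h2 : E ^ 2 * -σ * ((s - σ) * hermiteFn (σ + 1) a * hermiteFn s a) =
      2 * ((s - σ) ^ 2 * overlap s σ a) := by linear_combination (s - σ) * hw
  have h3 : 0 < E ^ 2 * -σ := mul_pos (by positivity) (by linarith)
  exact (mul_pos_iff_of_pos_left h3).1 (by linarith)

/-! ### Zeros in the order variable -/

theorem exists_first_zero {f : ℝ → ℝ} (hf : Continuous f) {a b : ℝ} (hab : a ≤ b) (ha : 0 < f a)
    (hb : f b ≤ 0) : ∃ t ∈ Ioc a b, f t = 0 ∧ ∀ x, a ≤ x → x < t → 0 < f x := by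
  have hc : IsCompact (Icc a b ∩ {t | f t ≤ 0}) :=
    isCompact_Icc.inter_right (isClosed_le hf continuous_const)
  obtain ⟨t, ⟨⟨hat, htb⟩, ht⟩, hmin⟩ := hc.exists_isLeast ⟨b, ⟨hab, le_rfl⟩, hb⟩
  have ht : f t ≤ 0 := ht
  have hat' : a < t := hat.lt_of_ne fun h => by rw [← h] at ht; linarith
  have hpos : ∀ x, a ≤ x → x < t → 0 < f x := by
    intro x hx hxt
    by_contra h
    exact absurd (hmin ⟨⟨hx, hxt.le.trans htb⟩, not_lt.1 h⟩) (not_le.2 hxt)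
  refine ⟨t, ⟨hat', htb⟩, le_antisymm ht ?_, hpos⟩
  refine ge_of_tendsto (x := 𝓝[<] t) (hf.continuousWithinAt (s := Iio t)) ?_
  filter_upwards [Ioo_mem_nhdsLT hat'] with x hx using (hpos x hx.1.le hx.2).le

/-- A continuous function that is negative at `α` and positive at `β`, and all of whose zeros to
the left of `c` are up-crossings while all others are down-crossings, has exactly one zero: the
last zero must be an up-crossing. -/
theorem exists_unique_sign_change {f : ℝ → ℝ} (hf : Continuous f) {α c β : ℝ} (hαc : α ≤ c)
    (hcβ : c ≤ β) (hα : f α < 0) (hβ : 0 < f β)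
    (up : ∀ s ∈ Ioo α c, f s = 0 → ∀ᶠ t in 𝓝 s, t ≠ s → 0 < (t - s) * f t)
    (down : ∀ s ∈ Ico c β, f s = 0 → ∀ᶠ t in 𝓝 s, t ≠ s → (t - s) * f t < 0) :
    ∃ s ∈ Ioo α c, f s = 0 ∧ (∀ t, s < t → t ≤ β → 0 < f t) ∧ ∀ t, α ≤ t → t < s → f t < 0 := by
  -- To the right of `c` there is no zero at all: the last one before `β` would be an up-crossing.
  have right : ∀ t, c ≤ t → t ≤ β → 0 < f t := by
    intro t hct htβ
    by_contra hneg
    obtain ⟨u, ⟨hu1, hu2⟩, hu0, hu⟩ := exists_first_zero (f := fun x => f (-x))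
      (hf.comp continuous_neg) (neg_le_neg htβ) (by simpa using hβ) (by simpa using hneg)
    have hd := down (-u) ⟨by linarith, by linarith⟩ hu0
    obtain ⟨x, hx, hx1, hx2⟩ := ((hd.filter_mono nhdsWithin_le_nhds).and
      (Ioo_mem_nhdsGT (show -u < β by linarith))).exists
    have h1 := hx (ne_of_gt hx1)
    have h2 := hu (-x) (by linarith) (by linarith)
    rw [neg_neg] at h2
    nlinarith
  have hc := right c le_rfl hcβ
  obtain ⟨s, ⟨hs1, hs2⟩, hs0, hs⟩ := exists_first_zero (f := fun x => -f x) hf.neg hαc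
    (by linarith) (by linarith)
  have hs0 : f s = 0 := by linarith
  have hsc : s < c := hs2.lt_of_ne fun h => by rw [h] at hs0; linarith
  refine ⟨s, ⟨hs1, hsc⟩, hs0, fun t hst htβ => ?_, fun t h1 h2 => by linarith [hs t h1 h2]⟩
  rcases le_total c t with hct | htc
  · exact right t hct htβ
  -- After the up-crossing at `s`, the next zero `u` before `c` would be a down-crossing.
  by_contra hneg
  obtain ⟨x, hx, hx1, hx2⟩ := (((up s ⟨hs1, hsc⟩ hs0).filter_mono nhdsWithin_le_nhds).and
      (Ioo_mem_nhdsGT hst)).exists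
  have hfx : 0 < f x := by
    have := hx (ne_of_gt hx1)
    exact (mul_pos_iff_of_pos_left (by linarith)).1 this
  obtain ⟨u, ⟨hu1, hu2⟩, hu0, hu⟩ := exists_first_zero hf hx2.le hfx (not_lt.1 hneg)
  have huc : u < c := (hu2.trans htc).lt_of_ne fun h => by rw [h] at hu0; linarith
  obtain ⟨y, hy, hy1, hy2⟩ := (((up u ⟨by linarith, huc⟩ hu0).filter_mono
    nhdsWithin_le_nhds).and (Ioo_mem_nhdsLT hu1)).exists
  have h1 := hy (ne_of_lt hy2)
  have h2 := hu y hy1.le hy2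
  nlinarith

/-- If the Hermite polynomials up to degree `m + 1` have alternating signs at `a`, then
`s ↦ J s a` has exactly one zero between `-(m + 1)` and `-m`. At a zero `s` the direction of the
crossing is read off from the sign of `J (s + 1) a`, which is known from the preceding interval. -/
theorem exists_unique_order {a : ℝ} (m : ℕ)
    (h : ∀ j ≤ m + 1, 0 < (-1 : ℝ) ^ j * hermiteFn (-j) a) :
    ∃ s ∈ Ioo (-(m : ℝ) - 1) (-m), hermiteFn s a = 0 ∧
      (∀ t, s < t → t ≤ -m → 0 < (-1 : ℝ) ^ m * hermiteFn t a) ∧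
      ∀ t, -(m : ℝ) - 1 ≤ t → t < s → (-1 : ℝ) ^ m * hermiteFn t a < 0 := by
  have sq1 : ∀ m : ℕ, ((-1 : ℝ) ^ m) * (-1) ^ m = 1 := fun m => by
    rw [← mul_pow]; norm_num
  have ne1 : ∀ m : ℕ, ((-1 : ℝ) ^ m) ≠ 0 := fun m => pow_ne_zero _ (by norm_num)
  induction m with
  | zero =>
    have hα := h 1 le_rfl
    have hc := continuous_hermiteFn_order a
    have hup : ∀ s ∈ Ioo (-1 : ℝ) 0, hermiteFn s a = 0 →
        ∀ᶠ t in 𝓝 s, t ≠ s → 0 < (t - s) * hermiteFn t a := by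
      intro s hs h0
      filter_upwards [eventually_crossing h0] with t ht hne
      have h3 := ht hne
      have h4 := hermiteFn_pos (by linarith [hs.1] : 0 ≤ s + 1) a
      rw [mul_right_comm] at h3
      exact (mul_pos_iff_of_pos_right h4).1 h3
    obtain ⟨s, hs, h0, h1, h2⟩ := exists_unique_sign_change (f := fun t => hermiteFn t a)
      (α := -1) (c := 0) (β := 0) hc (by norm_num) le_rfl (by norm_num at hα; exact hα)
      (hermiteFn_pos le_rfl a) hup (fun s hs => absurd hs (by simp))
    refine ⟨s, by simpa using hs, h0, fun t ht ht' => ?_, fun t ht ht' => ?_⟩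
    · simpa using h1 t ht (by simpa using ht')
    · simpa using h2 t (by simpa using ht) ht'
  | succ m ih =>
    -- With `z` the zero in the preceding interval, the crossings change direction at `z - 1`.
    obtain ⟨z, ⟨hz1, hz2⟩, hz0, hzr, hzl⟩ := ih fun j hj => h j (by omega)
    have hc : Continuous fun t => (-1 : ℝ) ^ (m + 1) * hermiteFn t a :=
      (continuous_hermiteFn_order a).const_mul _
    have hα := h (m + 2) le_rfl
    have hβ := h (m + 1) (by omega)
    push_cast at hα hβ
    have hα' : (-1 : ℝ) ^ (m + 1) * hermiteFn (-((m : ℝ) + 1) - 1) a < 0 := by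
      rw [pow_succ _ (m + 1)] at hα
      rw [show -((m : ℝ) + 1) - 1 = -((m : ℝ) + 2) by ring]
      linarith
    have hup : ∀ s ∈ Ioo (-((m : ℝ) + 1) - 1) (z - 1), (-1 : ℝ) ^ (m + 1) * hermiteFn s a = 0 →
        ∀ᶠ t in 𝓝 s, t ≠ s → 0 < (t - s) * ((-1 : ℝ) ^ (m + 1) * hermiteFn t a) := by
      intro s hs h0
      have h0 : hermiteFn s a = 0 := (mul_eq_zero.1 h0).resolve_left (ne1 _)
      filter_upwards [eventually_crossing h0] with t ht hne
      have h3 := ht hne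
      have h4 := hzl (s + 1) (by linarith [hs.1]) (by linarith [hs.2])
      have h5 : (t - s) * hermiteFn (s + 1) a * hermiteFn t a =
          (t - s) * ((-1) ^ (m + 1) * hermiteFn t a) * -((-1) ^ m * hermiteFn (s + 1) a) := by
        rw [pow_succ]
        linear_combination (-(t - s) * hermiteFn (s + 1) a * hermiteFn t a) * sq1 m
      rw [h5] at h3
      exact (mul_pos_iff_of_pos_right (by linarith)).1 h3
    have hdown : ∀ s ∈ Ico (z - 1) (-((m : ℝ) + 1)), (-1 : ℝ) ^ (m + 1) * hermiteFn s a = 0 →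
        ∀ᶠ t in 𝓝 s, t ≠ s → (t - s) * ((-1 : ℝ) ^ (m + 1) * hermiteFn t a) < 0 := by
      intro s hs h0
      have h0 : hermiteFn s a = 0 := (mul_eq_zero.1 h0).resolve_left (ne1 _)
      -- At `s = z - 1` the function cannot vanish, since `J z` vanishes.
      have hsz : z < s + 1 := (by linarith [hs.1] : z ≤ s + 1).lt_of_ne fun h => by
        rw [h] at hz0
        exact hermiteFn_ne_zero_of_succ_eq_zero s a hz0 h0
      filter_upwards [eventually_crossing h0] with t ht hne
      have h3 := ht hne
      have h4 := hzr (s + 1) hsz (by linarith [hs.2])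
      have h5 : (t - s) * hermiteFn (s + 1) a * hermiteFn t a =
          -((t - s) * ((-1) ^ (m + 1) * hermiteFn t a)) * ((-1) ^ m * hermiteFn (s + 1) a) := by
        rw [pow_succ]
        linear_combination (-(t - s) * hermiteFn (s + 1) a * hermiteFn t a) * sq1 m
      rw [h5] at h3
      have := (mul_pos_iff_of_pos_right h4).1 h3
      linarith
    obtain ⟨s, hs, h0, h1, h2⟩ := exists_unique_sign_change hc (by linarith) (by linarith) hα'
      hβ hup hdown
    push_cast
    exact ⟨s, ⟨hs.1, by linarith [hs.2]⟩, (mul_eq_zero.1 h0).resolve_left (ne1 _), h1, h2⟩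

/-- The functions of the form `1 + O(k⁻²)` as `k → ∞`. -/
def IsOneAdd (f : ℝ → ℝ) : Prop :=
  (fun k => f k - 1) =O[atTop] fun k : ℝ => k ^ (-2 : ℤ)

theorem tendsto_zpow_neg_two : Tendsto (fun k : ℝ => k ^ (-2 : ℤ)) atTop (𝓝 0) :=
  tendsto_zpow_atTop_zero (by norm_num)

theorem IsOneAdd.tendsto {f : ℝ → ℝ} (hf : IsOneAdd f) : Tendsto f atTop (𝓝 1) := by
  have := (hf.trans_tendsto tendsto_zpow_neg_two).add_const 1
  simpa using this

theorem IsOneAdd.congr {f g : ℝ → ℝ} (hf : IsOneAdd f) (h : f =ᶠ[atTop] g) : IsOneAdd g :=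
  IsBigO.congr' hf (h.mono fun k hk => by simp only [hk]) EventuallyEq.rfl

theorem isOneAdd_one : IsOneAdd fun _ => 1 := by
  simpa [IsOneAdd] using isBigO_zero (fun k : ℝ => k ^ (-2 : ℤ)) atTop

theorem IsOneAdd.mul {f g : ℝ → ℝ} (hf : IsOneAdd f) (hg : IsOneAdd g) :
    IsOneAdd fun k => f k * g k := by
  have h1 : (fun k => (f k - 1) * g k) =O[atTop] fun k : ℝ => k ^ (-2 : ℤ) := by
    simpa using IsBigO.mul hf (hg.tendsto.isBigO_one ℝ)
  exact (h1.add hg).congr_left fun k => by ring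

theorem IsOneAdd.inv {f : ℝ → ℝ} (hf : IsOneAdd f) : IsOneAdd fun k => (f k)⁻¹ := by
  have h1 := (hf.tendsto.inv₀ one_ne_zero).isBigO_one ℝ
  have h2 : (fun k => -(f k - 1) * (f k)⁻¹) =O[atTop] fun k : ℝ => k ^ (-2 : ℤ) := by
    simpa using IsBigO.mul (IsBigO.neg_left hf) h1
  refine h2.congr' ?_ EventuallyEq.rfl
  filter_upwards [hf.tendsto.eventually_ne one_ne_zero] with k hk
  field_simp
  ring

theorem IsOneAdd.pow {f : ℝ → ℝ} (hf : IsOneAdd f) (m : ℕ) : IsOneAdd fun k => f k ^ m := by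
  induction m with
  | zero => simpa using isOneAdd_one
  | succ m ih => simpa only [pow_succ] using ih.mul hf

/-- The monic Hermite polynomial of degree `m` is `k^m (1 + O(k⁻²))`; here it is evaluated at
`-k`. -/
theorem isOneAdd_hermiteFn (m : ℕ) :
    IsOneAdd fun k => (-1 : ℝ) ^ m * hermiteFn (-m) (-k) / k ^ m := by
  suffices key : ∀ m : ℕ, IsOneAdd (fun k => (-1 : ℝ) ^ m * hermiteFn (-m) (-k) / k ^ m) ∧
      IsOneAdd fun k => (-1 : ℝ) ^ (m + 1) * hermiteFn (-(m + 1 : ℕ)) (-k) / k ^ (m + 1) from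
    (key m).1
  intro m
  induction m with
  | zero =>
    refine ⟨by simpa [hermiteFn_zero] using isOneAdd_one, isOneAdd_one.congr ?_⟩
    filter_upwards [eventually_gt_atTop 0] with k hk
    rw [hermiteFn_recurrence]
    norm_num [hermiteFn_zero, hk.ne']
  | succ m ih =>
    refine ⟨ih.2, ?_⟩
    have h1 : (fun k : ℝ => (-((m : ℝ) + 1) / 2) * k ^ (-2 : ℤ) *
        ((-1 : ℝ) ^ m * hermiteFn (-m) (-k) / k ^ m)) =O[atTop] fun k : ℝ => k ^ (-2 : ℤ) := by
      simpa using ((isBigO_refl (fun k : ℝ => k ^ (-2 : ℤ)) atTop).const_mul_left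
        (-((m : ℝ) + 1) / 2)).mul (ih.1.tendsto.isBigO_one ℝ)
    refine (IsBigO.add ih.2 h1).congr' ?_ EventuallyEq.rfl
    filter_upwards [eventually_gt_atTop 0] with k hk
    rw [hermiteFn_recurrence (-((m + 1 + 1 : ℕ) : ℝ)),
      show (-((m + 1 + 1 : ℕ) : ℝ) + 2) = -(m : ℝ) by push_cast; ring,
      show (-((m + 1 + 1 : ℕ) : ℝ) + 1) = -((m + 1 : ℕ) : ℝ) by push_cast; ring]
    push_cast
    rw [show k ^ (-2 : ℤ) = (k ^ 2)⁻¹ by rw [zpow_neg]; norm_cast]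
    field_simp
    ring

theorem eventually_hermiteFn_neg_nat_pos (m : ℕ) :
    ∀ᶠ k : ℝ in atTop, 0 < (-1 : ℝ) ^ m * hermiteFn (-m) (-k) := by
  filter_upwards [(isOneAdd_hermiteFn m).tendsto.eventually_const_lt one_pos,
    eventually_gt_atTop 0] with k h hk
  have := mul_pos h (pow_pos hk m)
  rwa [div_mul_cancel₀ _ (pow_ne_zero _ hk.ne')] at this

/-- For an order strictly between `-m` and `1 - m`, the sign of `J s` near `-∞` is `(-1)^m`:
integrate `(J s)' = -s J (s + 1)`. -/
theorem eventually_le_hermiteFn (m : ℕ) {s : ℝ} (h1 : -(m : ℝ) < s) (h2 : s < 1 - m) :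
    ∃ c : ℝ, 0 < c ∧ ∀ᶠ k : ℝ in atTop, c ≤ (-1 : ℝ) ^ m * hermiteFn s (-k) := by
  induction m generalizing s with
  | zero =>
    have hs : 0 < s := by simpa using h1
    refine ⟨hermiteFn s 0, hermiteFn_pos hs.le 0, ?_⟩
    filter_upwards [eventually_ge_atTop 0] with k hk
    rw [pow_zero, one_mul, hermiteFn_of_pos hs, hermiteFn_of_pos hs]
    have := gaussMellin_anti hs (by linarith : -k ≤ 0)
    have := Real.Gamma_pos_of_pos hs
    gcongr
  | succ m ih =>
    push_cast at h1 h2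
    obtain ⟨c, hc, h⟩ := ih (s := s + 1) (by linarith) (by linarith)
    obtain ⟨K, hK⟩ := eventually_atTop.1 h
    have hs : s < 0 := by have : (0 : ℝ) ≤ m := m.cast_nonneg; linarith
    refine ⟨1, one_pos, ?_⟩
    have hd : ∀ k, HasDerivAt (fun k => (-1 : ℝ) ^ (m + 1) * hermiteFn s (-k))
        (-s * ((-1) ^ m * hermiteFn (s + 1) (-k))) k := by
      intro k
      have := ((hasDerivAt_hermiteFn s (-k)).comp k (hasDerivAt_neg k)).const_mul
        ((-1 : ℝ) ^ (m + 1))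
      refine this.congr_deriv ?_
      rw [pow_succ]
      ring
    set g := fun k => (-1 : ℝ) ^ (m + 1) * hermiteFn s (-k) with hg
    have hgrow : ∀ k, K ≤ k → g K + -s * c * (k - K) ≤ g k := by
      intro k hk
      have hmono : MonotoneOn (fun k => g k - -s * c * k) (Ici K) := by
        refine monotoneOn_of_hasDerivWithinAt_nonneg (convex_Ici K)
          (f' := fun k => -s * ((-1) ^ m * hermiteFn (s + 1) (-k)) - -s * c) ?_ ?_ ?_
        · exact fun x _ => ((hd x).continuousAt.sub (by fun_prop)).continuousWithinAt
        · intro x _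
          exact ((hd x).sub ((hasDerivAt_id x).const_mul (-s * c))).hasDerivWithinAt.congr_deriv
            (by simp)
        · intro x hx
          rw [interior_Ici] at hx
          have := mul_le_mul_of_nonneg_left (hK x (le_of_lt hx)) (by linarith : 0 ≤ -s)
          linarith
      have := hmono (mem_Ici.2 le_rfl) (mem_Ici.2 hk) hk
      simp only at this
      linarith
    have hpos : 0 < -s * c := mul_pos (by linarith) hc
    filter_upwards [eventually_ge_atTop K, eventually_ge_atTop (K + (1 - g K) / (-s * c))]
      with k hk1 hk2
    refine le_trans ?_ (hgrow k hk1)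
    have h3 : (1 - g K) / (-s * c) ≤ k - K := by linarith
    rw [div_le_iff₀ hpos] at h3
    linarith

/-! ### Branches of zeros -/

theorem tendsto_weberDeriv_comp {l : Filter ℝ} {f g : ℝ → ℝ} {a b : ℝ} (hf : Tendsto f l (𝓝 a))
    (hg : Tendsto g l (𝓝 b)) : Tendsto (fun t => weberDeriv (f t) (g t)) l (𝓝 (weberDeriv a b)) := by
  have h := Tendsto.comp (continuous_weberDeriv_uncurry.tendsto (a, b)) (hf.prodMk_nhds hg)
  simp only [Function.comp_def] at h
  exact h

/-- For each `k ≥ K`, the number `S k` is the only zero of `s ↦ J s (-k)` between `-(m + 1)`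
and `-m`; the sign of `J s (-k)` on both sides of it is part of the definition. -/
structure IsBranch (m : ℕ) (K : ℝ) (S : ℝ → ℝ) : Prop where
  mem : ∀ k, K ≤ k → S k ∈ Ioo (-(m : ℝ) - 1) (-m)
  zero : ∀ k, K ≤ k → hermiteFn (S k) (-k) = 0
  pos : ∀ k, K ≤ k → ∀ t, S k < t → t ≤ -m → 0 < (-1 : ℝ) ^ m * hermiteFn t (-k)
  neg : ∀ k, K ≤ k → ∀ t, -(m : ℝ) - 1 ≤ t → t < S k → (-1 : ℝ) ^ m * hermiteFn t (-k) < 0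

theorem IsBranch.eq_of_zero {m : ℕ} {K : ℝ} {S : ℝ → ℝ} (h : IsBranch m K S) {k t : ℝ}
    (hk : K ≤ k) (ht : t ∈ Ioo (-(m : ℝ) - 1) (-m)) (h0 : hermiteFn t (-k) = 0) : t = S k := by
  rcases lt_trichotomy t (S k) with hlt | heq | hgt
  · have := h.neg k hk t ht.1.le hlt
    rw [h0, mul_zero] at this
    exact absurd this (lt_irrefl _)
  · exact heq
  · have := h.pos k hk t hgt ht.2.le
    rw [h0, mul_zero] at this
    exact absurd this (lt_irrefl _)

theorem IsBranch.lt_of_neg {m : ℕ} {K : ℝ} {S : ℝ → ℝ} (h : IsBranch m K S) {k t : ℝ}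
    (hk : K ≤ k) (ht : t ≤ -m) (h0 : (-1 : ℝ) ^ m * hermiteFn t (-k) < 0) : t < S k := by
  by_contra hle
  rcases (not_lt.1 hle).eq_or_lt with heq | hlt
  · rw [← heq, h.zero k hk, mul_zero] at h0
    exact lt_irrefl _ h0
  · exact lt_asymm h0 (h.pos k hk t hlt ht)

theorem IsBranch.lt_of_pos {m : ℕ} {K : ℝ} {S : ℝ → ℝ} (h : IsBranch m K S) {k t : ℝ}
    (hk : K ≤ k) (ht : -(m : ℝ) - 1 ≤ t) (h0 : 0 < (-1 : ℝ) ^ m * hermiteFn t (-k)) : S k < t := by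
  by_contra hle
  rcases (not_lt.1 hle).eq_or_lt with heq | hlt
  · rw [heq, h.zero k hk, mul_zero] at h0
    exact lt_irrefl _ h0
  · exact lt_asymm h0 (h.neg k hk t ht hlt)

/-- The sign of `J t` at `-k` persists near `k`, and it decides on which side of `t` the branch
is. -/
theorem IsBranch.continuousAt {m : ℕ} {K : ℝ} {S : ℝ → ℝ} (h : IsBranch m K S) {k : ℝ}
    (hk : K < k) : ContinuousAt S k := by
  have hev : ∀ᶠ k' in 𝓝 k, K ≤ k' := eventually_ge_nhds hk
  have hc : ∀ t, Tendsto (fun k' => (-1 : ℝ) ^ m * hermiteFn t (-k')) (𝓝 k)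
      (𝓝 ((-1 : ℝ) ^ m * hermiteFn t (-k))) := fun t =>
    ((continuous_hermiteFn t).comp continuous_neg).tendsto k |>.const_mul _
  refine tendsto_order.2 ⟨fun t ht => ?_, fun t ht => ?_⟩
  · by_cases h1 : -(m : ℝ) - 1 ≤ t
    · filter_upwards [hev, (hc t).eventually_lt_const (h.neg k hk.le t h1 ht)] with k' hk' h2
      exact h.lt_of_neg hk' (ht.le.trans (h.mem k hk.le).2.le) h2
    · filter_upwards [hev] with k' hk'
      exact (not_le.1 h1).trans (h.mem k' hk').1
  · by_cases h1 : t ≤ -m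
    · filter_upwards [hev, (hc t).eventually_const_lt (h.pos k hk.le t ht h1)] with k' hk' h2
      exact h.lt_of_pos hk' ((h.mem k hk.le).1.le.trans ht.le) h2
    · filter_upwards [hev] with k' hk'
      exact (h.mem k' hk').2.trans (not_le.1 h1)

/-- Every order `t` between `-(m + 1)` and `-m` is passed by the branch, since `(-1)^m J t` is
negative near `-∞`. -/
theorem IsBranch.tendsto {m : ℕ} {K : ℝ} {S : ℝ → ℝ} (h : IsBranch m K S) :
    Tendsto S atTop (𝓝 (-m)) := by
  refine tendsto_order.2 ⟨fun t ht => ?_, fun t ht => ?_⟩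
  · by_cases h1 : -(m : ℝ) - 1 < t
    · obtain ⟨c, hc, hev⟩ := eventually_le_hermiteFn (m + 1) (s := t) (by push_cast; linarith)
        (by push_cast; linarith)
      filter_upwards [hev, eventually_ge_atTop K] with k h2 hk
      refine h.lt_of_neg hk ht.le ?_
      rw [pow_succ] at h2
      linarith
    · filter_upwards [eventually_ge_atTop K] with k hk
      exact (not_lt.1 h1).trans_lt (h.mem k hk).1
  · filter_upwards [eventually_ge_atTop K] with k hk
    exact (h.mem k hk).2.trans ht

/-- The mean value theorem, without an order on the end points. -/
theorem exists_eq_deriv_mul_sub {f f' : ℝ → ℝ} (hf : ∀ x, HasDerivAt f (f' x) x) (x y : ℝ) :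
    ∃ ξ, |ξ - x| ≤ |y - x| ∧ f y - f x = f' ξ * (y - x) := by
  have hc : Continuous f := continuous_iff_continuousAt.2 fun x => (hf x).continuousAt
  rcases lt_trichotomy x y with h | h | h
  · obtain ⟨ξ, ⟨h1, h2⟩, h3⟩ := exists_hasDerivAt_eq_slope f f' h hc.continuousOn fun x _ => hf x
    refine ⟨ξ, ?_, ?_⟩
    · rw [abs_of_pos (by linarith), abs_of_pos (by linarith)]; linarith
    · rw [h3, div_mul_cancel₀ _ (by linarith)]
  · exact ⟨x, by simp, by simp [h]⟩
  · obtain ⟨ξ, ⟨h1, h2⟩, h3⟩ := exists_hasDerivAt_eq_slope f f' h hc.continuousOn fun x _ => hf x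
    refine ⟨ξ, ?_, ?_⟩
    · rw [abs_of_neg (by linarith), abs_of_neg (by linarith)]; linarith
    · have : x - y ≠ 0 := by linarith
      rw [h3, ← neg_sub x y, mul_neg, div_mul_cancel₀ _ this]
      ring

/-- The derivative of a branch of zeros, from the Wronskian of the solutions with the orders `S k`
and `S k'` and the mean value theorem. -/
theorem hasDerivAt_of_zero {S : ℝ → ℝ} {k : ℝ} (hS : ContinuousAt S k)
    (h0 : ∀ᶠ k' in 𝓝 k, hermiteFn (S k') (-k') = 0) :
    HasDerivAt S (weberDeriv (S k) (-k) ^ 2 / (2 * overlap (S k) (S k) (-k))) k := by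
  have hk0 : weberFn (S k) (-k) = 0 := weberFn_eq_zero_iff.2 h0.self_of_nhds
  -- The Wronskian at `-k` is `D' (S k) (-k) D (S k') (-k)`, and `D (S k')` vanishes at `-k'`.
  have hmvt : ∀ k', ∃ ξ, |ξ - -k| ≤ |k' - k| ∧ weberFn (S k') (-k) - weberFn (S k') (-k') =
      weberDeriv (S k') ξ * (k' - k) := by
    intro k'
    obtain ⟨ξ, h1, h2⟩ := exists_eq_deriv_mul_sub (hasDerivAt_weberFn (S k')) (-k) (-k')
    rw [show -k' - -k = -(k' - k) by ring] at h1 h2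
    rw [abs_neg] at h1
    exact ⟨ξ, h1, by linarith⟩
  choose ξ hξ hξ' using hmvt
  have hξt : Tendsto ξ (𝓝 k) (𝓝 (-k)) := by
    rw [tendsto_iff_norm_sub_tendsto_zero]
    refine squeeze_zero (fun _ => norm_nonneg _) hξ ?_
    have : Continuous fun k' : ℝ => |k' - k| := by fun_prop
    simpa using this.tendsto k
  have hov : Tendsto (fun k' => overlap (S k') (S k) (-k)) (𝓝 k) (𝓝 (overlap (S k) (S k) (-k))) :=
    (tendsto_overlap (S k) (-k)).comp hS
  have hpos := overlap_self_pos (S k) (-k)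
  have hder := tendsto_weberDeriv_comp hS hξt
  rw [hasDerivAt_iff_tendsto_slope]
  have hlim := ((hder.const_mul (weberDeriv (S k) (-k))).div (hov.const_mul 2)
    (by positivity)).mono_left (nhdsWithin_le_nhds (s := {k}ᶜ))
  rw [← sq] at hlim
  refine hlim.congr' ?_
  filter_upwards [self_mem_nhdsWithin, nhdsWithin_le_nhds h0,
    nhdsWithin_le_nhds (hov.eventually_const_lt hpos)] with k' hne hz ho
  have hne' : k' - k ≠ 0 := sub_ne_zero.2 hne
  have hw := weberWronskian_eq (S k) (S k') (-k)
  have h1 := hξ' k'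
  rw [weberFn_eq_zero_iff.2 hz, sub_zero] at h1
  rw [weberWronskian, hk0, zero_mul, sub_zero, h1, overlap_comm] at hw
  rw [slope_def_field]
  simp only [Pi.div_apply]
  rw [div_eq_div_iff (by positivity) hne']
  linarith

theorem IsBranch.hasDerivAt {m : ℕ} {K : ℝ} {S : ℝ → ℝ} (h : IsBranch m K S) {k : ℝ}
    (hk : K < k) :
    HasDerivAt S (weberDeriv (S k) (-k) ^ 2 / (2 * overlap (S k) (S k) (-k))) k :=
  hasDerivAt_of_zero (h.continuousAt hk) ((eventually_ge_nhds hk).mono fun k' hk' => h.zero k' hk')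

theorem IsBranch.strictMonoOn {m : ℕ} {K : ℝ} {S : ℝ → ℝ} (h : IsBranch m K S) :
    StrictMonoOn S (Ioi K) := by
  refine strictMonoOn_of_deriv_pos (convex_Ioi K)
    (fun k hk => (h.continuousAt hk).continuousWithinAt) fun k hk => ?_
  rw [interior_Ioi] at hk
  rw [(h.hasDerivAt hk).deriv]
  have h1 := overlap_self_pos (S k) (-k)
  have h2 := weberDeriv_ne_zero (weberFn_eq_zero_iff.2 (h.zero k (le_of_lt hk)))
  positivity

theorem overlap_neg_eq (s s' : ℝ) {r₁ r₂ : ℝ} (h : r₁ ≤ r₂) :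
    overlap s s' (-r₂) =
      overlap s s' (-r₁) + ∫ r in r₁..r₂, weberFn s (-r) * weberFn s' (-r) := by
  have h1 := intervalIntegral.integral_comp_neg (a := r₁) (b := r₂)
    (fun x => weberFn s x * weberFn s' x)
  rw [h1, intervalIntegral.integral_of_le (neg_le_neg h), add_comm]
  have i := integrableOn_weberFn_mul s s' (-r₂)
  unfold overlap
  rw [← setIntegral_union (Ioc_disjoint_Ioi le_rfl) measurableSet_Ioi
    (i.mono_set Ioc_subset_Ioi_self) (i.mono_set (Ioi_subset_Ioi (neg_le_neg h))),
    Ioc_union_Ioi_eq_Ioi (neg_le_neg h)]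

/-! ### The Hermite function on the left half-line -/

/-- The logarithmic derivative of the Hermite function near `-∞`: that of the Gaussian at `-r`
is `r`, and that of the Hermite polynomial is `O(1/r)` and negative. -/
theorem exists_logDeriv_bounds (m : ℕ) :
    ∃ B : ℝ, 0 ≤ B ∧ ∀ᶠ r : ℝ in atTop, weberFn (-m) (-r) ≠ 0 ∧
      r - B / r ≤ weberDeriv (-m) (-r) / weberFn (-m) (-r) ∧
      weberDeriv (-m) (-r) / weberFn (-m) (-r) ≤ r := by
  rcases m with _ | m
  · refine ⟨0, le_rfl, Eventually.of_forall fun r => ?_⟩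
    have e := Real.exp_ne_zero (-(-r) ^ 2 / 2)
    have h1 : weberFn (-(0 : ℕ)) (-r) = Real.exp (-(-r) ^ 2 / 2) := by
      simp [weberFn, hermiteFn_zero]
    have h2 : weberDeriv (-(0 : ℕ)) (-r) = Real.exp (-(-r) ^ 2 / 2) * r := by
      simp [weberDeriv, hermiteFn_zero]
    rw [h1, h2, mul_div_cancel_left₀ _ e]
    exact ⟨e, by simp, le_rfl⟩
  · refine ⟨4 * (m + 1), by positivity, ?_⟩
    have ta := (isOneAdd_hermiteFn (m + 1)).tendsto
    have tb := (isOneAdd_hermiteFn m).tendsto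
    filter_upwards [ta.eventually_const_lt (show (1 / 2 : ℝ) < 1 by norm_num),
      tb.eventually_const_lt one_pos, tb.eventually_lt_const one_lt_two, eventually_gt_atTop 0]
      with r ha hb1 hb2 hr
    set a := (-1 : ℝ) ^ (m + 1) * hermiteFn (-(m + 1 : ℕ)) (-r) / r ^ (m + 1) with ha'
    set b := (-1 : ℝ) ^ m * hermiteFn (-m) (-r) / r ^ m with hb'
    have sq1 : ((-1 : ℝ) ^ m) * (-1) ^ m = 1 := by rw [← mul_pow]; norm_num
    have hJ1 : hermiteFn (-(m + 1 : ℕ)) (-r) = -((-1 : ℝ) ^ m * a * r ^ (m + 1)) := by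
      rw [ha', pow_succ (-1 : ℝ)]
      field_simp
      linear_combination -hermiteFn (-(m + 1 : ℕ)) (-r) * sq1
    have hJ0 : hermiteFn (-m) (-r) = (-1 : ℝ) ^ m * b * r ^ m := by
      rw [hb']
      field_simp
      linear_combination -hermiteFn (-m) (-r) * sq1
    have e := Real.exp_pos (-(-r) ^ 2 / 2)
    have ha0 : 0 < a := by linarith
    have s0 : ((-1 : ℝ) ^ m) ≠ 0 := pow_ne_zero _ (by norm_num)
    have hJne : hermiteFn (-(m + 1 : ℕ)) (-r) ≠ 0 := by
      rw [hJ1]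
      exact neg_ne_zero.2 (mul_ne_zero (mul_ne_zero s0 ha0.ne') (pow_ne_zero _ hr.ne'))
    have key : weberDeriv (-(m + 1 : ℕ)) (-r) / weberFn (-(m + 1 : ℕ)) (-r) =
        r - (m + 1) * (b / a) / r := by
      unfold weberDeriv weberFn
      rw [mul_div_mul_left _ _ e.ne', show (-((m + 1 : ℕ) : ℝ) + 1) = -(m : ℝ) by push_cast; ring,
        hJ0, hJ1, pow_succ r]
      push_cast
      have : r ^ m ≠ 0 := pow_ne_zero _ hr.ne'
      field_simp
      ring
    refine ⟨mul_ne_zero e.ne' hJne, ?_, ?_⟩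
    · rw [key]
      have : b / a ≤ 4 := by rw [div_le_iff₀ ha0]; linarith
      have h3 : (m + 1 : ℝ) * (b / a) / r ≤ (m + 1) * 4 / r := by gcongr
      rw [mul_comm 4]
      linarith
    · rw [key]
      have : 0 ≤ (m + 1 : ℝ) * (b / a) / r := by positivity
      linarith

/-- The reciprocal of the squared Hermite function at `-r`; the variable is reflected, so that the
region of interest is `r → ∞`. -/
noncomputable def invSq (m : ℕ) (r : ℝ) : ℝ := (weberFn (-m) (-r) ^ 2)⁻¹

theorem invSq_pos {m : ℕ} {r : ℝ} (h : weberFn (-m) (-r) ≠ 0) : 0 < invSq m r := by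
  unfold invSq
  positivity

theorem hasDerivAt_invSq {m : ℕ} {r : ℝ} (h : weberFn (-m) (-r) ≠ 0) :
    HasDerivAt (invSq m)
      (2 * (weberDeriv (-m) (-r) / weberFn (-m) (-r)) * invSq m r) r := by
  have h1 := (hasDerivAt_weberFn (-m) (-r)).comp r (hasDerivAt_neg r)
  have h2 := (h1.pow 2).inv (pow_ne_zero 2 h)
  refine h2.congr_deriv ?_
  unfold invSq
  simp only [Function.comp_apply, Pi.pow_apply]
  field_simp
  norm_num
  ring

/-- Laplace asymptotics of `∫ h⁻²` for the Hermite function `h`: near the end point the integrand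
`h⁻²` grows like `exp (r²)`, with logarithmic derivative `2 r + O(1/r)`. -/
theorem exists_integral_invSq_bounds (m : ℕ) :
    ∃ R : ℝ, 1 ≤ R ∧ (∀ r, R ≤ r → weberFn (-m) (-r) ≠ 0) ∧ ∀ K, R ≤ K → ∃ C : ℝ, 0 ≤ C ∧
      ∀ k, K ≤ k →
        (∫ r in K..k, invSq m r / r ^ 2) ≤ invSq m k / k ^ 3 ∧
        |(∫ r in K..k, invSq m r) - invSq m k / (2 * k)| ≤ C * (invSq m k / k ^ 3) := by
  obtain ⟨B, hB, hev⟩ := exists_logDeriv_bounds m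
  obtain ⟨R₀, hR₀⟩ := eventually_atTop.1 hev
  -- Beyond this point `2 L / r - 3 / r² ≥ 1` for the logarithmic derivative `L`.
  set R := max R₀ (2 * B + 3) with hR
  have hR1 : 1 ≤ R := le_trans (by linarith) (le_max_right _ _)
  have hRB : 2 * B + 3 ≤ R := le_max_right _ _
  refine ⟨R, hR1, fun r hr => (hR₀ r ((le_max_left _ _).trans hr)).1, fun K hK => ?_⟩
  have hlow : ∀ r, R ≤ r → r - B / r ≤ weberDeriv (-m) (-r) / weberFn (-m) (-r) :=
    fun r hr => (hR₀ r ((le_max_left _ _).trans hr)).2.1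
  have hupp : ∀ r, R ≤ r → weberDeriv (-m) (-r) / weberFn (-m) (-r) ≤ r :=
    fun r hr => (hR₀ r ((le_max_left _ _).trans hr)).2.2
  have hne : ∀ r, R ≤ r → weberFn (-m) (-r) ≠ 0 :=
    fun r hr => (hR₀ r ((le_max_left _ _).trans hr)).1
  have hK0 : 0 < K := by linarith
  set L : ℝ → ℝ := fun r => weberDeriv (-m) (-r) / weberFn (-m) (-r) with hL
  have hφd : ∀ r, R ≤ r → HasDerivAt (invSq m) (2 * L r * invSq m r) r :=
    fun r hr => hasDerivAt_invSq (hne r hr)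
  refine ⟨B + 1 / 2 + K ^ 2 / 2, by positivity, fun k hk => ?_⟩
  have hmem : ∀ r ∈ uIcc K k, K ≤ r := fun r hr => by
    rw [uIcc_of_le hk] at hr; exact hr.1
  have hcφ : ContinuousOn (invSq m) (uIcc K k) := fun r hr =>
    (hφd r (hK.trans (hmem r hr))).continuousAt.continuousWithinAt
  have hcL : ContinuousOn L (uIcc K k) := by
    refine ContinuousOn.div ?_ ?_ fun r hr => hne r (hK.trans (hmem r hr))
    · exact ((continuous_weberDeriv _).comp continuous_neg).continuousOn
    · exact ((continuous_weberFn _).comp continuous_neg).continuousOn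
  have hr0 : ∀ r ∈ uIcc K k, r ≠ 0 := fun r hr => by
    have := hmem r hr; linarith
  -- The derivatives of `invSq / r³` and `invSq / (2 r)`.
  set f₃ : ℝ → ℝ := fun r => invSq m r * (2 * L r / r ^ 3 - 3 / r ^ 4) with hf₃
  set f₁ : ℝ → ℝ := fun r => invSq m r * (L r / r - 1 / (2 * r ^ 2)) with hf₁
  have hd₃ : ∀ r ∈ uIcc K k, HasDerivAt (fun r => invSq m r / r ^ 3) (f₃ r) r := by
    intro r hr
    have h0 := hr0 r hr
    refine ((hφd r (hK.trans (hmem r hr))).div (hasDerivAt_pow 3 r)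
      (pow_ne_zero 3 h0)).congr_deriv ?_
    simp only [hf₃]
    field_simp
    norm_num
    ring
  have hd₁ : ∀ r ∈ uIcc K k, HasDerivAt (fun r => invSq m r / (2 * r)) (f₁ r) r := by
    intro r hr
    have h0 := hr0 r hr
    refine ((hφd r (hK.trans (hmem r hr))).div ((hasDerivAt_id r).const_mul 2)
      (mul_ne_zero two_ne_zero h0)).congr_deriv ?_
    simp only [hf₁, id]
    field_simp
  have hi₃ : IntervalIntegrable f₃ volume K k := by
    refine ContinuousOn.intervalIntegrable (hcφ.mul (ContinuousOn.sub ?_ ?_))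
    · exact (hcL.const_smul (2 : ℝ)).div (by fun_prop) fun r hr => pow_ne_zero 3 (hr0 r hr)
    · exact continuousOn_const.div (by fun_prop) fun r hr => pow_ne_zero 4 (hr0 r hr)
  have hi₁ : IntervalIntegrable f₁ volume K k := by
    refine ContinuousOn.intervalIntegrable (hcφ.mul (ContinuousOn.sub ?_ ?_))
    · exact hcL.div (by fun_prop) fun r hr => hr0 r hr
    · exact continuousOn_const.div (by fun_prop) fun r hr =>
        mul_ne_zero two_ne_zero (pow_ne_zero 2 (hr0 r hr))
  have hi₂ : IntervalIntegrable (fun r => invSq m r / r ^ 2) volume K k :=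
    (hcφ.div (by fun_prop) fun r hr => pow_ne_zero 2 (hr0 r hr)).intervalIntegrable
  have hi₀ : IntervalIntegrable (invSq m) volume K k := hcφ.intervalIntegrable
  have hpos : ∀ r, K ≤ r → 0 < invSq m r := fun r hr => invSq_pos (hne r (hK.trans hr))
  have e₃ := intervalIntegral.integral_eq_sub_of_hasDerivAt hd₃ hi₃
  have e₁ := intervalIntegral.integral_eq_sub_of_hasDerivAt hd₁ hi₁
  have b₃ : ∫ r in K..k, invSq m r / r ^ 2 ≤ ∫ r in K..k, f₃ r := by
    refine intervalIntegral.integral_mono_on hk hi₂ hi₃ fun r hr => ?_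
    have hrK := hr.1
    have hrpos : 0 < r := by linarith
    have hl := hlow r (hK.trans hrK)
    have h1 : 1 / r ^ 2 ≤ 2 * L r / r ^ 3 - 3 / r ^ 4 := by
      have h2 : 2 * (r - B / r) / r ^ 3 ≤ 2 * L r / r ^ 3 := by gcongr
      have h3 : 2 * (r - B / r) / r ^ 3 - 3 / r ^ 4 - 1 / r ^ 2 = (r ^ 2 - (2 * B + 3)) / r ^ 4 := by
        field_simp
        ring
      have h4 : 0 ≤ (r ^ 2 - (2 * B + 3)) / r ^ 4 := by
        apply div_nonneg _ (by positivity)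
        nlinarith
      linarith
    calc invSq m r / r ^ 2 = invSq m r * (1 / r ^ 2) := by ring
      _ ≤ _ := mul_le_mul_of_nonneg_left h1 (hpos r hrK).le
  have b₁ : ∫ r in K..k, f₁ r ≤ ∫ r in K..k, invSq m r := by
    refine intervalIntegral.integral_mono_on hk hi₁ hi₀ fun r hr => ?_
    have hrpos : 0 < r := by linarith [hr.1]
    have hl := hupp r (hK.trans hr.1)
    have h1 : L r / r - 1 / (2 * r ^ 2) ≤ 1 := by
      have : L r / r ≤ 1 := (div_le_one hrpos).2 hl
      have : 0 ≤ 1 / (2 * r ^ 2) := by positivity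
      linarith
    exact mul_le_of_le_one_right (hpos r hr.1).le h1
  have b₂ : (∫ r in K..k, invSq m r) - (B + 1 / 2) * ∫ r in K..k, invSq m r / r ^ 2 ≤
      ∫ r in K..k, f₁ r := by
    rw [← intervalIntegral.integral_const_mul, ← intervalIntegral.integral_sub hi₀
      (hi₂.const_mul _)]
    refine intervalIntegral.integral_mono_on hk (hi₀.sub (hi₂.const_mul _)) hi₁ fun r hr => ?_
    have hrpos : 0 < r := by linarith [hr.1]
    have hl := hlow r (hK.trans hr.1)
    have h1 : 1 - (B + 1 / 2) / r ^ 2 ≤ L r / r - 1 / (2 * r ^ 2) := by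
      have h2 : (r - B / r) / r ≤ L r / r := by gcongr
      have h3 : (r - B / r) / r - 1 / (2 * r ^ 2) = 1 - (B + 1 / 2) / r ^ 2 := by
        field_simp
        ring
      linarith
    calc _ = invSq m r * (1 - (B + 1 / 2) / r ^ 2) := by ring
      _ ≤ _ := mul_le_mul_of_nonneg_left h1 (hpos r hr.1).le
  have pK : 0 < invSq m K := hpos K le_rfl
  have pI : 0 ≤ ∫ r in K..k, invSq m r / r ^ 2 :=
    intervalIntegral.integral_nonneg hk fun r hr => by
      have := hpos r hr.1
      have : 0 < r := by linarith [hr.1]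
      positivity
  have q3 : 0 ≤ invSq m K / K ^ 3 := by positivity
  have qk : invSq m K / K ^ 3 ≤ invSq m k / k ^ 3 := by linarith
  have q1 : invSq m K / (2 * K) = K ^ 2 / 2 * (invSq m K / K ^ 3) := by field_simp
  refine ⟨by linarith, ?_⟩
  have hkk : ∫ r in K..k, invSq m r / r ^ 2 ≤ invSq m k / k ^ 3 := by linarith
  have m1 := mul_le_mul_of_nonneg_left hkk (by linarith : 0 ≤ B + 1 / 2)
  have m2 := mul_le_mul_of_nonneg_left qk (by positivity : 0 ≤ K ^ 2 / 2)
  have m3 : 0 ≤ K ^ 2 / 2 * (invSq m K / K ^ 3) := by positivity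
  have m4 : 0 ≤ K ^ 2 / 2 * (invSq m k / k ^ 3) := m3.trans m2
  have m5 : 0 ≤ (B + 1 / 2) * (invSq m k / k ^ 3) := mul_nonneg (by linarith) (q3.trans qk)
  rw [add_mul, abs_le]
  constructor <;> linarith

theorem exists_abs_weberFn_neg_nat_le (m : ℕ) :
    ∃ C : ℝ, 0 ≤ C ∧ ∀ x, |weberFn (-m) x| ≤ C * Real.exp (-x ^ 2 / 4) := by
  obtain ⟨C, c, hC, -, h⟩ := exists_abs_hermiteFn_neg_nat_le m
  refine ⟨C * Real.exp (c ^ 2), by positivity, fun x => ?_⟩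
  rw [weberFn, abs_mul, Real.abs_exp]
  calc _ ≤ Real.exp (-x ^ 2 / 2) * (C * Real.exp (c * |x|)) := by gcongr; exact h x
    _ = C * (Real.exp (c * |x|) * Real.exp (-x ^ 2 / 2)) := by ring
    _ ≤ C * (Real.exp (c ^ 2) * Real.exp (-x ^ 2 / 4)) :=
        mul_le_mul_of_nonneg_left (exp_mul_abs_mul_gauss_le c x) hC
    _ = _ := by ring

/-- The squared norm of the Hermite function on the whole line. -/
noncomputable def hermiteNorm (m : ℕ) : ℝ := ∫ x, weberFn (-m) x ^ 2

theorem exists_sq_weberFn_neg_nat_le (m : ℕ) :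
    ∃ C : ℝ, 0 ≤ C ∧ ∀ x, weberFn (-m) x ^ 2 ≤ C * Real.exp (-x ^ 2 / 2) := by
  obtain ⟨C, hC, h⟩ := exists_abs_weberFn_neg_nat_le m
  refine ⟨C ^ 2, by positivity, fun x => ?_⟩
  rw [← gauss_mul_gauss, ← sq, ← mul_pow, ← sq_abs]
  exact pow_le_pow_left₀ (abs_nonneg _) (h x) 2

theorem integrable_weberFn_sq (m : ℕ) : Integrable fun x => weberFn (-m) x ^ 2 := by
  obtain ⟨C, hC, h⟩ := exists_sq_weberFn_neg_nat_le m
  refine (integrable_gauss_half.const_mul C).mono'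
    ((continuous_weberFn _).pow 2).aestronglyMeasurable (Eventually.of_forall fun x => ?_)
  rw [Real.norm_of_nonneg (sq_nonneg _)]
  exact h x

theorem integrable_sq_mul_weberFn_sq (m : ℕ) :
    Integrable fun x => x ^ 2 * weberFn (-m) x ^ 2 := by
  obtain ⟨C, hC, h⟩ := exists_sq_weberFn_neg_nat_le m
  have hg : Integrable fun x : ℝ => Real.exp (-x ^ 2 / 4) := by
    refine (integrable_exp_neg_mul_sq (b := 1 / 4) (by norm_num)).congr
      (Eventually.of_forall fun x => ?_)
    simp only
    congr 1
    ring
  refine (hg.const_mul (4 * C)).mono'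
    ((continuous_pow 2).mul ((continuous_weberFn _).pow 2)).aestronglyMeasurable
    (Eventually.of_forall fun x => ?_)
  rw [Real.norm_of_nonneg (by positivity)]
  have h1 : x ^ 2 / 4 ≤ Real.exp (x ^ 2 / 4) := by linarith [Real.add_one_le_exp (x ^ 2 / 4)]
  have h2 : Real.exp (x ^ 2 / 4) * Real.exp (-x ^ 2 / 2) = Real.exp (-x ^ 2 / 4) := by
    rw [← Real.exp_add]; ring_nf
  calc x ^ 2 * weberFn (-m) x ^ 2 ≤ (4 * Real.exp (x ^ 2 / 4)) * (C * Real.exp (-x ^ 2 / 2)) :=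
        mul_le_mul (by linarith) (h x) (sq_nonneg _) (by positivity)
    _ = 4 * C * (Real.exp (x ^ 2 / 4) * Real.exp (-x ^ 2 / 2)) := by ring
    _ = _ := by rw [h2]

/-- The part of the norm of the Hermite function to the left of `-r` is `O(r⁻²)`. -/
theorem exists_hermiteNorm_sub_overlap_le (m : ℕ) :
    ∃ C : ℝ, 0 ≤ C ∧ ∀ r, 0 < r → 0 ≤ hermiteNorm m - overlap (-m) (-m) (-r) ∧
      hermiteNorm m - overlap (-m) (-m) (-r) ≤ C / r ^ 2 := by
  refine ⟨∫ x, x ^ 2 * weberFn (-m) x ^ 2, integral_nonneg fun x => by positivity,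
    fun r hr => ?_⟩
  have i1 := integrable_weberFn_sq m
  have i2 := integrable_sq_mul_weberFn_sq m
  have e : hermiteNorm m - overlap (-m) (-m) (-r) = ∫ x in Iic (-r), weberFn (-m) x ^ 2 := by
    have := intervalIntegral.integral_Iic_add_Ioi (b := -r) i1.integrableOn i1.integrableOn
    simp only [hermiteNorm, overlap, ← sq]
    linarith
  rw [e]
  refine ⟨setIntegral_nonneg measurableSet_Iic fun x _ => sq_nonneg _, ?_⟩
  rw [le_div_iff₀ (by positivity), mul_comm, ← integral_const_mul]
  calc ∫ x in Iic (-r), r ^ 2 * weberFn (-m) x ^ 2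
      ≤ ∫ x in Iic (-r), x ^ 2 * weberFn (-m) x ^ 2 := by
        refine setIntegral_mono_on (i1.const_mul _).integrableOn i2.integrableOn
          measurableSet_Iic fun x hx => ?_
        have hx : x ≤ -r := hx
        have : r ^ 2 ≤ x ^ 2 := by nlinarith
        gcongr
    _ ≤ _ := setIntegral_le_integral i2 (Eventually.of_forall fun x => by positivity)

theorem hermiteNorm_pos (m : ℕ) : 0 < hermiteNorm m := by
  obtain ⟨C, -, h⟩ := exists_hermiteNorm_sub_overlap_le m
  linarith [(h 1 one_pos).1, overlap_self_pos (-m) (-1)]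

/-! ### Comparison of a branch with the Hermite function -/

theorem weberDeriv_mul_of_zero {s s' a : ℝ} (h : hermiteFn s a = 0) :
    weberDeriv s a * weberFn s' a = 2 * (s' - s) * overlap s s' a := by
  have := weberWronskian_eq s s' a
  rwa [weberWronskian, weberFn_eq_zero_iff.2 h, zero_mul, sub_zero] at this

/-- Comparison of the solution `u = D s`, `s = S k`, which vanishes at `-k`, with the Hermite
function `h = D (-m)` on `[-k, -K]`. The quotient `ζ = u / h` satisfies `ζ' = W / h²` with the
Wronskian `W x = δ ∫ₓ^∞ u h`, `δ = 2 (-m - s)`; it vanishes at `-k` and increases up to its value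
`c` at `-K`. -/
theorem IsBranch.comparison {m : ℕ} {K₀ : ℝ} {S : ℝ → ℝ} (hS : IsBranch m K₀ S) {K k C C' : ℝ}
    (hK₀ : K₀ < K) (hK1 : 0 < K) (hk : K ≤ k)
    (hne : ∀ r, K ≤ r → weberFn (-m) (-r) ≠ 0)
    (hC : ∀ r, 0 < r → hermiteNorm m - overlap (-m) (-m) (-r) ≤ C / r ^ 2)
    (hC' : ∀ r, K ≤ r → (∫ x in K..r, invSq m x) ≤ C' * invSq m r)
    (hI : (∫ r in K..k, invSq m r / r ^ 2) ≤ invSq m k / k ^ 3)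
    (hM : overlap (-m) (-m) (-k) ≤ hermiteNorm m)
    {δ c : ℝ} (hδ : δ = 2 * (-m - S k))
    (hc : c = weberFn (S k) (-K) / weberFn (-m) (-K)) (hc0 : 0 < c)
    (hA : 0 < overlap (S k) (-m) (-K)) :
    c ≤ δ * overlap (S k) (-m) (-k) * (∫ r in K..k, invSq m r) ∧
    δ * overlap (S k) (-m) (-k) * (∫ r in K..k, invSq m r) - δ * c * C * (invSq m k / k ^ 3) ≤ c ∧
    overlap (S k) (-m) (-K) ≤ overlap (S k) (-m) (-k) ∧
    overlap (S k) (-m) (-k) ≤ overlap (S k) (-m) (-K) +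
      c * (overlap (-m) (-m) (-k) - overlap (-m) (-m) (-K)) ∧
    |overlap (S k) (-m) (-k) - overlap (S k) (-m) (-K) -
      c * (overlap (-m) (-m) (-k) - overlap (-m) (-m) (-K))| ≤
      δ * overlap (S k) (-m) (-k) * C' * k ∧
    |overlap (S k) (S k) (-k) - overlap (S k) (S k) (-K) -
      c ^ 2 * (overlap (-m) (-m) (-k) - overlap (-m) (-m) (-K))| ≤
      2 * c * (δ * overlap (S k) (-m) (-k) * C' * k) := by
  set s := S k with hs
  set σ : ℝ := -m with hσ
  have hKk : K₀ ≤ k := hK₀.le.trans hk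
  have hsσ : s < σ := (hS.mem k hKk).2
  have hδ0 : 0 < δ := by rw [hδ]; linarith
  set ζ : ℝ → ℝ := fun r => weberFn s (-r) / weberFn σ (-r) with hζ
  have hζk : ζ k = 0 := by
    simp only [hζ]
    rw [weberFn_eq_zero_iff.2 (hS.zero k hKk), zero_div]
  have hφpos : ∀ r, K ≤ r → 0 < invSq m r := fun r hr => invSq_pos (hne r hr)
  have hφ : ∀ r, K ≤ r → invSq m r * weberFn σ (-r) ^ 2 = 1 := fun r hr => by
    unfold invSq
    exact inv_mul_cancel₀ (pow_ne_zero 2 (hne r hr))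
  have hu : ∀ r, K ≤ r → weberFn s (-r) = ζ r * weberFn σ (-r) := fun r hr =>
    (div_mul_cancel₀ _ (hne r hr)).symm
  have hcont : ∀ t, Continuous fun r : ℝ => weberFn t (-r) := fun t =>
    (continuous_weberFn t).comp continuous_neg
  have hζd : ∀ r, K ≤ r → HasDerivAt ζ (-(δ * overlap s σ (-r) * invSq m r)) r := by
    intro r hr
    have h1 := (hasDerivAt_weberFn s (-r)).comp r (hasDerivAt_neg r)
    have h2 := (hasDerivAt_weberFn σ (-r)).comp r (hasDerivAt_neg r)
    have hw := weberWronskian_eq s σ (-r)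
    rw [← hδ] at hw
    refine (h1.div h2 (hne r hr)).congr_deriv ?_
    rw [← hw, weberWronskian]
    unfold invSq
    have := hne r hr
    simp only [Function.comp_apply]
    rw [← hσ] at *
    field_simp
    ring
  have hζc : ContinuousOn ζ (Ici K) := fun r hr => (hζd r hr).continuousAt.continuousWithinAt
  -- The branch is injective, so that `u` has no zero in `(-k, -K]`.
  have hζpos : ∀ r, K ≤ r → r < k → 0 < ζ r := by
    intro r hr hrk
    by_contra hneg
    have hKr : ζ K = c := hc.symm
    obtain ⟨x, ⟨hx1, hx2⟩, hx0⟩ := intermediate_value_Icc' hr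
      (hζc.mono fun y hy => hy.1) (show (0 : ℝ) ∈ Icc (ζ r) (ζ K) from
        ⟨not_lt.1 hneg, by rw [hKr]; exact hc0.le⟩)
    have hz : hermiteFn s (-x) = 0 := by
      rw [← weberFn_eq_zero_iff, hu x hx1, hx0, zero_mul]
    have hKx : K₀ < x := hK₀.trans_le hx1
    have heq := hS.eq_of_zero hKx.le (hS.mem k hKk) hz
    have hlt := hS.strictMonoOn (mem_Ioi.2 hKx) (mem_Ioi.2 (hK₀.trans_le hk)) (hx2.trans_lt hrk)
    linarith
  have hζnn : ∀ r, K ≤ r → r ≤ k → 0 ≤ ζ r := by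
    intro r hr hrk
    rcases hrk.eq_or_lt with rfl | h
    · exact hζk.ge
    · exact (hζpos r hr h).le
  -- Monotonicity of the overlap integrals.
  have hov : ∀ r₁ r₂, K ≤ r₁ → r₁ ≤ r₂ → r₂ ≤ k → overlap s σ (-r₁) ≤ overlap s σ (-r₂) := by
    intro r₁ r₂ h1 h2 h3
    rw [overlap_neg_eq s σ h2]
    have : 0 ≤ ∫ r in r₁..r₂, weberFn s (-r) * weberFn σ (-r) := by
      refine intervalIntegral.integral_nonneg h2 fun r hr => ?_
      rw [hu r (h1.trans hr.1), mul_assoc, ← sq]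
      exact mul_nonneg (hζnn r (h1.trans hr.1) (hr.2.trans h3)) (sq_nonneg _)
    linarith
  set N := overlap s σ (-k) with hN
  have hN0 : 0 < N := hA.trans_le (hov K k le_rfl hk le_rfl)
  have hcφ : ∀ r, ContinuousOn (invSq m) (uIcc K r) ∨ r < K := by
    intro r
    rcases le_or_gt K r with h | h
    · left
      intro x hx
      rw [uIcc_of_le h] at hx
      exact (hasDerivAt_invSq (hne x hx.1)).continuousAt.continuousWithinAt
    · exact Or.inr h
  have hiφ : ∀ r, K ≤ r → IntervalIntegrable (invSq m) volume K r := fun r hr =>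
    ((hcφ r).resolve_right (not_lt.2 hr)).intervalIntegrable
  have hcW : Continuous fun r => δ * overlap s σ (-r) := by
    have : (fun r => δ * overlap s σ (-r)) = fun r => weberWronskian s σ (-r) := by
      funext r
      rw [weberWronskian_eq, hδ]
    rw [this]
    exact (continuous_iff_continuousAt.2 fun x =>
      (hasDerivAt_weberWronskian s σ x).continuousAt).comp continuous_neg
  have hiW : ∀ r, K ≤ r → IntervalIntegrable (fun r => δ * overlap s σ (-r) * invSq m r)
      volume K r := fun r hr =>
    (hcW.continuousOn.mul ((hcφ r).resolve_right (not_lt.2 hr))).intervalIntegrable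
  have hζint : ∀ r, K ≤ r → c - ζ r = ∫ x in K..r, δ * overlap s σ (-x) * invSq m x := by
    intro r hr
    have h1 := intervalIntegral.integral_eq_sub_of_hasDerivAt (a := K) (b := r) (f := ζ)
      (f' := fun x => -(δ * overlap s σ (-x) * invSq m x)) (fun x hx => by
        rw [uIcc_of_le hr] at hx
        exact hζd x hx.1) (hiW r hr).neg
    rw [intervalIntegral.integral_neg] at h1
    have hKr : ζ K = c := hc.symm
    linarith
  have hdiff : ∀ r, K ≤ r → r ≤ k → 0 ≤ c - ζ r ∧ c - ζ r ≤ δ * N * ∫ x in K..r, invSq m x := by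
    intro r hr hrk
    rw [hζint r hr]
    constructor
    · refine intervalIntegral.integral_nonneg hr fun x hx => ?_
      have h1 := hov K x le_rfl hx.1 (hx.2.trans hrk)
      have h2 := hφpos x hx.1
      have h3 := hA.trans_le h1
      positivity
    · rw [← intervalIntegral.integral_const_mul]
      refine intervalIntegral.integral_mono_on hr (hiW r hr) ((hiφ r hr).const_mul _) fun x hx => ?_
      have h1 := hov x k hx.1 (hx.2.trans hrk) le_rfl
      have h2 := hφpos x hx.1
      gcongr
  have hζle : ∀ r, K ≤ r → r ≤ k → ζ r ≤ c := fun r hr hrk => by linarith [(hdiff r hr hrk).1]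
  -- The growth of `∫ h⁻²` is compensated by the factor `h²`.
  have hh2 : ∀ r, K ≤ r → r ≤ k →
      0 ≤ (c - ζ r) * weberFn σ (-r) ^ 2 ∧ (c - ζ r) * weberFn σ (-r) ^ 2 ≤ δ * N * C' := by
    intro r hr hrk
    obtain ⟨h1, h2⟩ := hdiff r hr hrk
    refine ⟨mul_nonneg h1 (sq_nonneg _), ?_⟩
    calc (c - ζ r) * weberFn σ (-r) ^ 2
        ≤ (δ * N * (C' * invSq m r)) * weberFn σ (-r) ^ 2 := by
          refine mul_le_mul_of_nonneg_right (h2.trans ?_) (sq_nonneg _)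
          exact mul_le_mul_of_nonneg_left (hC' r hr) (by positivity)
      _ = δ * N * C' * (invSq m r * weberFn σ (-r) ^ 2) := by ring
      _ = _ := by rw [hφ r hr, mul_one]
  have hi : ∀ t t' a b : ℝ, IntervalIntegrable (fun r => weberFn t (-r) * weberFn t' (-r))
      volume a b := fun t t' a b => ((hcont t).mul (hcont t')).intervalIntegrable a b
  -- The part of the overlap between `-k` and `-r` is at most `c` times that of `h` with itself.
  have hrem : ∀ r, K ≤ r → r ≤ k →
      N - overlap s σ (-r) ≤ c * (overlap σ σ (-k) - overlap σ σ (-r)) := by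
    intro r hr hrk
    rw [hN, overlap_neg_eq s σ hrk, overlap_neg_eq σ σ hrk, add_sub_cancel_left,
      add_sub_cancel_left, ← intervalIntegral.integral_const_mul]
    refine intervalIntegral.integral_mono_on hrk (hi _ _ _ _) ((hi _ _ _ _).const_mul _)
      fun x hx => ?_
    rw [hu x (hr.trans hx.1), mul_assoc]
    exact mul_le_mul_of_nonneg_right (hζle x (hr.trans hx.1) hx.2) (mul_self_nonneg _)
  have hck : c = ∫ x in K..k, δ * overlap s σ (-x) * invSq m x := by
    have := hζint k hk
    rwa [hζk, sub_zero] at this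
  have hkK : |k - K| ≤ k := by rw [abs_of_nonneg (by linarith)]; linarith
  have hC'0 : 0 ≤ δ * N * C' := (hh2 K le_rfl hk).1.trans (hh2 K le_rfl hk).2
  refine ⟨?_, ?_, hov K k le_rfl hk le_rfl, ?_, ?_, ?_⟩
  · have := (hdiff k hk le_rfl).2
    rwa [hζk, sub_zero] at this
  · have hcI : ContinuousOn (fun r => invSq m r / r ^ 2) (uIcc K k) :=
      ((hcφ k).resolve_right (not_lt.2 hk)).div (by fun_prop) fun r hr => by
        rw [uIcc_of_le hk] at hr
        exact pow_ne_zero 2 (by linarith [hr.1])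
    have hC0 : 0 ≤ C := by
      have h1 := hC k (by linarith)
      have h2 : 0 ≤ C / k ^ 2 := le_trans (by linarith) h1
      have h3 : 0 < k ^ 2 := by have : 0 < k := by linarith
                                positivity
      by_contra hneg
      have := div_neg_of_neg_of_pos (not_le.1 hneg) h3
      linarith
    have h1 : (∫ r in K..k, (δ * N * invSq m r - δ * c * C * (invSq m r / r ^ 2))) ≤ c := by
      conv_rhs => rw [hck]
      refine intervalIntegral.integral_mono_on hk (((hiφ k hk).const_mul _).sub
        (hcI.intervalIntegrable.const_mul _)) (hiW k hk) fun r hr => ?_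
      have h2 := hrem r hr.1 hr.2
      have h3 := hC r (by linarith [hr.1])
      have h4 : c * (overlap σ σ (-k) - overlap σ σ (-r)) ≤ c * (C / r ^ 2) :=
        mul_le_mul_of_nonneg_left (by linarith) hc0.le
      have h5 : N - c * (C / r ^ 2) ≤ overlap s σ (-r) := by linarith
      have h6 := hφpos r hr.1
      calc _ = δ * (N - c * (C / r ^ 2)) * invSq m r := by ring
        _ ≤ _ := by gcongr
    rw [intervalIntegral.integral_sub ((hiφ k hk).const_mul _)
        (hcI.intervalIntegrable.const_mul _), intervalIntegral.integral_const_mul,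
        intervalIntegral.integral_const_mul] at h1
    have h7 := mul_le_mul_of_nonneg_left hI (by positivity : 0 ≤ δ * c * C)
    linarith
  · have := hrem K le_rfl hk
    linarith
  · rw [hN, overlap_neg_eq s σ hk, overlap_neg_eq σ σ hk, add_sub_cancel_left,
      add_sub_cancel_left, ← intervalIntegral.integral_const_mul,
      ← intervalIntegral.integral_sub (hi _ _ _ _) ((hi _ _ _ _).const_mul _),
      ← overlap_neg_eq s σ hk, ← hN, ← Real.norm_eq_abs]
    refine (intervalIntegral.norm_integral_le_of_norm_le_const (C := δ * N * C')
      fun r hr => ?_).trans (mul_le_mul_of_nonneg_left hkK hC'0)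
    rw [uIoc_of_le hk] at hr
    obtain ⟨h1, h2⟩ := hh2 r hr.1.le hr.2
    rw [hu r hr.1.le, Real.norm_eq_abs, show ζ r * weberFn σ (-r) * weberFn σ (-r) -
      c * (weberFn σ (-r) * weberFn σ (-r)) = -((c - ζ r) * weberFn σ (-r) ^ 2) by ring, abs_neg,
      abs_of_nonneg h1]
    exact h2
  · rw [overlap_neg_eq s s hk, overlap_neg_eq σ σ hk, add_sub_cancel_left,
      add_sub_cancel_left, ← intervalIntegral.integral_const_mul,
      ← intervalIntegral.integral_sub (hi _ _ _ _) ((hi _ _ _ _).const_mul _),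
      ← Real.norm_eq_abs]
    refine (intervalIntegral.norm_integral_le_of_norm_le_const (C := 2 * c * (δ * N * C'))
      fun r hr => ?_).trans ?_
    · rw [uIoc_of_le hk] at hr
      obtain ⟨h1, h2⟩ := hh2 r hr.1.le hr.2
      have h3 := hζnn r hr.1.le hr.2
      have h4 := hζle r hr.1.le hr.2
      rw [hu r hr.1.le, Real.norm_eq_abs,
        show ζ r * weberFn σ (-r) * (ζ r * weberFn σ (-r)) -
          c ^ 2 * (weberFn σ (-r) * weberFn σ (-r)) =
          -((c + ζ r) * ((c - ζ r) * weberFn σ (-r) ^ 2)) by ring, abs_neg,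
        abs_of_nonneg (mul_nonneg (by linarith) h1)]
      exact mul_le_mul (by linarith) h2 h1 (by linarith)
    · calc _ ≤ 2 * c * (δ * N * C') * k := mul_le_mul_of_nonneg_left hkK (by positivity)
        _ = _ := by ring

/-! ### Asymptotics of a branch -/

theorem isOneAdd_of_le {f : ℝ → ℝ} (D : ℝ) (h : ∀ᶠ k in atTop, |f k - 1| ≤ D / k ^ 2) :
    IsOneAdd f := by
  refine IsBigO.of_bound D ?_
  filter_upwards [h, eventually_gt_atTop 0] with k hk hk0
  rw [Real.norm_eq_abs, Real.norm_of_nonneg (by positivity),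
    show k ^ (-2 : ℤ) = (k ^ 2)⁻¹ by rw [zpow_neg]; norm_cast]
  exact hk

theorem isOneAdd_div_of_le {f : ℝ → ℝ} {M : ℝ} (hM : 0 < M) (D : ℝ)
    (h : ∀ᶠ k in atTop, |f k - M| ≤ D / k ^ 2) : IsOneAdd fun k => f k / M := by
  refine isOneAdd_of_le (D / M) ?_
  filter_upwards [h] with k hk
  rw [show f k / M - 1 = (f k - M) / M by field_simp, abs_div, abs_of_pos hM,
    div_right_comm]
  gcongr

theorem exists_sq_weberFn_neg_nat_le_div (m : ℕ) :
    ∃ C : ℝ, 0 ≤ C ∧ ∀ k, 0 < k → weberFn (-m) (-k) ^ 2 ≤ C / k ^ 4 := by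
  obtain ⟨C, hC, h⟩ := exists_sq_weberFn_neg_nat_le m
  refine ⟨8 * C, by positivity, fun k hk => (h (-k)).trans ?_⟩
  have h1 := Real.quadratic_le_exp_of_nonneg (show 0 ≤ k ^ 2 / 2 by positivity)
  have h2 : k ^ 4 / 8 ≤ Real.exp (k ^ 2 / 2) := by
    refine le_trans ?_ h1
    have : 0 ≤ k ^ 2 := by positivity
    linarith [show (k ^ 2 / 2) ^ 2 / 2 = k ^ 4 / 8 by ring]
  have h3 : Real.exp (-(-k) ^ 2 / 2) = (Real.exp (k ^ 2 / 2))⁻¹ := by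
    rw [← Real.exp_neg]; ring_nf
  rw [h3, ← div_eq_mul_inv]
  calc C / Real.exp (k ^ 2 / 2) ≤ C / (k ^ 4 / 8) := by gcongr
    _ = _ := by field_simp

/-- Asymptotics of a branch `S` of zeros and of the quantity that governs its derivative, in terms
of the Hermite function `h` of degree `m`: with `δ = 2 (-m - S k)`, one has
`δ ~ 2 k h(-k)² / ‖h‖²`. Integrating `ζ' = W / h²` from `-k` to `-K` expresses the limit `1` of `ζ`
at `-K` as `δ ‖h‖²` times `∫ h⁻² ~ h(-k)⁻² / (2 k)`. -/
theorem IsBranch.asymptotics {m : ℕ} {K₀ : ℝ} {S : ℝ → ℝ} (hS : IsBranch m K₀ S) :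
    IsOneAdd (fun k => 2 * (-m - S k) * (hermiteNorm m * invSq m k / (2 * k))) ∧
    IsOneAdd (fun k => weberDeriv (S k) (-k) ^ 2 / overlap (S k) (S k) (-k) *
      (hermiteNorm m * invSq m k / (4 * k ^ 2))) := by
  obtain ⟨R, hR1, hne, hR⟩ := exists_integral_invSq_bounds m
  set K := max (K₀ + 1) R with hK
  have hKR : R ≤ K := le_max_right _ _
  have hK₀ : K₀ < K := lt_of_lt_of_le (by linarith) (le_max_left _ _)
  have hK1 : 1 ≤ K := hR1.trans hKR
  obtain ⟨C, hC, hΦ⟩ := hR K hKR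
  obtain ⟨T, hT, htail⟩ := exists_hermiteNorm_sub_overlap_le m
  obtain ⟨H, hH, hh⟩ := exists_sq_weberFn_neg_nat_le_div m
  obtain ⟨C₁, hC₁, hL₁⟩ := exists_abs_weberFn_sub_le (-m) (-K)
  obtain ⟨C₂, hC₂, hL₂⟩ := exists_abs_overlap_sub_le (-m) (-K)
  have hneK : ∀ r, K ≤ r → weberFn (-m) (-r) ≠ 0 := fun r hr => hne r (hKR.trans hr)
  have hφpos : ∀ r, K ≤ r → 0 < invSq m r := fun r hr => invSq_pos (hneK r hr)
  have hM := hermiteNorm_pos m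
  set M := hermiteNorm m with hMdef
  set A₀ := overlap (-m) (-m) (-K) with hA₀
  have hA₀pos : 0 < A₀ := overlap_self_pos _ _
  have hA₀M : A₀ ≤ M := by linarith [(htail K (by linarith)).1]
  set δ : ℝ → ℝ := fun k => 2 * (-m - S k) with hδ
  set c : ℝ → ℝ := fun k => weberFn (S k) (-K) / weberFn (-m) (-K) with hc
  set N : ℝ → ℝ := fun k => overlap (S k) (-m) (-k) with hN
  set N₂ : ℝ → ℝ := fun k => overlap (S k) (S k) (-k) with hN₂
  set A₁ : ℝ → ℝ := fun k => overlap (S k) (-m) (-K) with hA₁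
  set A₂ : ℝ → ℝ := fun k => overlap (S k) (S k) (-K) with hA₂
  set Φ : ℝ → ℝ := fun k => ∫ r in K..k, invSq m r with hΦdef
  set O : ℝ → ℝ := fun k => overlap (-m) (-m) (-k) with hO
  set C₁' := C₁ * Real.exp (-(-K) ^ 2 / 4) / |weberFn (-m) (-K)| with hC₁'
  have hC₁'0 : 0 ≤ C₁' := by positivity
  have hSt := hS.tendsto
  have hδpos : ∀ k, K ≤ k → 0 < δ k := fun k hk => by
    have := (hS.mem k (hK₀.le.trans hk)).2
    simp only [hδ]
    linarith
  have hδt : Tendsto δ atTop (𝓝 0) := by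
    have := (hSt.const_sub (-(m : ℝ))).const_mul 2
    simpa using this
  have hδS : ∀ k, K ≤ k → |S k - -m| ≤ δ k := fun k hk => by
    have := hδpos k hk
    simp only [hδ] at this ⊢
    rw [abs_le]
    constructor <;> linarith
  have ec : ∀ᶠ k in atTop, |c k - 1| ≤ C₁' * δ k := by
    filter_upwards [hSt.eventually hL₁, eventually_ge_atTop K] with k h hk
    have h1 := h (-K) le_rfl
    have h2 := hneK K le_rfl
    have h3 : 0 < |weberFn (-m) (-K)| := abs_pos.2 h2
    rw [show c k - 1 = (weberFn (S k) (-K) - weberFn (-m) (-K)) / weberFn (-m) (-K) by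
      simp only [hc]; field_simp, abs_div, div_le_iff₀ h3]
    refine h1.trans ?_
    rw [hC₁']
    calc _ ≤ C₁ * δ k * Real.exp (-(-K) ^ 2 / 4) := by gcongr; exact hδS k hk
      _ = _ := by field_simp
  have eA : ∀ᶠ k in atTop, |A₁ k - A₀| ≤ C₂ * δ k ∧ |A₂ k - A₀| ≤ C₂ * δ k := by
    filter_upwards [hSt.eventually hL₂, eventually_ge_atTop K] with k h hk
    have h1 : C₂ * |S k - -m| ≤ C₂ * δ k := mul_le_mul_of_nonneg_left (hδS k hk) hC₂
    exact ⟨h.1.trans h1, h.2.trans h1⟩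
  have esmall : ∀ᶠ k in atTop, C₁' * δ k ≤ 1 / 2 ∧ C₂ * δ k ≤ A₀ / 2 := by
    have h1 := hδt.const_mul C₁'
    have h2 := hδt.const_mul C₂
    rw [mul_zero] at h1 h2
    filter_upwards [h1.eventually_le_const (show (0 : ℝ) < 1 / 2 by norm_num),
      h2.eventually_le_const (show (0 : ℝ) < A₀ / 2 by positivity)] with k a b using ⟨a, b⟩
  set C' := C + 1 with hC'
  have hΦφ : ∀ r, K ≤ r → Φ r ≤ C' * invSq m r := by
    intro r hr
    have h1 := (abs_le.1 (hΦ r hr).2).2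
    have hφ := hφpos r hr
    have hr1 : 1 ≤ r := hK1.trans hr
    have h2 : invSq m r / (2 * r) ≤ invSq m r := div_le_self hφ.le (by linarith)
    have h3 : C * (invSq m r / r ^ 3) ≤ C * invSq m r :=
      mul_le_mul_of_nonneg_left (div_le_self hφ.le (one_le_pow₀ hr1)) hC
    simp only [hΦdef]
    linarith
  -- All the estimates of the comparison with the Hermite function, for large `k`.
  have ecomp : ∀ᶠ k in atTop, K ≤ k ∧ 1 / 2 ≤ c k ∧ c k ≤ 2 ∧ A₀ / 2 ≤ N k ∧
      N k ≤ 2 * A₀ + 2 * M ∧ c k ≤ δ k * N k * Φ k ∧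
      δ k * N k * Φ k - δ k * c k * T * (invSq m k / k ^ 3) ≤ c k ∧
      |N k - A₁ k - c k * (O k - A₀)| ≤ δ k * N k * C' * k ∧
      |N₂ k - A₂ k - c k ^ 2 * (O k - A₀)| ≤ 2 * c k * (δ k * N k * C' * k) ∧
      0 ≤ O k - A₀ ∧ O k ≤ M ∧ M - O k ≤ T / k ^ 2 := by
    filter_upwards [ec, eA, esmall, eventually_ge_atTop K] with k h1 h2 h3 hk
    have hc1 := abs_le.1 h1
    have hA1 := abs_le.1 h2.1
    have hk0 : 0 < k := by linarith
    have htk := htail k hk0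
    have hc0 : 0 < c k := by linarith
    have hA : 0 < A₁ k := by linarith
    obtain ⟨g1, g2, g3, g4, g5, g6⟩ := hS.comparison hK₀ (by linarith) hk hneK
      (fun r hr => (htail r hr).2) hΦφ (hΦ k hk).1 (by linarith) (δ := δ k) (c := c k) rfl rfl hc0 hA
    have hO0 : 0 ≤ O k - A₀ := by
      simp only [hO, hA₀]
      rw [overlap_neg_eq (-m) (-m) hk, add_sub_cancel_left]
      exact intervalIntegral.integral_nonneg hk fun r _ => mul_self_nonneg _
    have hOM : O k ≤ M := by linarith
    refine ⟨hk, by linarith, by linarith, ?_, ?_, g1, g2, g5, g6, hO0, hOM, htk.2⟩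
    · exact le_trans (by linarith) g3
    · refine g4.trans ?_
      have : c k * (O k - A₀) ≤ 2 * M :=
        mul_le_mul (by linarith) (by linarith) hO0 (by norm_num)
      simp only [hO, hA₀] at this ⊢
      have h5 : A₁ k ≤ 2 * A₀ := by linarith
      simp only [hA₁, hA₀] at h5
      linarith
  -- A priori bound on `δ`, from the lower bound `A₀ / 2` of the overlap.
  have eδφ : ∀ᶠ k in atTop, δ k * invSq m k ≤ 16 / A₀ * k := by
    set E := A₀ * C / 2 + 2 * T with hE
    have hE0 : 0 ≤ E := by positivity
    filter_upwards [ecomp, (tendsto_pow_atTop (α := ℝ) two_ne_zero).eventually_ge_atTop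
      (8 * E / A₀)] with k h hkE
    obtain ⟨hk, hc1, hc2, hN1, -, -, g2, -⟩ := h
    have hk0 : 0 < k := by linarith
    have hφ := hφpos k hk
    have hδ0 := hδpos k hk
    have h1 := (abs_le.1 (hΦ k hk).2).1
    have h2 : invSq m k / (2 * k) - C * (invSq m k / k ^ 3) ≤ Φ k := by
      simp only [hΦdef]; linarith
    rw [div_le_iff₀ hA₀pos] at hkE
    have hfac : invSq m k / (2 * k) - C * (invSq m k / k ^ 3) =
        invSq m k / k ^ 3 * (k ^ 2 / 2 - C) := by field_simp
    set p := invSq m k / k ^ 3 with hp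
    have hp0 : 0 < p := by positivity
    have hpk : invSq m k = p * k ^ 3 := by rw [hp]; field_simp
    have hCk : C ≤ k ^ 2 / 2 := by
      have : 8 * (A₀ * C / 2) ≤ k ^ 2 * A₀ := by
        refine le_trans ?_ hkE
        have : 0 ≤ T := hT
        linarith
      have h4 : A₀ * (4 * C) ≤ A₀ * k ^ 2 := by linarith
      have := le_of_mul_le_mul_left h4 hA₀pos
      linarith
    have h5 : A₀ / 2 * (p * (k ^ 2 / 2 - C)) ≤ N k * Φ k := by
      rw [hfac] at h2
      exact mul_le_mul hN1 h2 (mul_nonneg hp0.le (by linarith)) (by linarith)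
    have h6 : δ k * (A₀ / 2 * (p * (k ^ 2 / 2 - C))) - δ k * 2 * T * p ≤ 2 := by
      have a1 := mul_le_mul_of_nonneg_left h5 hδ0.le
      have a2 : δ k * c k * T * p ≤ δ k * 2 * T * p := by gcongr
      linarith
    have h7 : δ k * p * (k ^ 2 * A₀ / 8) ≤ 2 := by
      have a3 : k ^ 2 * A₀ / 8 ≤ A₀ * k ^ 2 / 4 - E := by linarith
      have a4 := mul_le_mul_of_nonneg_left a3 (mul_pos hδ0 hp0).le
      have a5 : δ k * (A₀ / 2 * (p * (k ^ 2 / 2 - C))) - δ k * 2 * T * p =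
        δ k * p * (A₀ * k ^ 2 / 4 - E) := by rw [hE]; ring
      linarith
    have e : δ k * invSq m k * A₀ = δ k * (p * k ^ 3) * A₀ := by rw [← hpk]
    rw [div_mul_eq_mul_div, le_div_iff₀ hA₀pos, e]
    have := mul_le_mul_of_nonneg_right h7 (by positivity : 0 ≤ 8 * k)
    linarith
  set D := 16 / A₀ * H with hD
  have hD0 : 0 ≤ D := by positivity
  -- As `h²` decays like a Gaussian, the a priori bound gives `δ k = O(k⁻²)`.
  have eδ : ∀ᶠ k in atTop, δ k * k ≤ D / k ^ 2 ∧ δ k ≤ D / k ^ 2 := by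
    filter_upwards [eδφ, eventually_ge_atTop K] with k h hk
    have hk0 : 0 < k := by linarith
    have hk1 : 1 ≤ k := hK1.trans hk
    have hδ0 := hδpos k hk
    have h1 : invSq m k * weberFn (-m) (-k) ^ 2 = 1 := by
      unfold invSq
      exact inv_mul_cancel₀ (pow_ne_zero 2 (hneK k hk))
    have h2 : δ k ≤ 16 / A₀ * k * (H / k ^ 4) := by
      calc δ k = δ k * invSq m k * weberFn (-m) (-k) ^ 2 := by rw [mul_assoc, h1, mul_one]
        _ ≤ _ := mul_le_mul h (hh k hk0) (sq_nonneg _) (by positivity)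
    have h3 : δ k * k ≤ D / k ^ 2 := by
      calc δ k * k ≤ 16 / A₀ * k * (H / k ^ 4) * k := by gcongr
        _ = _ := by rw [hD]; field_simp
    exact ⟨h3, le_trans (le_mul_of_one_le_right hδ0.le hk1) h3⟩
  have oc : IsOneAdd c := by
    refine isOneAdd_of_le (C₁' * D) ?_
    filter_upwards [ec, eδ] with k h1 h2
    refine h1.trans ?_
    rw [mul_div_assoc]
    exact mul_le_mul_of_nonneg_left h2.2 hC₁'0
  have oN : IsOneAdd fun k => N k / M := by
    refine isOneAdd_div_of_le hM (D * ((2 * A₀ + 2 * M) * C') + C₂ * D + C₁' * D * M + T) ?_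
    filter_upwards [ecomp, ec, eA, eδ] with k h hc1 hA hδ1
    obtain ⟨hk, -, -, hN1, hN2, -, -, g5, -, hO0, hOM, hOT⟩ := h
    have hδ0 := hδpos k hk
    rw [show N k - M = (N k - A₁ k - c k * (O k - A₀)) + (A₁ k - A₀) + (c k - 1) * (O k - A₀) +
      (O k - M) by ring, add_div, add_div, add_div]
    refine (abs_add_le _ _).trans (add_le_add ((abs_add_three _ _ _).trans
      (add_le_add (add_le_add ?_ ?_) ?_)) ?_)
    · refine g5.trans ?_
      calc δ k * N k * C' * k = δ k * k * (N k * C') := by ring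
        _ ≤ D / k ^ 2 * ((2 * A₀ + 2 * M) * C') := by
            have : 0 < k := by linarith
            have : 0 ≤ N k := by linarith
            gcongr
            exact hδ1.1
        _ = _ := by ring
    · refine hA.1.trans ?_
      rw [mul_div_assoc]
      exact mul_le_mul_of_nonneg_left hδ1.2 hC₂
    · rw [abs_mul, abs_of_nonneg hO0]
      calc _ ≤ (C₁' * δ k) * M := mul_le_mul hc1 (by linarith) hO0 (by positivity)
        _ ≤ (C₁' * (D / k ^ 2)) * M := by gcongr; exact hδ1.2
        _ = _ := by ring
    · rw [abs_sub_comm, abs_of_nonneg (by linarith)]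
      exact hOT
  have oN₂ : IsOneAdd fun k => N₂ k / M := by
    refine isOneAdd_div_of_le hM (4 * (D * ((2 * A₀ + 2 * M) * C')) + C₂ * D +
      3 * (C₁' * D * M) + T) ?_
    filter_upwards [ecomp, ec, eA, eδ] with k h hc1 hA hδ1
    obtain ⟨hk, hc2, hc3, hN1, hN2, -, -, -, g6, hO0, hOM, hOT⟩ := h
    have hδ0 := hδpos k hk
    rw [show N₂ k - M = (N₂ k - A₂ k - c k ^ 2 * (O k - A₀)) + (A₂ k - A₀) +
      ((c k + 1) * (c k - 1)) * (O k - A₀) + (O k - M) by ring, add_div, add_div, add_div]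
    refine (abs_add_le _ _).trans (add_le_add ((abs_add_three _ _ _).trans
      (add_le_add (add_le_add ?_ ?_) ?_)) ?_)
    · refine g6.trans ?_
      calc 2 * c k * (δ k * N k * C' * k) = 2 * c k * (δ k * k * (N k * C')) := by ring
        _ ≤ 2 * 2 * (D / k ^ 2 * ((2 * A₀ + 2 * M) * C')) := by
            have : 0 < k := by linarith
            have : 0 ≤ N k := by linarith
            gcongr
            exact hδ1.1
        _ = _ := by ring
    · refine hA.2.trans ?_
      rw [mul_div_assoc]
      exact mul_le_mul_of_nonneg_left hδ1.2 hC₂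
    · rw [abs_mul, abs_mul, abs_of_nonneg hO0, abs_of_nonneg (by linarith : 0 ≤ c k + 1)]
      calc _ ≤ (3 * (C₁' * δ k)) * M := by
            refine mul_le_mul (mul_le_mul (by linarith) hc1 (abs_nonneg _) (by norm_num))
              (by linarith) hO0 (by positivity)
        _ ≤ (3 * (C₁' * (D / k ^ 2))) * M := by gcongr; exact hδ1.2
        _ = _ := by ring
    · rw [abs_sub_comm, abs_of_nonneg (by linarith)]
      exact hOT
  have oΦ : IsOneAdd fun k => 2 * k * Φ k / invSq m k := by
    refine isOneAdd_of_le (2 * C) ?_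
    filter_upwards [eventually_ge_atTop K] with k hk
    have hk0 : 0 < k := by linarith
    have hφ := hφpos k hk
    have h1 := (hΦ k hk).2
    rw [show 2 * k * Φ k / invSq m k - 1 = 2 * k / invSq m k * (Φ k - invSq m k / (2 * k)) by
      field_simp, abs_mul, abs_of_nonneg (by positivity)]
    calc _ ≤ 2 * k / invSq m k * (C * (invSq m k / k ^ 3)) := by gcongr
      _ = _ := by field_simp
  have oδ : IsOneAdd fun k => δ k * N k * Φ k / c k := by
    refine isOneAdd_of_le (16 / A₀ * T) ?_
    filter_upwards [ecomp, eδφ] with k h h1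
    obtain ⟨hk, hc2, -, -, -, g1, g2, -⟩ := h
    have hk0 : 0 < k := by linarith
    have hc0 : 0 < c k := by linarith
    rw [show δ k * N k * Φ k / c k - 1 = (δ k * N k * Φ k - c k) / c k by field_simp,
      abs_of_nonneg (div_nonneg (by linarith) hc0.le), div_le_iff₀ hc0]
    calc δ k * N k * Φ k - c k ≤ δ k * c k * T * (invSq m k / k ^ 3) := by linarith
      _ = δ k * invSq m k * (T * c k / k ^ 3) := by ring
      _ ≤ 16 / A₀ * k * (T * c k / k ^ 3) := by gcongr
      _ = _ := by field_simp
  -- `δ N Φ ~ c`, where `N ~ M`, `Φ ~ h⁻² / (2 k)` and `c ~ 1`.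
  have main : IsOneAdd fun k => δ k * (M * invSq m k / (2 * k)) := by
    refine ((oδ.mul oc).mul (oN.mul oΦ).inv).congr ?_
    filter_upwards [ecomp] with k h
    obtain ⟨hk, hc2, -, hN1, -, g1, -⟩ := h
    have hk0 : 0 < k := by linarith
    have hc0 : 0 < c k := by linarith
    have hN0 : 0 < N k := by linarith
    have hφ := hφpos k hk
    have hΦ0 : Φ k ≠ 0 := by
      intro h0
      rw [h0, mul_zero] at g1
      linarith
    field_simp
  refine ⟨main, ?_⟩
  -- By the Wronskian identity at `-k`, the derivative of `u` there is `δ N / h`.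
  refine (((main.pow 2).mul (oN.pow 2)).mul oN₂.inv).congr ?_
  filter_upwards [eventually_ge_atTop K] with k hk
  have hk0 : 0 < k := by linarith
  have hN₂0 : N₂ k ≠ 0 := (overlap_self_pos _ _).ne'
  have hw := weberDeriv_mul_of_zero (s' := -m) (hS.zero k (hK₀.le.trans hk))
  have h1 : invSq m k * weberFn (-m) (-k) ^ 2 = 1 := by
    unfold invSq
    exact inv_mul_cancel₀ (pow_ne_zero 2 (hneK k hk))
  have hw2 : weberDeriv (S k) (-k) ^ 2 = (δ k * N k) ^ 2 * invSq m k := by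
    have h2 : (weberDeriv (S k) (-k) * weberFn (-m) (-k)) ^ 2 = (δ k * N k) ^ 2 := by rw [hw]
    rw [← h2]
    linear_combination (-weberDeriv (S k) (-k) ^ 2) * h1
  rw [hw2, show overlap (S k) (S k) (-k) = N₂ k from rfl]
  field_simp
  ring

/-! ### Elements of `H¹(0, ∞)` as primitives -/

/-- Integration by parts against a primitive of a locally integrable function, by Fubini. -/
theorem integral_deriv_mul_primitive {Ψ Ψ' g : ℝ → ℂ} (hΨ : ∀ x, HasDerivAt Ψ (Ψ' x) x)
    (hΨ' : Continuous Ψ') (hg : ∀ a b, IntervalIntegrable g volume a b) {R : ℝ} (hR : 0 ≤ R) :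
    ∫ x in (0 : ℝ)..R, Ψ' x * ∫ t in (0 : ℝ)..x, g t =
      (Ψ R * ∫ t in (0 : ℝ)..R, g t) - ∫ x in (0 : ℝ)..R, Ψ x * g x := by
  have hgR : IntegrableOn g (Ioc 0 R) := (intervalIntegrable_iff_integrableOn_Ioc_of_le hR).1
    (hg 0 R)
  have hΨR : IntegrableOn Ψ' (Ioc 0 R) := (intervalIntegrable_iff_integrableOn_Ioc_of_le hR).1
    (hΨ'.intervalIntegrable 0 R)
  have hΨc : Continuous Ψ := continuous_iff_continuousAt.2 fun x => (hΨ x).continuousAt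
  set A : Set (ℝ × ℝ) := {p | p.2 ≤ p.1} with hA
  have hAm : MeasurableSet A := measurableSet_le measurable_snd measurable_fst
  have hint : Integrable (A.indicator fun p : ℝ × ℝ => Ψ' p.1 * g p.2)
      ((volume.restrict (Ioc 0 R)).prod (volume.restrict (Ioc 0 R))) :=
    (Integrable.mul_prod hΨR hgR).indicator hAm
  have hswap := integral_integral_swap (f := fun x t => A.indicator
    (fun p : ℝ × ℝ => Ψ' p.1 * g p.2) (x, t)) hint
  have e1 : ∀ x ∈ Ioc 0 R, ∫ t in Ioc 0 R, A.indicator (fun p : ℝ × ℝ => Ψ' p.1 * g p.2) (x, t) =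
      Ψ' x * ∫ t in (0 : ℝ)..x, g t := by
    intro x hx
    have : ∀ t, A.indicator (fun p : ℝ × ℝ => Ψ' p.1 * g p.2) (x, t) =
        (Iic x).indicator (fun t => Ψ' x * g t) t := fun t => by
      simp [indicator, hA]
    simp_rw [this]
    rw [setIntegral_indicator measurableSet_Iic, Ioc_inter_Iic, min_eq_right hx.2,
      intervalIntegral.integral_of_le hx.1.le, integral_const_mul]
  have e2 : ∀ t ∈ Ioc 0 R, ∫ x in Ioc 0 R, A.indicator (fun p : ℝ × ℝ => Ψ' p.1 * g p.2) (x, t) =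
      Ψ R * g t - Ψ t * g t := by
    intro t ht
    have : ∀ x, A.indicator (fun p : ℝ × ℝ => Ψ' p.1 * g p.2) (x, t) =
        (Ici t).indicator (fun x => Ψ' x * g t) x := fun x => by
      simp [indicator, hA]
    simp_rw [this]
    have hset : Ioc 0 R ∩ Ici t = Icc t R := by
      ext x
      simp only [mem_inter_iff, mem_Ioc, mem_Ici, mem_Icc]
      exact ⟨fun h => ⟨h.2, h.1.2⟩, fun h => ⟨⟨ht.1.trans_le h.1, h.2⟩, h.1⟩⟩
    rw [setIntegral_indicator measurableSet_Ici, hset, integral_Icc_eq_integral_Ioc,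
      ← intervalIntegral.integral_of_le ht.2, intervalIntegral.integral_mul_const,
      intervalIntegral.integral_eq_sub_of_hasDerivAt (fun x _ => hΨ x)
        (hΨ'.intervalIntegrable _ _), sub_mul]
  rw [setIntegral_congr_fun measurableSet_Ioc e1, setIntegral_congr_fun measurableSet_Ioc e2,
    ← intervalIntegral.integral_of_le hR, ← intervalIntegral.integral_of_le hR,
    intervalIntegral.integral_sub ((hg 0 R).const_mul _)
      ((hg 0 R).continuousOn_mul hΨc.continuousOn), intervalIntegral.integral_const_mul] at hswap
  exact hswap

theorem memLp_indicator (v : L2) : MemLp ((Ioi (0 : ℝ)).indicator v) 2 volume :=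
  (memLp_indicator_iff_restrict measurableSet_Ioi).2 (Lp.memLp v)

theorem intervalIntegrable_indicator (v : L2) (a b : ℝ) :
    IntervalIntegrable ((Ioi (0 : ℝ)).indicator v) volume a b :=
  (LocallyIntegrable.integrableOn_isCompact ((memLp_indicator v).locallyIntegrable (by norm_num))
    isCompact_uIcc).intervalIntegrable

/-- The primitive `x ↦ ∫₀^x v` of an element of `L²(0, ∞)`, constant for `x ≤ 0`. -/
noncomputable def primitive (v : L2) (x : ℝ) : ℂ := ∫ t in (0 : ℝ)..x, (Ioi (0 : ℝ)).indicator v t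

theorem continuous_primitive (v : L2) : Continuous (primitive v) :=
  intervalIntegral.continuous_primitive (intervalIntegrable_indicator v) 0

theorem setIntegral_Ioi_eq_of_zero {f : ℝ → ℂ} {R : ℝ} (hR : 0 ≤ R) (hf : ∀ x, R < x → f x = 0) :
    ∫ x in Ioi (0 : ℝ), f x = ∫ x in (0 : ℝ)..R, f x := by
  rw [intervalIntegral.integral_of_le hR]
  refine setIntegral_eq_of_subset_of_forall_sdiff_eq_zero measurableSet_Ioi Ioc_subset_Ioi_self ?_
  rintro x ⟨hx, hx'⟩
  refine hf x (not_le.1 fun h => hx' ⟨hx, h⟩)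

theorem integral_mul_indicator {f : ℝ → ℂ} (v : L2) {R : ℝ} (hR : 0 ≤ R) :
    ∫ x in (0 : ℝ)..R, f x * (Ioi (0 : ℝ)).indicator v x = ∫ x in (0 : ℝ)..R, f x * v x := by
  rw [intervalIntegral.integral_of_le hR, intervalIntegral.integral_of_le hR]
  refine setIntegral_congr_fun measurableSet_Ioc fun x hx => ?_
  simp only [indicator_of_mem (show x ∈ Ioi (0 : ℝ) from hx.1)]

/-- Integration by parts against a primitive, for functions that vanish at infinity but not
necessarily at the origin. -/
theorem integral_deriv_mul_primitive_Ioi {Ψ Ψ' : ℝ → ℂ} (hΨ : ∀ x, HasDerivAt Ψ (Ψ' x) x)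
    (hΨ' : Continuous Ψ') {R : ℝ} (hR : 0 ≤ R) (h0 : ∀ x, R ≤ x → Ψ x = 0)
    (h0' : ∀ x, R ≤ x → Ψ' x = 0) (v : L2) :
    ∫ x in Ioi (0 : ℝ), Ψ' x * primitive v x = -∫ x in Ioi (0 : ℝ), Ψ x * v x := by
  rw [setIntegral_Ioi_eq_of_zero hR (fun x hx => by rw [h0' x hx.le, zero_mul]),
    setIntegral_Ioi_eq_of_zero hR (fun x hx => by rw [h0 x hx.le, zero_mul])]
  have h := integral_deriv_mul_primitive hΨ hΨ' (intervalIntegrable_indicator v) hR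
  rw [h0 R le_rfl, zero_mul, zero_sub, integral_mul_indicator v hR] at h
  exact h

theorem exists_eq_zero_of_hasCompactSupport {f : ℝ → ℂ} (hf : HasCompactSupport f) :
    ∃ R : ℝ, 0 ≤ R ∧ ∀ x, R ≤ x → f x = 0 := by
  obtain ⟨R, hR⟩ := hf.isCompact.bddAbove
  refine ⟨max 0 (R + 1), le_max_left _ _, fun x hx => ?_⟩
  by_contra h
  have := hR (subset_tsupport _ h)
  have := le_max_right 0 (R + 1)
  linarith

theorem integral_deriv_mul_primitive_of_hasCompactSupport {Ψ : ℝ → ℂ} (hΨ : ContDiff ℝ 1 Ψ)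
    (hc : HasCompactSupport Ψ) (v : L2) :
    ∫ x in Ioi (0 : ℝ), deriv Ψ x * primitive v x = -∫ x in Ioi (0 : ℝ), Ψ x * v x := by
  obtain ⟨R₁, hR₁, h1⟩ := exists_eq_zero_of_hasCompactSupport hc
  obtain ⟨R₂, hR₂, h2⟩ := exists_eq_zero_of_hasCompactSupport hc.deriv
  exact integral_deriv_mul_primitive_Ioi
    (fun x => (hΨ.differentiable (by norm_num) x).hasDerivAt)
    (hΨ.continuous_deriv (by norm_num)) (R := max R₁ R₂) (hR₁.trans (le_max_left _ _))
    (fun x hx => h1 x ((le_max_left _ _).trans hx))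
    (fun x hx => h2 x ((le_max_right _ _).trans hx)) v

/-- A smooth function with compact support in `(0, ∞)` and vanishing integral is the derivative of
a test function. -/
theorem exists_test_deriv_eq {θ : ℝ → ℝ} (hθ : ContDiff ℝ (⊤ : ℕ∞) θ) (hc : HasCompactSupport θ)
    (hs : tsupport θ ⊆ Ioi 0) (hI : ∫ x, θ x = 0) :
    ∃ φ : Test, ∀ x, deriv φ x = θ x := by
  -- The primitive vanishes outside the interval `[a, b]`, as the integral of `θ` is zero.
  obtain ⟨a, b, ha, hab⟩ : ∃ a b : ℝ, 0 < a ∧ tsupport θ ⊆ Icc a b := by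
    rcases (tsupport θ).eq_empty_or_nonempty with he | hne
    · exact ⟨1, 1, one_pos, by simp [he]⟩
    · obtain ⟨a, ha⟩ := hc.isCompact.exists_isLeast hne
      obtain ⟨b, hb⟩ := hc.isCompact.bddAbove
      exact ⟨a, b, hs ha.1, fun x hx => ⟨ha.2 hx, hb hx⟩⟩
  have h0 : ∀ x, x ∉ Icc a b → θ x = 0 := fun x hx => by
    by_contra h
    exact hx (hab (subset_tsupport _ h))
  have hd : ∀ x, HasDerivAt (fun x => ((∫ t in (0 : ℝ)..x, θ t : ℝ) : ℂ)) (θ x) x := fun x =>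
    (intervalIntegral.integral_hasDerivAt_right (hθ.continuous.intervalIntegrable _ _)
      (hθ.continuous.stronglyMeasurableAtFilter _ _) hθ.continuous.continuousAt).ofReal_comp
  have hz : ∀ x, x ∉ Icc a b → ((∫ t in (0 : ℝ)..x, θ t : ℝ) : ℂ) = 0 := by
    intro x hx
    rw [Complex.ofReal_eq_zero]
    by_cases hxa : x < a
    · refine intervalIntegral.integral_zero_ae (Eventually.of_forall fun t ht => h0 t fun h => ?_)
      rw [uIoc, mem_Ioc] at ht
      exact absurd (ht.2.trans_lt (max_lt ha hxa)) (not_lt.2 h.1)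
    · have hbx : b < x := not_le.1 fun h => hx ⟨not_lt.1 hxa, h⟩
      rw [intervalIntegral.integral_eq_integral_of_support_subset, hI]
      intro t ht
      have := hab (subset_tsupport _ ht)
      exact ⟨ha.trans_le this.1, this.2.trans hbx.le⟩
  have hsub : tsupport (fun x => ((∫ t in (0 : ℝ)..x, θ t : ℝ) : ℂ)) ⊆ Icc a b :=
    closure_minimal (fun x hx => by
      by_contra h
      exact hx (hz x h)) isClosed_Icc
  refine ⟨⟨fun x => ((∫ t in (0 : ℝ)..x, θ t : ℝ) : ℂ), ?_,
    isCompact_Icc.of_isClosed_subset (isClosed_tsupport _) hsub,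
    hsub.trans fun x hx => ha.trans_le hx.1⟩, fun x => (hd x).deriv⟩
  refine contDiff_infty_iff_deriv.2 ⟨fun x => (hd x).differentiableAt, ?_⟩
  rw [show deriv (fun x => ((∫ t in (0 : ℝ)..x, θ t : ℝ) : ℂ)) = fun x => (θ x : ℂ) from
    funext fun x => (hd x).deriv]
  exact Complex.ofRealCLM.contDiff.comp hθ

theorem memLp_of_hasCompactSupport {f : ℝ → ℂ} (hf : Continuous f) (hc : HasCompactSupport f) :
    MemLp f 2 (volume.restrict (Ioi (0 : ℝ))) :=
  (hf.memLp_of_hasCompactSupport hc).restrict _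

/-- Du Bois-Reymond: an element of `H¹(0, ∞)` is, up to a constant, the primitive of its weak
derivative. -/
theorem exists_eq_const_add_primitive {u v : L2} (h : (u, v) ∈ weakDerivGraph) :
    ∃ c : ℂ, u =ᵐ[volume.restrict (Ioi (0 : ℝ))] fun x => c + primitive v x := by
  let B : ContDiffBump (2 : ℝ) := ⟨1 / 2, 1, by norm_num, by norm_num⟩
  set ρ : ℝ → ℝ := B.normed volume with hρ
  have hρd : ContDiff ℝ (⊤ : ℕ∞) ρ := B.contDiff_normed
  have hρc : HasCompactSupport ρ := B.hasCompactSupport_normed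
  have hρs : tsupport ρ ⊆ Ioi 0 := by
    rw [hρ, B.tsupport_normed_eq, Real.closedBall_eq_Icc]
    intro x hx
    have : (2 : ℝ) - 1 ≤ x := hx.1
    exact mem_Ioi.2 (by linarith)
  have hρI : ∫ x, ρ x = 1 := B.integral_normed
  set f : ℝ → ℂ := fun x => u x - primitive v x with hf
  have hfl : LocallyIntegrable f (volume.restrict (Ioi (0 : ℝ))) :=
    LocallyIntegrable.sub ((Lp.memLp u).locallyIntegrable (by norm_num))
      (continuous_primitive v).locallyIntegrable
  have hfg : ∀ {g : ℝ → ℝ}, Continuous g → HasCompactSupport g →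
      Integrable (fun x => g x • f x) (volume.restrict (Ioi (0 : ℝ))) := fun hg hgc =>
    hfl.integrable_smul_left_of_hasCompactSupport hg hgc
  have hIoi : ∀ {g : ℝ → ℝ}, tsupport g ⊆ Ioi 0 → ∫ x in Ioi (0 : ℝ), g x = ∫ x, g x :=
    fun hg => setIntegral_eq_integral_of_forall_compl_eq_zero fun x hx => by
      by_contra h
      exact hx (hg (subset_tsupport _ h))
  have key : ∀ {θ : ℝ → ℝ}, ContDiff ℝ (⊤ : ℕ∞) θ → HasCompactSupport θ → tsupport θ ⊆ Ioi 0 →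
      ∫ x, θ x = 0 → ∫ x in Ioi (0 : ℝ), θ x • f x = 0 := by
    intro θ hθ hθc hθs hθI
    obtain ⟨φ, hφ⟩ := exists_test_deriv_eq hθ hθc hθs hθI
    have h1 := h φ
    have h2 := integral_deriv_mul_primitive_of_hasCompactSupport
      ((contDiff_test φ).of_le (by norm_num)) φ.hasCompactSupport v
    have hi : IntegrableOn (fun x => deriv φ x * primitive v x) (Ioi 0) :=
      (((((contDiff_test φ).continuous_deriv (by norm_num)).mul
        (continuous_primitive v)).integrable_of_hasCompactSupport
          φ.hasCompactSupport.deriv.mul_right)).integrableOn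
    have h3 : ∀ x, θ x • f x = deriv φ x * u x - deriv φ x * primitive v x := fun x => by
      rw [hφ, hf, Complex.real_smul, mul_sub]
    simp_rw [h3]
    rw [integral_sub (integrable_deriv_test_mul φ u) hi]
    exact sub_eq_zero.2 (h1.trans h2.symm)
  refine ⟨∫ x in Ioi (0 : ℝ), ρ x • f x, ?_⟩
  set c := ∫ x in Ioi (0 : ℝ), ρ x • f x with hcdef
  have hae : ∀ᵐ x ∂(volume.restrict (Ioi (0 : ℝ))), x ∈ Ioi (0 : ℝ) → f x - c = 0 := by
    have hl : LocallyIntegrable (fun x => f x - c) (volume.restrict (Ioi (0 : ℝ))) :=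
      hfl.sub continuous_const.locallyIntegrable
    refine isOpen_Ioi.ae_eq_zero_of_integral_contDiff_smul_eq_zero (hl.locallyIntegrableOn _) ?_
    intro g hg hgc hgs
    set I := ∫ x, g x with hI
    have hgi : IntegrableOn g (Ioi 0) :=
      (hg.continuous.integrable_of_hasCompactSupport hgc).integrableOn
    have hρi : Integrable ρ := hρd.continuous.integrable_of_hasCompactSupport hρc
    have hθc : HasCompactSupport (fun x => g x - I * ρ x) := hgc.sub hρc.mul_left
    -- Subtracting a multiple of `ρ` makes the integral zero.
    have h1 := key (θ := fun x => g x - I * ρ x) (hg.sub (contDiff_const.mul hρd)) hθc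
      ((tsupport_sub g fun x => I * ρ x).trans (union_subset hgs
        ((closure_mono (Function.support_const_smul_subset I ρ)).trans hρs))) (by
        rw [integral_sub (hg.continuous.integrable_of_hasCompactSupport hgc) (hρi.const_mul I),
          integral_const_mul, hρI, mul_one, sub_self])
    have h2 : ∀ x, (g x - I * ρ x) • f x = g x • f x - (I : ℂ) * (ρ x • f x) := fun x => by
      simp only [Complex.real_smul]
      push_cast
      ring
    simp_rw [h2] at h1
    rw [integral_sub (hfg hg.continuous hgc) ((hfg hρd.continuous hρc).const_mul _),
      integral_const_mul, ← hcdef] at h1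
    simp_rw [smul_sub]
    rw [integral_sub (hfg hg.continuous hgc) (hgi.smul_const c), integral_smul_const, hIoi hgs,
      Complex.real_smul]
    exact h1
  filter_upwards [hae, ae_restrict_mem measurableSet_Ioi] with x hx hx0
  have := hx hx0
  rw [hf] at this
  linear_combination this

/-! ### Integration by parts and `H¹₀(0, ∞)` -/

theorem continuous_integral_mul {f : ℝ → ℂ} (hf : MemLp f 2 (volume.restrict (Ioi (0 : ℝ)))) :
    Continuous fun u : L2 => ∫ x in Ioi (0 : ℝ), f x * u x := by
  have h : (fun u : L2 => ∫ x in Ioi (0 : ℝ), f x * u x) = fun u : L2 =>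
      inner ℂ (hf.star.toLp (star f)) u := by
    funext u
    rw [L2.inner_def]
    refine integral_congr_ae ?_
    filter_upwards [hf.star.coeFn_toLp] with x hx
    rw [hx, RCLike.inner_apply, Pi.star_apply, ← starRingEnd_apply, starRingEnd_self_apply, mul_comm]
  rw [h]
  exact continuous_const.inner continuous_id

theorem tendsto_zero_of_integrableOn {f : ℝ → ℂ} (hf : IntegrableOn f (Ioi 0)) {a : ℂ}
    (h : Tendsto f atTop (𝓝 a)) : a = 0 := by
  refine IntegrableAtFilter.eq_zero_of_tendsto (⟨Ioi 0, Ioi_mem_atTop _, hf⟩ :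
    IntegrableAtFilter f atTop volume) (fun s hs => ?_) h
  obtain ⟨b, hb⟩ := mem_atTop_sets.1 hs
  exact top_unique ((Real.volume_Ici (a := b)).symm.le.trans (measure_mono fun x hx => hb x hx))

/-- Integration by parts on `(0, ∞)` of a square integrable function with square integrable
derivative against an element of `H¹(0, ∞)`; the boundary term at infinity vanishes because it has
a limit and is integrable. -/
theorem integral_deriv_mul_add_integral_mul {d d' : ℝ → ℂ} (hd : ∀ x, HasDerivAt d (d' x) x)
    (hc : Continuous d') (h1 : MemLp d 2 (volume.restrict (Ioi (0 : ℝ))))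
    (h2 : MemLp d' 2 (volume.restrict (Ioi (0 : ℝ)))) {u v : L2} {c : ℂ}
    (hu : u =ᵐ[volume.restrict (Ioi (0 : ℝ))] fun x => c + primitive v x) :
    (∫ x in Ioi (0 : ℝ), d' x * u x) + ∫ x in Ioi (0 : ℝ), d x * v x = -(d 0 * c) := by
  have i1 : IntegrableOn (fun x => d' x * u x) (Ioi 0) := h2.integrable_mul (Lp.memLp u)
  have i2 : IntegrableOn (fun x => d x * v x) (Ioi 0) := h1.integrable_mul (Lp.memLp v)
  have i3 : IntegrableOn (fun x => d x * (c + primitive v x)) (Ioi 0) := by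
    refine (h1.integrable_mul (Lp.memLp u)).congr ?_
    filter_upwards [hu] with x hx
    rw [Pi.mul_apply, hx]
  have hdc : Continuous d := continuous_iff_continuousAt.2 fun x => (hd x).continuousAt
  have key : ∀ R : ℝ, 0 ≤ R → d R * (c + primitive v R) =
      (∫ x in (0 : ℝ)..R, d' x * u x) + (∫ x in (0 : ℝ)..R, d x * v x) + d 0 * c := by
    intro R hR
    have e1 : ∫ x in (0 : ℝ)..R, d' x * u x =
        (∫ x in (0 : ℝ)..R, d' x * c) + ∫ x in (0 : ℝ)..R, d' x * primitive v x := by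
      rw [← intervalIntegral.integral_add (f := fun x => d' x * c)
        (g := fun x => d' x * primitive v x)
        ((hc.mul continuous_const).intervalIntegrable _ _)
        ((hc.mul (continuous_primitive v)).intervalIntegrable _ _)]
      refine intervalIntegral.integral_congr_ae_restrict ?_
      rw [uIoc_of_le hR]
      filter_upwards [ae_restrict_of_ae_restrict_of_subset Ioc_subset_Ioi_self hu] with x hx
      rw [hx, mul_add]
    have e2 := integral_deriv_mul_primitive hd hc (intervalIntegrable_indicator v) hR
    rw [integral_mul_indicator v hR] at e2
    rw [e1, intervalIntegral.integral_mul_const,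
      intervalIntegral.integral_eq_sub_of_hasDerivAt (fun x _ => hd x)
        (hc.intervalIntegrable _ _), show (∫ x in (0 : ℝ)..R, d' x * primitive v x) = _ from e2]
    unfold primitive
    ring
  have ht : Tendsto (fun R => d R * (c + primitive v R)) atTop
      (𝓝 ((∫ x in Ioi (0 : ℝ), d' x * u x) + (∫ x in Ioi (0 : ℝ), d x * v x) + d 0 * c)) := by
    refine Tendsto.congr' ?_ (((intervalIntegral_tendsto_integral_Ioi 0 i1 tendsto_id).add
      (intervalIntegral_tendsto_integral_Ioi 0 i2 tendsto_id)).add_const (d 0 * c))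
    filter_upwards [eventually_ge_atTop 0] with R hR
    exact (key R hR).symm
  exact eq_neg_of_add_eq_zero_left (tendsto_zero_of_integrableOn i3 ht)

theorem integral_deriv_test_mul_of_hasDerivAt (φ : Test) {d d' : ℝ → ℂ}
    (hd : ∀ x, HasDerivAt d (d' x) x) (hc : Continuous d') :
    ∫ x in Ioi (0 : ℝ), deriv φ x * d x = -∫ x in Ioi (0 : ℝ), φ x * d' x := by
  have hdc : Continuous d := continuous_iff_continuousAt.2 fun x => (hd x).continuousAt
  have hφ' : Continuous (deriv φ) := (contDiff_test φ).continuous_deriv (by norm_num)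
  have i1 : Integrable (fun x => deriv φ x * d x) :=
    (hφ'.mul hdc).integrable_of_hasCompactSupport φ.hasCompactSupport.deriv.mul_right
  have i2 : Integrable (fun x => φ x * d' x) :=
    (φ.continuous.mul hc).integrable_of_hasCompactSupport φ.hasCompactSupport.mul_right
  obtain ⟨R, hR, hR0⟩ := exists_eq_zero_of_hasCompactSupport φ.hasCompactSupport
  have hdm : ∀ x, HasDerivAt (fun x => φ x * d x) (deriv φ x * d x + φ x * d' x) x := fun x =>
    (differentiable_test φ x).hasDerivAt.mul (hd x)
  have ht : Tendsto (fun x => φ x * d x) atTop (𝓝 0) := tendsto_const_nhds.congr' (by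
    filter_upwards [eventually_ge_atTop R] with x hx
    rw [hR0 x hx, zero_mul])
  have h0 : φ 0 = 0 := by
    by_contra h
    exact lt_irrefl (0 : ℝ) (φ.tsupport_subset (subset_tsupport _ h))
  have h3 := integral_Ioi_of_hasDerivAt_of_tendsto' (fun x (_ : x ∈ Ici (0 : ℝ)) => hdm x)
    (i1.add i2).integrableOn ht
  rw [integral_add i1.integrableOn i2.integrableOn, h0, zero_mul, sub_zero] at h3
  exact eq_neg_of_add_eq_zero_left h3

/-- The Green identity for test functions passes to their closure in `H¹`. -/
theorem integral_deriv_mul_of_mem_closure {p : L2 × L2} (hp : p ∈ testGraph.topologicalClosure)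
    {Ψ : ℝ → ℂ} (hΨ : ContDiff ℝ 1 Ψ) (hc : HasCompactSupport Ψ) :
    (∫ x in Ioi (0 : ℝ), deriv Ψ x * p.1 x) + ∫ x in Ioi (0 : ℝ), Ψ x * p.2 x = 0 := by
  have hΨ' : Continuous (deriv Ψ) := hΨ.continuous_deriv (by norm_num)
  have m1 := memLp_of_hasCompactSupport hΨ.continuous hc
  have m2 := memLp_of_hasCompactSupport hΨ' hc.deriv
  have hcont : Continuous fun p : L2 × L2 =>
      (∫ x in Ioi (0 : ℝ), deriv Ψ x * p.1 x) + ∫ x in Ioi (0 : ℝ), Ψ x * p.2 x :=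
    ((continuous_integral_mul m2).comp continuous_fst).add
      ((continuous_integral_mul m1).comp continuous_snd)
  have hcl : IsClosed {p : L2 × L2 |
      (∫ x in Ioi (0 : ℝ), deriv Ψ x * p.1 x) + ∫ x in Ioi (0 : ℝ), Ψ x * p.2 x = 0} :=
    isClosed_eq hcont continuous_const
  refine closure_minimal (fun q hq => ?_) hcl hp
  obtain ⟨φ, h1, h2⟩ := hq
  have e1 : ∫ x in Ioi (0 : ℝ), deriv Ψ x * q.1 x = ∫ x in Ioi (0 : ℝ), deriv Ψ x * φ x :=
    integral_congr_ae (by filter_upwards [h1] with x hx; rw [hx])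
  have e2 : ∫ x in Ioi (0 : ℝ), Ψ x * q.2 x = ∫ x in Ioi (0 : ℝ), Ψ x * deriv φ x :=
    integral_congr_ae (by filter_upwards [h2] with x hx; rw [hx])
  have h := integral_deriv_test_mul_of_hasDerivAt φ
    (fun x => (hΨ.differentiable (by norm_num) x).hasDerivAt) hΨ'
  simp_rw [mul_comm (φ _), mul_comm (deriv φ _)] at h
  rw [mem_ofPred_eq, e1, e2, h, add_neg_cancel]

theorem mem_weakDerivGraph_of_mem_closure {p : L2 × L2} (hp : p ∈ testGraph.topologicalClosure) :
    p ∈ weakDerivGraph := fun φ =>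
  eq_neg_of_add_eq_zero_left (integral_deriv_mul_of_mem_closure hp
    ((contDiff_test φ).of_le (by norm_num)) φ.hasCompactSupport)

/-- An element of `H¹₀(0, ∞)` vanishes at the origin: it is the primitive of its weak
derivative. -/
theorem eq_primitive_of_mem_closure {p : L2 × L2} (hp : p ∈ testGraph.topologicalClosure) :
    p.1 =ᵐ[volume.restrict (Ioi (0 : ℝ))] primitive p.2 := by
  obtain ⟨c, hc⟩ := exists_eq_const_add_primitive (u := p.1) (v := p.2)
    (mem_weakDerivGraph_of_mem_closure hp)
  -- Testing with a function that is `1` at the origin singles out the constant.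
  let B : ContDiffBump (0 : ℝ) := ⟨1, 2, by norm_num, by norm_num⟩
  have hB : ContDiff ℝ 1 fun x => (B x : ℂ) := Complex.ofRealCLM.contDiff.comp B.contDiff
  have hBc : HasCompactSupport fun x => (B x : ℂ) :=
    B.hasCompactSupport.comp_left (g := fun r : ℝ => (r : ℂ)) (by simp)
  have h1 := integral_deriv_mul_of_mem_closure hp hB hBc
  rw [integral_deriv_mul_add_integral_mul
    (fun x => (hB.differentiable (by norm_num) x).hasDerivAt) (hB.continuous_deriv (by norm_num))
    (memLp_of_hasCompactSupport hB.continuous hBc)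
    (memLp_of_hasCompactSupport (hB.continuous_deriv (by norm_num)) hBc.deriv) hc,
    B.one_of_mem_closedBall (by simp [B]), Complex.ofReal_one, one_mul, neg_eq_zero] at h1
  simpa [h1] using hc

/-- A pair is in the `H¹` closure of the test functions if it satisfies the Green identity without
boundary term against all elements of `H¹(0, ∞)`: otherwise a separating functional, represented
by two elements of `L²`, would be such an element. -/
theorem mem_closure_testGraph {p : L2 × L2} (hp : ∀ u v : L2, (u, v) ∈ weakDerivGraph →
    (∫ x in Ioi (0 : ℝ), u x * p.2 x) + ∫ x in Ioi (0 : ℝ), v x * p.1 x = 0) :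
    p ∈ testGraph.topologicalClosure := by
  by_contra hn
  obtain ⟨F, r, hF, hr⟩ := RCLike.geometric_hahn_banach_closed_point (𝕜 := ℂ)
    (testGraph.topologicalClosure.restrictScalars ℝ).convex
    testGraph.isClosed_topologicalClosure hn
  have hF0 : ∀ q ∈ testGraph, F q = 0 := by
    intro q hq
    by_contra hne
    -- A functional bounded above on a subspace vanishes there.
    have h1 : ((((r + 1 : ℝ) : ℂ) / F q) • q) ∈ testGraph.topologicalClosure :=
      testGraph.le_topologicalClosure (testGraph.smul_mem _ hq)
    have h2 := hF _ h1
    rw [map_smul, smul_eq_mul, div_mul_cancel₀ _ hne] at h2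
    simp only [RCLike.re_to_complex, Complex.ofReal_re] at h2
    linarith
  have hr0 : 0 < r := by simpa using hF 0 (zero_mem _)
  have hFp : F p ≠ 0 := fun h => by
    rw [h, map_zero] at hr
    linarith
  set v : L2 := star ((InnerProductSpace.toDual ℂ L2).symm
    (F.comp (ContinuousLinearMap.inl ℂ L2 L2))) with hv
  set u : L2 := star ((InnerProductSpace.toDual ℂ L2).symm
    (F.comp (ContinuousLinearMap.inr ℂ L2 L2))) with hu
  have hrep : ∀ (G : StrongDual ℂ L2) (a : L2), ∫ x in Ioi (0 : ℝ),
      (star ((InnerProductSpace.toDual ℂ L2).symm G) : L2) x * a x = G a := by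
    intro G a
    rw [← InnerProductSpace.toDual_symm_apply (𝕜 := ℂ), L2.inner_def]
    refine integral_congr_ae ?_
    filter_upwards [Lp.coeFn_star ((InnerProductSpace.toDual ℂ L2).symm G)] with x hx
    rw [hx, RCLike.inner_apply, Pi.star_apply, ← starRingEnd_apply, mul_comm]
  have hFq : ∀ q : L2 × L2, F q = (∫ x in Ioi (0 : ℝ), u x * q.2 x) +
      ∫ x in Ioi (0 : ℝ), v x * q.1 x := by
    intro q
    rw [hu, hv, hrep, hrep]
    simp only [ContinuousLinearMap.comp_apply, ContinuousLinearMap.inl_apply,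
      ContinuousLinearMap.inr_apply]
    rw [← map_add, Prod.mk_add_mk, zero_add, add_zero]
  refine hFp ((hFq p).trans (hp u v fun φ => ?_))
  have h1 := hF0 ((memLp_test φ).toLp φ, (memLp_deriv_test φ).toLp (deriv φ))
    ⟨φ, (memLp_test φ).coeFn_toLp, (memLp_deriv_test φ).coeFn_toLp⟩
  rw [hFq] at h1
  refine eq_neg_of_add_eq_zero_left (Eq.trans ?_ h1)
  congr 1
  · refine integral_congr_ae ?_
    filter_upwards [(memLp_deriv_test φ).coeFn_toLp] with x hx
    rw [hx, mul_comm]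
  · refine integral_congr_ae ?_
    filter_upwards [(memLp_test φ).coeFn_toLp] with x hx
    rw [hx, mul_comm]

/-- A square integrable `C¹` function with square integrable derivative belongs to `H¹(0, ∞)`. -/
theorem mem_weakDerivGraph_of_hasDerivAt {d d' : ℝ → ℂ} (hd : ∀ x, HasDerivAt d (d' x) x)
    (hc : Continuous d') (h1 : MemLp d 2 (volume.restrict (Ioi (0 : ℝ))))
    (h2 : MemLp d' 2 (volume.restrict (Ioi (0 : ℝ)))) :
    (h1.toLp d, h2.toLp d') ∈ weakDerivGraph := by
  intro φ
  have e1 : ∫ x in Ioi (0 : ℝ), deriv φ x * (h1.toLp d) x = ∫ x in Ioi (0 : ℝ), deriv φ x * d x :=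
    integral_congr_ae (by filter_upwards [h1.coeFn_toLp] with x hx; rw [hx])
  have e2 : ∫ x in Ioi (0 : ℝ), φ x * (h2.toLp d') x = ∫ x in Ioi (0 : ℝ), φ x * d' x :=
    integral_congr_ae (by filter_upwards [h2.coeFn_toLp] with x hx; rw [hx])
  change ∫ x in Ioi (0 : ℝ), deriv φ x * (h1.toLp d) x =
    -∫ x in Ioi (0 : ℝ), φ x * (h2.toLp d') x
  rw [e1, e2, integral_deriv_test_mul_of_hasDerivAt φ hd hc]

/-- A square integrable `C¹` function with square integrable derivative which vanishes at the
origin belongs to `H¹₀(0, ∞)`. -/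
theorem mem_closure_testGraph_of_hasDerivAt {d d' : ℝ → ℂ} (hd : ∀ x, HasDerivAt d (d' x) x)
    (hc : Continuous d') (h1 : MemLp d 2 (volume.restrict (Ioi (0 : ℝ))))
    (h2 : MemLp d' 2 (volume.restrict (Ioi (0 : ℝ)))) (h0 : d 0 = 0) :
    (h1.toLp d, h2.toLp d') ∈ testGraph.topologicalClosure := by
  refine mem_closure_testGraph fun u v huv => ?_
  obtain ⟨c, hu⟩ := exists_eq_const_add_primitive huv
  have h := integral_deriv_mul_add_integral_mul hd hc h1 h2 hu
  rw [h0, zero_mul, neg_zero] at h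
  refine Eq.trans ?_ h
  congr 1
  · refine integral_congr_ae ?_
    filter_upwards [h2.coeFn_toLp] with x hx
    rw [hx, mul_comm]
  · refine integral_congr_ae ?_
    filter_upwards [h1.coeFn_toLp] with x hx
    rw [hx, mul_comm]

/-! ### The eigenspaces -/

theorem mem_H1_of_mem_weakDerivGraph {u v : L2} (h : (u, v) ∈ weakDerivGraph) : u ∈ H1 := by
  rw [← weakDeriv_graph, LinearPMap.mem_graph_iff] at h
  obtain ⟨y, rfl : (y : L2) = u, -⟩ := h
  exact y.2

theorem weakDeriv_mem_graph {u : L2} (hu : u ∈ H1) :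
    (u, weakDeriv ⟨u, hu⟩) ∈ weakDerivGraph := by
  rw [← weakDeriv_graph]
  exact weakDeriv.mem_graph ⟨u, hu⟩

theorem weakDerivGraph_unique {u v w : L2} (hv : (u, v) ∈ weakDerivGraph)
    (hw : (u, w) ∈ weakDerivGraph) : v = w :=
  sub_eq_zero.1 (weakDerivGraph_functional _ (sub_mem hv hw) (sub_self u))

theorem weakDeriv_eq {u v : L2} (h : (u, v) ∈ weakDerivGraph) (hu : u ∈ H1) :
    weakDeriv ⟨u, hu⟩ = v :=
  weakDerivGraph_unique (weakDeriv_mem_graph hu) h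

theorem exists_of_mem_eigenspace {k ν : ℝ} {u : L2} (hu : u ∈ eigenspace k ν) :
    ∃ v w : L2, (u, v) ∈ testGraph.topologicalClosure ∧ (v, w) ∈ weakDerivGraph ∧
      w =ᵐ[volume.restrict (Ioi (0 : ℝ))] fun x => (((x - k) ^ 2 - ν : ℝ) : ℂ) * u x := by
  obtain ⟨hd, he⟩ := hu
  obtain ⟨h1, h2⟩ := hd.1.2
  obtain ⟨⟨a, v⟩, hp, rfl : a = u⟩ := hd.1.1
  have hq : a ∈ sqWeighted := hd.2
  have hp' : weakDeriv ⟨a, h1⟩ = v := weakDeriv_eq (mem_weakDerivGraph_of_mem_closure hp) h1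
  refine ⟨weakDeriv ⟨a, h1⟩, weakDeriv ⟨weakDeriv ⟨a, h1⟩, h2⟩, ?_, weakDeriv_mem_graph h2, ?_⟩
  · rw [hp']
    exact hp
  · have he' : -weakDeriv ⟨weakDeriv ⟨a, h1⟩, h2⟩ + (memLp_potential k hq).toLp
        (fun x : ℝ => ((x : ℂ) - k) ^ 2 * a x) = (ν : ℂ) • a := he
    have he2 : weakDeriv ⟨weakDeriv ⟨a, h1⟩, h2⟩ = (memLp_potential k hq).toLp
        (fun x : ℝ => ((x : ℂ) - k) ^ 2 * a x) - (ν : ℂ) • a := by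
      rw [← he']
      abel
    rw [he2]
    filter_upwards [Lp.coeFn_sub ((memLp_potential k hq).toLp
        (fun x : ℝ => ((x : ℂ) - k) ^ 2 * a x)) ((ν : ℂ) • a), Lp.coeFn_smul (ν : ℂ) a,
      (memLp_potential k hq).coeFn_toLp] with x e1 e2 e3
    rw [e1, Pi.sub_apply, e2, e3, Pi.smul_apply, smul_eq_mul]
    push_cast
    ring

theorem mem_eigenspace_of_mem_closure {k ν : ℝ} {u v w : L2}
    (h1 : (u, v) ∈ testGraph.topologicalClosure) (h2 : (v, w) ∈ weakDerivGraph)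
    (h3 : u ∈ sqWeighted)
    (h4 : w =ᵐ[volume.restrict (Ioi (0 : ℝ))] fun x => (((x - k) ^ 2 - ν : ℝ) : ℂ) * u x) :
    u ∈ eigenspace k ν := by
  have hg := mem_weakDerivGraph_of_mem_closure h1
  have hu : u ∈ H1 := mem_H1_of_mem_weakDerivGraph hg
  have hv : weakDeriv ⟨u, hu⟩ = v := weakDeriv_eq hg hu
  have hv' : weakDeriv ⟨u, hu⟩ ∈ H1 := hv ▸ mem_H1_of_mem_weakDerivGraph h2
  refine ⟨⟨⟨⟨(u, v), h1, rfl⟩, hu, hv'⟩, h3⟩, ?_⟩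
  change -weakDeriv ⟨weakDeriv ⟨u, hu⟩, hv'⟩ + (memLp_potential k h3).toLp
        (fun x : ℝ => ((x : ℂ) - k) ^ 2 * u x) = (ν : ℂ) • u
  rw [weakDeriv_eq (v := w) (by rw [hv]; exact h2), neg_add_eq_sub, sub_eq_iff_eq_add]
  refine Lp.ext ?_
  filter_upwards [(memLp_potential k h3).coeFn_toLp, Lp.coeFn_add ((ν : ℂ) • u) w,
    Lp.coeFn_smul (ν : ℂ) u, h4] with x a b c d
  rw [a, b, Pi.add_apply, c, d, Pi.smul_apply, smul_eq_mul]
  push_cast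
  ring

theorem memLp_shift {f : ℝ → ℝ} (hf : Continuous f) {k : ℝ}
    (h : ∃ C : ℝ, 0 ≤ C ∧ ∀ x, -k ≤ x → |f x| ≤ C * Real.exp (-x ^ 2 / 4)) :
    MemLp (fun x : ℝ => (f (x - k) : ℂ)) 2 (volume.restrict (Ioi (0 : ℝ))) := by
  have h1 : MemLp f 2 (volume.restrict (Ioi (-k))) := by
    rw [memLp_two_iff_integrable_sq hf.aestronglyMeasurable]
    simp_rw [sq]
    exact integrableOn_mul_of_gauss_bound hf hf h h
  have h2 := (measurePreserving_sub_right volume k).restrict_preimage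
    (measurableSet_Ioi (a := -k))
  rw [preimage_sub_const_Ioi, neg_add_cancel] at h2
  exact (h1.comp_measurePreserving h2).ofReal

theorem memLp_weberFn (s k : ℝ) :
    MemLp (fun x : ℝ => (weberFn s (x - k) : ℂ)) 2 (volume.restrict (Ioi (0 : ℝ))) :=
  memLp_shift (continuous_weberFn s) (exists_abs_weberFn_le s (-k))

theorem memLp_weberDeriv (s k : ℝ) :
    MemLp (fun x : ℝ => (weberDeriv s (x - k) : ℂ)) 2 (volume.restrict (Ioi (0 : ℝ))) :=
  memLp_shift (continuous_weberDeriv s) (exists_abs_weberDeriv_le s (-k))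

theorem memLp_sq_mul_weberFn (s k : ℝ) :
    MemLp (fun x : ℝ => (((x - k) ^ 2 * weberFn s (x - k) : ℝ) : ℂ)) 2
      (volume.restrict (Ioi (0 : ℝ))) := by
  refine memLp_shift (f := fun x => x ^ 2 * weberFn s x)
    ((continuous_pow 2).mul (continuous_weberFn s)) ?_
  obtain ⟨C, hC, h⟩ := exists_abs_mul_weberFn_le s (-k)
  exact ⟨C, hC, fun x hx => by rw [abs_mul, abs_pow]; exact h x hx⟩

theorem memLp_potential_mul_weberFn (s k ν : ℝ) :
    MemLp (fun x : ℝ => ((((x - k) ^ 2 - ν) * weberFn s (x - k) : ℝ) : ℂ)) 2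
      (volume.restrict (Ioi (0 : ℝ))) := by
  refine ((memLp_sq_mul_weberFn s k).sub ((memLp_weberFn s k).const_mul (ν : ℂ))).ae_eq ?_
  refine Eventually.of_forall fun x => ?_
  simp only [Pi.sub_apply]
  push_cast
  ring

/-- The parabolic cylinder function `x ↦ D s (x - k)` as an element of `L²(0, ∞)`. -/
noncomputable def eigenfunction (s k : ℝ) : L2 :=
  (memLp_weberFn s k).toLp fun x : ℝ => (weberFn s (x - k) : ℂ)

theorem eigenfunction_mem_sqWeighted (s k : ℝ) : eigenfunction s k ∈ sqWeighted := by
  have hb := ((memLp_sq_mul_weberFn s k).norm.const_mul 2).add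
    ((memLp_weberFn s k).norm.const_mul (2 * k ^ 2))
  refine hb.of_le ?_ ?_
  · exact (Continuous.aestronglyMeasurable (by fun_prop)).mul (Lp.aestronglyMeasurable _)
  · filter_upwards [(memLp_weberFn s k).coeFn_toLp] with x hx
    rw [eigenfunction, hx]
    simp only [Pi.add_apply, norm_mul, norm_pow, Complex.norm_real, Real.norm_eq_abs, sq_abs]
    refine le_trans ?_ (le_abs_self _)
    nlinarith [mul_nonneg (sq_nonneg (x - 2 * k)) (abs_nonneg (weberFn s (x - k)))]

theorem hasDerivAt_weberFn_shift (s k x : ℝ) :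
    HasDerivAt (fun x : ℝ => (weberFn s (x - k) : ℂ)) (weberDeriv s (x - k) : ℂ) x :=
  ((hasDerivAt_weberFn s (x - k)).comp_sub_const x k).ofReal_comp

theorem hasDerivAt_weberDeriv_shift (s k x : ℝ) :
    HasDerivAt (fun x : ℝ => (weberDeriv s (x - k) : ℂ))
      ((((x - k) ^ 2 - (1 - 2 * s)) * weberFn s (x - k) : ℝ) : ℂ) x := by
  refine (((hasDerivAt_weberDeriv s (x - k)).comp_sub_const x k).ofReal_comp).congr_deriv ?_
  congr 1
  ring

theorem eigenfunction_mem_eigenspace {s k : ℝ} (h0 : weberFn s (-k) = 0) :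
    eigenfunction s k ∈ eigenspace k (1 - 2 * s) := by
  have c1 : Continuous fun x : ℝ => (weberDeriv s (x - k) : ℂ) :=
    Complex.continuous_ofReal.comp ((continuous_weberDeriv s).comp (continuous_sub_right k))
  have c2 : Continuous fun x : ℝ => ((((x - k) ^ 2 - (1 - 2 * s)) * weberFn s (x - k) : ℝ) : ℂ) :=
    Complex.continuous_ofReal.comp (((by fun_prop : Continuous fun x : ℝ =>
      (x - k) ^ 2 - (1 - 2 * s))).mul ((continuous_weberFn s).comp (continuous_sub_right k)))
  refine mem_eigenspace_of_mem_closure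
    (mem_closure_testGraph_of_hasDerivAt (hasDerivAt_weberFn_shift s k) c1 (memLp_weberFn s k)
      (memLp_weberDeriv s k) (by rw [zero_sub, h0, Complex.ofReal_zero]))
    (mem_weakDerivGraph_of_hasDerivAt (hasDerivAt_weberDeriv_shift s k) c2
      (memLp_weberDeriv s k) (memLp_potential_mul_weberFn s k (1 - 2 * s)))
    (eigenfunction_mem_sqWeighted s k) ?_
  filter_upwards [(memLp_potential_mul_weberFn s k (1 - 2 * s)).coeFn_toLp,
    (memLp_weberFn s k).coeFn_toLp] with x a b
  rw [a, eigenfunction, b, Complex.ofReal_mul]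

/-- An eigenfunction has a classical representative: the eigenvalue equation integrates twice to a
continuous integral equation. -/
theorem exists_classical_of_mem_eigenspace {k ν : ℝ} {u : L2} (hu : u ∈ eigenspace k ν) :
    ∃ U V : ℝ → ℂ, (∀ x, HasDerivAt U (V x) x) ∧
      (∀ x, 0 ≤ x → HasDerivAt V ((((x - k) ^ 2 - ν : ℝ) : ℂ) * U x) x) ∧ U 0 = 0 ∧
      u =ᵐ[volume.restrict (Ioi (0 : ℝ))] U ∧ MemLp V 2 (volume.restrict (Ioi (0 : ℝ))) := by
  obtain ⟨v, w, h1, h2, h3⟩ := exists_of_mem_eigenspace hu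
  have hu : u =ᵐ[volume.restrict (Ioi (0 : ℝ))] primitive v := eq_primitive_of_mem_closure h1
  obtain ⟨c, hv⟩ := exists_eq_const_add_primitive h2
  -- Replacing `u` by its continuous representative in the equation for `w` makes `v` and then
  -- `u` differentiable.
  set W : ℝ → ℂ := fun x => (((x - k) ^ 2 - ν : ℝ) : ℂ) * primitive v x with hW
  have hWc : Continuous W := (Complex.continuous_ofReal.comp (by fun_prop)).mul
    (continuous_primitive v)
  set V : ℝ → ℂ := fun x => c + ∫ t in (0 : ℝ)..x, W t with hV
  have hVd : ∀ x, HasDerivAt V (W x) x := fun x =>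
    (intervalIntegral.integral_hasDerivAt_right (hWc.intervalIntegrable _ _)
      (hWc.stronglyMeasurableAtFilter _ _) hWc.continuousAt).const_add c
  have hVc : Continuous V := continuous_iff_continuousAt.2 fun x => (hVd x).continuousAt
  have hprim : ∀ {g : L2} {G : ℝ → ℂ}, g =ᵐ[volume.restrict (Ioi (0 : ℝ))] G → ∀ x, 0 ≤ x →
      primitive g x = ∫ t in (0 : ℝ)..x, G t := by
    intro g G hg x hx
    refine intervalIntegral.integral_congr_ae_restrict ?_
    rw [uIoc_of_le hx]
    filter_upwards [ae_restrict_of_ae_restrict_of_subset Ioc_subset_Ioi_self hg,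
      ae_restrict_mem measurableSet_Ioc] with t ht ht0
    rw [indicator_of_mem (show t ∈ Ioi (0 : ℝ) from ht0.1), ht]
  have hw : w =ᵐ[volume.restrict (Ioi (0 : ℝ))] W := by
    filter_upwards [h3, hu] with x a b
    rw [a, b]
  have hvV : v =ᵐ[volume.restrict (Ioi (0 : ℝ))] V := by
    filter_upwards [hv, ae_restrict_mem measurableSet_Ioi] with x a b
    rw [a, hprim hw x (le_of_lt b)]
  refine ⟨fun x => ∫ t in (0 : ℝ)..x, V t, V, fun x =>
    intervalIntegral.integral_hasDerivAt_right (hVc.intervalIntegrable _ _)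
      (hVc.stronglyMeasurableAtFilter _ _) hVc.continuousAt, fun x hx => ?_,
    intervalIntegral.integral_same, ?_, (Lp.memLp v).ae_eq hvV⟩
  · beta_reduce
    rw [← hprim hvV x hx]
    exact hVd x
  · filter_upwards [hu, ae_restrict_mem measurableSet_Ioi] with x a b
    rw [a, hprim hvV x (le_of_lt b)]

/-- Uniqueness for the Cauchy problem of the eigenvalue equation on `[0, ∞)`. -/
theorem eq_zero_of_cauchy {k ν : ℝ} {U V : ℝ → ℂ} (hU : ∀ x, HasDerivAt U (V x) x)
    (hV : ∀ x, 0 ≤ x → HasDerivAt V ((((x - k) ^ 2 - ν : ℝ) : ℂ) * U x) x) (hU0 : U 0 = 0)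
    (hV0 : V 0 = 0) {x : ℝ} (hx : 0 ≤ x) : U x = 0 := by
  have hd : ∀ y, 0 ≤ y → HasDerivAt (fun y => (U y, V y))
      (V y, (((y - k) ^ 2 - ν : ℝ) : ℂ) * U y) y := fun y hy => (hU y).prodMk (hV y hy)
  have h := eq_zero_of_abs_deriv_le_mul_abs_self_of_eq_zero_right (f := fun y => (U y, V y))
    (f' := fun y => (V y, (((y - k) ^ 2 - ν : ℝ) : ℂ) * U y)) (a := 0) (b := x)
    (K := 1 + ((x + |k|) ^ 2 + |ν|)) (fun y hy => (hd y hy.1).continuousAt.continuousWithinAt)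
    (fun y hy => (hd y hy.1).hasDerivWithinAt) (by simp [hU0, hV0]) ?_ x ⟨hx, le_rfl⟩
  · exact congrArg Prod.fst h
  · intro y hy
    have hU1 : ‖U y‖ ≤ ‖(U y, V y)‖ := norm_fst_le (U y, V y)
    have hV1 : ‖V y‖ ≤ ‖(U y, V y)‖ := norm_snd_le (U y, V y)
    have hn := norm_nonneg (U y, V y)
    have hq : |(y - k) ^ 2 - ν| ≤ (x + |k|) ^ 2 + |ν| := by
      refine (abs_sub _ _).trans (add_le_add ?_ le_rfl)
      rw [abs_pow]
      refine pow_le_pow_left₀ (abs_nonneg _) ((abs_sub _ _).trans (add_le_add ?_ le_rfl)) 2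
      rw [abs_of_nonneg hy.1]
      exact hy.2.le
    have hM : 0 ≤ (x + |k|) ^ 2 + |ν| := by positivity
    rw [Prod.norm_mk, max_le_iff, norm_mul, Complex.norm_real, Real.norm_eq_abs]
    constructor
    · nlinarith [mul_nonneg hM hn]
    · nlinarith [mul_le_mul hq hU1 (norm_nonneg _) hM]

/-- The Wronskian of an eigenfunction with the decaying solution vanishes, since it is constant and
integrable on the half-line. Hence the eigenspace is spanned by the decaying solution, which must
satisfy the Dirichlet condition. -/
theorem exists_smul_of_mem_eigenspace {k s : ℝ} {u : L2} (hu : u ∈ eigenspace k (1 - 2 * s)) :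
    ∃ c : ℂ, u = c • eigenfunction s k ∧ c * weberFn s (-k) = 0 := by
  obtain ⟨U, V, hU, hV, hU0, huU, hVm⟩ := exists_classical_of_mem_eigenspace hu
  set d : ℝ → ℂ := fun x => (weberFn s (x - k) : ℂ) with hd
  set d' : ℝ → ℂ := fun x => (weberDeriv s (x - k) : ℂ) with hd'
  have hUm : MemLp U 2 (volume.restrict (Ioi (0 : ℝ))) := (Lp.memLp u).ae_eq huU
  have hWd : ∀ x, 0 ≤ x → HasDerivAt (fun x => U x * d' x - V x * d x) 0 x := by
    intro x hx
    refine (((hU x).mul (hasDerivAt_weberDeriv_shift s k x)).sub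
      ((hV x hx).mul (hasDerivAt_weberFn_shift s k x))).congr_deriv ?_
    push_cast
    ring
  have hWc : ∀ x, 0 ≤ x → U x * d' x - V x * d x = -(V 0 * d 0) := by
    intro x hx
    have := constant_of_has_deriv_right_zero (f := fun x => U x * d' x - V x * d x) (a := 0) (b := x)
      (fun y hy => (hWd y hy.1).continuousAt.continuousWithinAt)
      (fun y hy => (hWd y hy.1).hasDerivWithinAt) x ⟨hx, le_rfl⟩
    simpa [hU0] using this
  have hWi : IntegrableOn (fun x => U x * d' x - V x * d x) (Ioi 0) :=
    (hUm.integrable_mul (memLp_weberDeriv s k)).sub (hVm.integrable_mul (memLp_weberFn s k))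
  have hW0 : V 0 * d 0 = 0 := neg_eq_zero.1 (tendsto_zero_of_integrableOn hWi
    (tendsto_const_nhds.congr' (by
      filter_upwards [eventually_ge_atTop 0] with x hx
      exact (hWc x hx).symm)))
  -- A multiple of `d` with the same Cauchy data at the origin as `U`.
  obtain ⟨c, hc0, hc1⟩ : ∃ c : ℂ, c * d 0 = 0 ∧ V 0 - c * d' 0 = 0 := by
    by_cases h0 : d 0 = 0
    · have hne : d' 0 ≠ 0 := by
        rw [hd, Complex.ofReal_eq_zero] at h0
        exact Complex.ofReal_ne_zero.2 (weberDeriv_ne_zero h0)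
      exact ⟨V 0 / d' 0, by rw [h0, mul_zero], by rw [div_mul_cancel₀ _ hne, sub_self]⟩
    · exact ⟨0, zero_mul _, by rw [(mul_eq_zero.1 hW0).resolve_right h0, zero_mul, sub_zero]⟩
  refine ⟨c, Lp.ext ?_, by simpa [hd] using hc0⟩
  have hz : ∀ x, 0 ≤ x → U x - c * d x = 0 := fun x hx =>
    eq_zero_of_cauchy (k := k) (ν := 1 - 2 * s) (U := fun x => U x - c * d x)
      (V := fun x => V x - c * d' x)
      (fun x => (hU x).sub ((hasDerivAt_weberFn_shift s k x).const_mul c))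
      (fun x hx => ((hV x hx).sub ((hasDerivAt_weberDeriv_shift s k x).const_mul c)).congr_deriv
        (by push_cast; ring)) (by rw [hU0, hc0, sub_zero]) hc1 hx
  filter_upwards [huU, Lp.coeFn_smul c (eigenfunction s k), (memLp_weberFn s k).coeFn_toLp,
    ae_restrict_mem measurableSet_Ioi] with x a b e hx
  rw [a, b, Pi.smul_apply, smul_eq_mul, eigenfunction, e]
  exact sub_eq_zero.1 (hz x (le_of_lt hx))

theorem inner_eigenfunction (s s' k : ℝ) :
    inner ℂ (eigenfunction s k) (eigenfunction s' k) = (overlap s s' (-k) : ℂ) := by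
  have h1 : ∫ x in Ioi (0 : ℝ), weberFn s (x - k) * weberFn s' (x - k) = overlap s s' (-k) := by
    rw [overlap, ← (measurePreserving_sub_right volume k).setIntegral_preimage_emb
      (measurableEmbedding_subRight k) _ (Ioi (-k)), preimage_sub_const_Ioi, neg_add_cancel]
  rw [L2.inner_def, ← h1, ← integral_complex_ofReal]
  refine integral_congr_ae ?_
  filter_upwards [(memLp_weberFn s k).coeFn_toLp, (memLp_weberFn s' k).coeFn_toLp] with x a b
  rw [eigenfunction, eigenfunction, a, b, RCLike.inner_apply, Complex.conj_ofReal,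
    Complex.ofReal_mul, mul_comm]

theorem eigenfunction_ne_zero (s k : ℝ) : eigenfunction s k ≠ 0 := fun h => by
  have h1 := inner_eigenfunction s s k
  rw [h, inner_zero_left] at h1
  exact (overlap_self_pos s (-k)).ne (Complex.ofReal_eq_zero.1 h1.symm).symm

theorem inner_eigenfunction_eq_zero {s s' k : ℝ} (h : weberFn s (-k) = 0)
    (h' : weberFn s' (-k) = 0) (hne : s ≠ s') :
    inner ℂ (eigenfunction s k) (eigenfunction s' k) = 0 := by
  have hw := weberWronskian_eq s s' (-k)
  rw [weberWronskian, h, h', mul_zero, zero_mul, sub_zero, zero_eq_mul] at hw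
  rw [inner_eigenfunction, hw.resolve_left (mul_ne_zero two_ne_zero (sub_ne_zero.2 hne.symm)),
    Complex.ofReal_zero]

/-! ### Counting eigenvalues -/

/-- The zeros of `s ↦ J s a` in `[-(m + 1), ∞)`: one between each pair of consecutive integers
in `[-(m + 1), 0]`, and no others. -/
theorem exists_zeros {a : ℝ} (m : ℕ) (h : ∀ j ≤ m + 1, 0 < (-1 : ℝ) ^ j * hermiteFn (-j) a) :
    ∃ σ : ℕ → ℝ, (∀ j ≤ m, σ j ∈ Ioo (-(j : ℝ) - 1) (-j) ∧ hermiteFn (σ j) a = 0 ∧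
      (∀ t, σ j < t → t ≤ -j → 0 < (-1 : ℝ) ^ j * hermiteFn t a) ∧
      ∀ t, -(j : ℝ) - 1 ≤ t → t < σ j → (-1 : ℝ) ^ j * hermiteFn t a < 0) ∧
      ∀ t, -(m : ℝ) - 1 ≤ t → hermiteFn t a = 0 → ∃ j ≤ m, t = σ j := by
  have hex : ∀ j : ℕ, ∃ s : ℝ, j ≤ m → s ∈ Ioo (-(j : ℝ) - 1) (-j) ∧ hermiteFn s a = 0 ∧
      (∀ t, s < t → t ≤ -j → 0 < (-1 : ℝ) ^ j * hermiteFn t a) ∧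
      ∀ t, -(j : ℝ) - 1 ≤ t → t < s → (-1 : ℝ) ^ j * hermiteFn t a < 0 := by
    intro j
    by_cases hj : j ≤ m
    · obtain ⟨s, hs⟩ := exists_unique_order (a := a) j fun i hi => h i (hi.trans (by omega))
      exact ⟨s, fun _ => hs⟩
    · exact ⟨0, fun h => absurd h hj⟩
  choose σ hσ using hex
  refine ⟨σ, hσ, fun t ht h0 => ?_⟩
  have ht0 : t < 0 := by
    by_contra hle
    exact (hermiteFn_pos (not_lt.1 hle) a).ne' h0
  -- The zero `t` lies in `(-(j + 1), -j]`.
  have hf1 : (⌊-t⌋₊ : ℝ) ≤ -t := Nat.floor_le (by linarith)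
  have hf2 : -t < ⌊-t⌋₊ + 1 := Nat.lt_floor_add_one _
  set j := ⌊-t⌋₊ with hj
  have hjm : j ≤ m := by
    by_contra hlt
    have h1 : (m : ℝ) + 1 ≤ j := by exact_mod_cast not_le.1 hlt
    have h2 : t = -((m + 1 : ℕ) : ℝ) := by push_cast; linarith
    have h3 := h (m + 1) le_rfl
    rw [← h2, h0, mul_zero] at h3
    exact lt_irrefl _ h3
  obtain ⟨-, -, hpos, hneg⟩ := hσ j hjm
  refine ⟨j, hjm, ?_⟩
  rcases lt_trichotomy t (σ j) with hlt | heq | hgt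
  · have := hneg t (by linarith) hlt
    rw [h0, mul_zero] at this
    exact absurd this (lt_irrefl _)
  · exact heq
  · have := hpos t hgt (by linarith)
    rw [h0, mul_zero] at this
    exact absurd this (lt_irrefl _)

/-- Distinct zeros give orthogonal eigenfunctions, so they bound the number of eigenvalues from
below. -/
theorem le_eigenvalueCount {k μ : ℝ} {n : ℕ} {σ : ℕ → ℝ} (hσ : ∀ j < n, hermiteFn (σ j) (-k) = 0)
    (hinj : ∀ i < n, ∀ j < n, i ≠ j → σ i ≠ σ j) (hμ : ∀ j < n, 1 - 2 * σ j ≤ μ) :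
    (n : Cardinal) ≤ eigenvalueCount k μ := by
  have hz : ∀ j : Fin n, weberFn (σ j) (-k) = 0 := fun j => weberFn_eq_zero_iff.2 (hσ j j.2)
  have hli : LinearIndependent ℂ fun j : Fin n => eigenfunction (σ j) k :=
    linearIndependent_of_ne_zero_of_inner_eq_zero (fun j => eigenfunction_ne_zero _ _)
      fun i j hij => inner_eigenfunction_eq_zero (hz i) (hz j)
        (hinj i i.2 j j.2 fun h => hij (Fin.ext h))
  have hmem : ∀ j : Fin n, eigenfunction (σ j) k ∈ (⨆ ν ∈ Iic μ, eigenspace k ν : Submodule ℂ L2) :=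
    fun j => Submodule.mem_iSup_of_mem (1 - 2 * σ j) (Submodule.mem_iSup_of_mem (hμ j j.2)
      (eigenfunction_mem_eigenspace (hz j)))
  have hli' : LinearIndependent ℂ fun j : Fin n =>
      (⟨eigenfunction (σ j) k, hmem j⟩ : (⨆ ν ∈ Iic μ, eigenspace k ν : Submodule ℂ L2)) :=
    LinearIndependent.of_comp (Submodule.subtype _) hli
  rw [eigenvalueCount]
  simpa using hli'.cardinal_le_rank

/-- Each eigenspace is spanned by an eigenfunction belonging to a zero, so the zeros bound the
number of eigenvalues from above. -/
theorem eigenvalueCount_le {k μ : ℝ} {n : ℕ} {σ : ℕ → ℝ}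
    (hσ : ∀ t, (1 - μ) / 2 ≤ t → hermiteFn t (-k) = 0 → ∃ j < n, t = σ j) :
    eigenvalueCount k μ ≤ n := by
  classical
  set T : Finset L2 := (Finset.range n).image fun j => eigenfunction (σ j) k with hT
  have hle : (⨆ ν ∈ Iic μ, eigenspace k ν : Submodule ℂ L2) ≤ Submodule.span ℂ (T : Set L2) := by
    refine iSup₂_le fun ν hν u hu => ?_
    have hν' : ν = 1 - 2 * ((1 - ν) / 2) := by ring
    rw [hν'] at hu
    obtain ⟨c, rfl, hc⟩ := exists_smul_of_mem_eigenspace hu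
    rcases mul_eq_zero.1 hc with hc | hc
    · rw [hc, zero_smul]
      exact zero_mem _
    · have hνμ : ν ≤ μ := hν
      obtain ⟨j, hj, he⟩ := hσ _ (by linarith)
        (weberFn_eq_zero_iff.1 (Complex.ofReal_eq_zero.1 hc))
      refine Submodule.smul_mem _ _ (Submodule.subset_span ?_)
      rw [he, hT, Finset.mem_coe]
      exact Finset.mem_image_of_mem _ (Finset.mem_range.2 hj)
  calc eigenvalueCount k μ ≤ Module.rank ℂ (Submodule.span ℂ (T : Set L2)) :=
        Submodule.rank_mono hle
    _ ≤ T.card := rank_span_finset_le T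
    _ ≤ n := by
        exact_mod_cast Finset.card_image_le.trans (Finset.card_range n).le

/-- For large `k` the band function with index `m + 1` is `1 - 2 S k`, where `S` is the branch of
zeros between `-(m + 1)` and `-m`. -/
theorem isBranch_bandFunction (m : ℕ) :
    ∃ K, IsBranch m K fun k => (1 - bandFunction (m + 1) k) / 2 := by
  have hev : ∀ᶠ k : ℝ in atTop, ∀ j ∈ Finset.range (m + 2),
      0 < (-1 : ℝ) ^ j * hermiteFn (-j) (-k) :=
    (Finset.eventually_all _).2 fun j _ => eventually_hermiteFn_neg_nat_pos j
  obtain ⟨K, hK⟩ := eventually_atTop.1 hev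
  have key : ∀ k, K ≤ k → ∃ s ∈ Ioo (-(m : ℝ) - 1) (-m), (1 - bandFunction (m + 1) k) / 2 = s ∧
      hermiteFn s (-k) = 0 ∧ (∀ t, s < t → t ≤ -m → 0 < (-1 : ℝ) ^ m * hermiteFn t (-k)) ∧
      ∀ t, -(m : ℝ) - 1 ≤ t → t < s → (-1 : ℝ) ^ m * hermiteFn t (-k) < 0 := by
    intro k hk
    obtain ⟨σ, hσ, hall⟩ := exists_zeros (a := -k) m fun j hj =>
      hK k hk j (Finset.mem_range.2 (by omega))
    have hlt : ∀ i j, i < j → j ≤ m → σ j < σ i := by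
      intro i j hij hj
      have h1 := (hσ j hj).1.2
      have h2 := (hσ i (by omega)).1.1
      have h3 : (i : ℝ) + 1 ≤ j := by exact_mod_cast hij
      linarith
    have hband : bandFunction (m + 1) k = 1 - 2 * σ m := by
      refine IsLeast.csInf_eq ⟨?_, fun μ hμ => ?_⟩
      · refine le_eigenvalueCount (σ := σ) (fun j hj => (hσ j (by omega)).2.1)
          (fun i hi j hj hij => ?_) fun j hj => ?_
        · rcases lt_or_gt_of_ne hij with h | h
          · exact (hlt i j h (by omega)).ne'
          · exact (hlt j i h (by omega)).ne
        · rcases (Nat.lt_succ_iff.1 hj).eq_or_lt with h | h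
          · rw [h]
          · have := hlt j m h le_rfl
            linarith
      · by_contra hlt'
        have hcount : eigenvalueCount k μ ≤ m := eigenvalueCount_le (σ := σ) fun t ht h0 => by
          have h1 := (hσ m le_rfl).1.1
          obtain ⟨j, hj, rfl⟩ := hall t (by linarith) h0
          refine ⟨j, lt_of_le_of_ne hj fun h => ?_, rfl⟩
          rw [h] at ht
          linarith
        have h2 : ((m + 1 : ℕ) : Cardinal) ≤ (m : ℕ) := le_trans hμ hcount
        have h3 := Nat.cast_le.1 h2
        omega
    exact ⟨σ m, (hσ m le_rfl).1, by rw [hband]; ring, (hσ m le_rfl).2⟩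
  refine ⟨K, fun k hk => ?_, fun k hk => ?_, fun k hk => ?_, fun k hk => ?_⟩ <;>
  · obtain ⟨s, h1, h2, h3, h4, h5⟩ := key k hk
    rw [h2]
    first | exact h1 | exact h3 | exact h4 | exact h5

/-! ### Asymptotics of the band functions -/

theorem inv_invSq_eq {m : ℕ} {k : ℝ} (hk : k ≠ 0) :
    (invSq m k)⁻¹ = ((-1 : ℝ) ^ m * hermiteFn (-m) (-k) / k ^ m) ^ 2 * (k ^ (2 * m) *
      Real.exp (-k ^ 2)) := by
  have h1 : Real.exp (-(-k) ^ 2 / 2) ^ 2 = Real.exp (-k ^ 2) := by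
    rw [← Real.exp_nat_mul]
    congr 1
    push_cast
    ring
  have h2 : ((-1 : ℝ) ^ m) ^ 2 = 1 := by
    rw [← pow_mul, mul_comm, pow_mul]
    ring
  have h3 : k ^ (2 * m) = (k ^ m) ^ 2 := by rw [← pow_mul, mul_comm]
  have hkm : k ^ m ≠ 0 := pow_ne_zero _ hk
  rw [invSq, inv_inv, weberFn, mul_pow, h1, div_pow, mul_pow, h2, h3]
  field_simp

/-- Both asymptotics in terms of the norm of the `m`-th Hermite function, for the band with index
`m + 1`. -/
theorem bandFunction_asymptotics (m : ℕ) :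
    (∃ f : ℝ → ℝ, IsOneAdd f ∧ ∀ᶠ k : ℝ in atTop, bandFunction (m + 1) k =
      landauLevel (m + 1) + 2 / hermiteNorm m * k ^ (2 * m + 1) * Real.exp (-k ^ 2) * f k) ∧
    ∃ f : ℝ → ℝ, IsOneAdd f ∧ ∀ᶠ k : ℝ in atTop, HasDerivAt (bandFunction (m + 1))
      (-(4 / hermiteNorm m * k ^ (2 * m + 2) * Real.exp (-k ^ 2) * f k)) k := by
  obtain ⟨K, hS⟩ := isBranch_bandFunction m
  obtain ⟨h1, h2⟩ := hS.asymptotics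
  have hB := (isOneAdd_hermiteFn m).pow 2
  have hM := (hermiteNorm_pos m).ne'
  have hne : ∀ᶠ k : ℝ in atTop, invSq m k ≠ 0 := by
    filter_upwards [eventually_hermiteFn_neg_nat_pos m] with k hk
    refine (invSq_pos fun h => ?_).ne'
    rw [weberFn_eq_zero_iff.1 h, mul_zero] at hk
    exact lt_irrefl _ hk
  refine ⟨⟨_, h1.mul hB, ?_⟩, ⟨_, h2.mul hB, ?_⟩⟩
  · filter_upwards [hne, eventually_gt_atTop 0] with k hk hk0
    have e := inv_invSq_eq (m := m) hk0.ne'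
    set J := ((-1 : ℝ) ^ m * hermiteFn (-m) (-k) / k ^ m) ^ 2
    have e2 : bandFunction (m + 1) k - landauLevel (m + 1) =
        2 * (-m - (1 - bandFunction (m + 1) k) / 2) := by
      rw [landauLevel]
      push_cast
      ring
    set δ := 2 * (-(m : ℝ) - (1 - bandFunction (m + 1) k) / 2)
    have e3 : 2 / hermiteNorm m * k ^ (2 * m + 1) * Real.exp (-k ^ 2) *
        (δ * (hermiteNorm m * invSq m k / (2 * k)) * J) = δ := by
      calc _ = δ * invSq m k * (J * (k ^ (2 * m) * Real.exp (-k ^ 2))) := by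
              field_simp
              ring
        _ = δ := by rw [← e, mul_assoc, mul_inv_cancel₀ hk, mul_one]
    rw [e3, ← e2]
    ring
  · filter_upwards [hne, eventually_gt_atTop 0, eventually_gt_atTop K] with k hk hk0 hkK
    have e := inv_invSq_eq (m := m) hk0.ne'
    set J := ((-1 : ℝ) ^ m * hermiteFn (-m) (-k) / k ^ m) ^ 2
    have hd := ((hS.hasDerivAt hkK).const_mul 2).const_sub 1
    have hband : (fun k => 1 - 2 * ((1 - bandFunction (m + 1) k) / 2)) = bandFunction (m + 1) :=
      funext fun k => by ring
    rw [hband] at hd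
    refine hd.congr_deriv ?_
    set s := (1 - bandFunction (m + 1) k) / 2
    have hov := (overlap_self_pos s (-k)).ne'
    set Q := weberDeriv s (-k) ^ 2 / overlap s s (-k) with hQ
    have e3 : 4 / hermiteNorm m * k ^ (2 * m + 2) * Real.exp (-k ^ 2) *
        (Q * (hermiteNorm m * invSq m k / (4 * k ^ 2)) * J) = Q := by
      calc _ = Q * invSq m k * (J * (k ^ (2 * m) * Real.exp (-k ^ 2))) := by
              field_simp
              ring
        _ = Q := by rw [← e, mul_assoc, mul_inv_cancel₀ hk, mul_one]
    rw [e3, hQ]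
    field_simp

end HalfLine

theorem mainTheorem1 (n : ℕ) (hn : 1 ≤ n) :
    ∃ γ : ℝ, 0 < γ ∧
      (∃ ε : ℝ → ℝ, ε =O[atTop] (fun k : ℝ => k ^ (-2 : ℤ)) ∧
        ∀ᶠ k : ℝ in atTop, HalfLine.bandFunction n k =
          HalfLine.landauLevel n +
            2 ^ (2 * n - 1) * γ ^ 2 * k ^ (2 * n - 1) * Real.exp (-k ^ 2) * (1 + ε k)) ∧
      (∃ ε : ℝ → ℝ, ε =O[atTop] (fun k : ℝ => k ^ (-2 : ℤ)) ∧
        ∀ᶠ k : ℝ in atTop, HasDerivAt (HalfLine.bandFunction n)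
          (-(2 ^ (2 * n) * γ ^ 2 * k ^ (2 * n) * Real.exp (-k ^ 2) * (1 + ε k))) k) := by
  obtain ⟨m, rfl⟩ : ∃ m, n = m + 1 := ⟨n - 1, by omega⟩
  have hM := HalfLine.hermiteNorm_pos m
  obtain ⟨⟨f, hf, h1⟩, g, hg, h2⟩ := HalfLine.bandFunction_asymptotics m
  have hγ : Real.sqrt ((2 ^ (2 * m) * HalfLine.hermiteNorm m)⁻¹) ^ 2 =
      (2 ^ (2 * m) * HalfLine.hermiteNorm m)⁻¹ := Real.sq_sqrt (by positivity)
  -- The constant is `γ² = 1 / (2^(2 m) ‖h‖²)` with the Hermite function `h` of degree `m`.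
  refine ⟨Real.sqrt ((2 ^ (2 * m) * HalfLine.hermiteNorm m)⁻¹), by positivity,
    ⟨fun k => f k - 1, hf, ?_⟩, ⟨fun k => g k - 1, hg, ?_⟩⟩
  · filter_upwards [h1] with k hk
    rw [hk, hγ, show 2 * (m + 1) - 1 = 2 * m + 1 by omega, add_sub_cancel, pow_succ 2]
    field_simp
  · filter_upwards [h2] with k hk
    refine hk.congr_deriv ?_
    rw [hγ, show 2 * (m + 1) = 2 * m + 2 by omega, add_sub_cancel, pow_add 2]
    field_simp
    ring
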